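/- Let $n\ge 1$ and $0<\delta<1$. With $\hat f(\xi)=\int_{\mathbb{R}^n} e^{-2\pi i x\cdot\xi}f(x)\,dx$, let $\Sigma_\delta(\mathbb{R}^n)$ be the space of $f\in L^2(\mathbb{R}^n;\mathbb{C})$ with $$\|f\|_{\Sigma_\delta}^2:=\big\||x|^\delta f\big\|_2^2+\big\||\xi|^\delta \hat f\big\|_2^2<\infty .$$ For $f\in\Sigma_\delta(\mathbb{R}^n)$ let $u(\cdot,t)\in L^2(\mathbb{R}^n)$, given by $\hat u(\xi,t)=e^{-\pi i t|\xi|^2}\hat f(\xi)$, be the solution of $\partial_t u=\frac{i}{4\pi}\Delta u$, $u(\cdot,0)=f$, and let $$h_\delta[f](t):=\int_{\mathbb{R}^n}|x|^{2\delta}|u(x,t)|^2\,dx,\qquad t\in\mathbb{R}.$$ Fix a smooth cutoff $\zeta:\mathbb{R}\to[0,1]$, supported in $[-1,1]$ and equal to $1$ on $[-\frac12,\frac12]$. For an interval $I=[a,b]$ let $P_I$ be the Fourier multiplier on $\mathbb{R}$ with symbol $\zeta\big((|\xi|-\frac{a+b}{2})/(b-a)\big)$. For $\alpha>0$ let $\Lambda^\alpha(\mathbb{R})$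 be the space of functions $g\in L^\infty(\mathbb{R})$ for which there is a finite $C$ with $$\|P_{[0,1]}g\|_\infty\le C\quad\text{and}\quad \|P_{[2^k,2^{k+1}]}g\|_\infty\le C\,2^{-\alpha k}\ \text{ for all integers } k\ge 0,$$ and let $\|g\|_{\Lambda^\alpha}$ be the least such $C$. Then the following hold. 1. If $f\in\Sigma_\delta(\mathbb{R}^n)$, then $h_\delta[f](t)<\infty$ for every $t\in\mathbb{R}$. 2. Let $\alpha=2\delta$ if $n\ge2$, or if $n=1$ and $\delta<\frac12$; let $\alpha$ be any number in $(0,1)$ if $n=1$ and $\delta=\frac12$; let $\alpha=\frac14+\frac32\delta$ if $n=1$ and $\delta>\frac12$. For every $\psi\in C_0^\infty(\mathbb{R})$ there is a constant $C$, depending only on $n,\delta,\alpha,\psi,\zeta$, such that for every $f\in\Sigma_\delta(\mathbb{R}^n)$ the function $\psi h_\delta[f]$ belongs to $\Lambda^\alpha(\mathbb{R})$ and $$\|\psi h_\delta[f]\|_{\Lambda^\alpha}\le C\,\|f\|_{\Sigma_\delta}^2 .$$ 3. The exponents are best possible, up to the end point in the case $n=1$, $\delta=\frac12$: put $\alpha_*=\frac14+\frac32\delta$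 if $n=1$ and $\delta>\frac12$, and $\alpha_*=2\delta$ otherwise. For every $\beta>\alpha_*$ there are $f\in\Sigma_\delta(\mathbb{R}^n)$ and $\psi\in C_0^\infty(\mathbb{R})$ such that $\psi h_\delta[f]\notin\Lambda^\beta(\mathbb{R})$. 4. If $\delta>\frac12$, then $h_\delta[f]\in C^1(\mathbb{R})$ for every $f\in\Sigma_\delta(\mathbb{R}^n)$. -/

import Mathlib

open MeasureTheory FourierTransform
open scoped ENNReal NNReal ContDiff

namespace SchrodingerDispersion

/-- `L²(ℝⁿ; ℂ)`. -/
abbrev L2 (n : ℕ) : Type :=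
  Lp (α := EuclideanSpace ℝ (Fin n)) ℂ 2 (volume : Measure (EuclideanSpace ℝ (Fin n)))

/-- `‖|x|^δ f‖₂`, with value `∞` allowed. -/
noncomputable def weightedNorm {n : ℕ} (δ : ℝ) (f : L2 n) : ℝ≥0∞ :=
  eLpNorm (fun x : EuclideanSpace ℝ (Fin n) => ((‖x‖ ^ δ : ℝ) : ℂ) * f x) 2 volume

/-- `‖f‖_{Σ_δ}² = ‖|x|^δ f‖₂² + ‖D^δ f‖₂²`, with value `∞` allowed. Here `D^δ f` has Fourier
transform `|ξ|^δ f̂(ξ)`, so its `L²` norm is the weighted norm of `f̂` by Plancherel. -/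
noncomputable def sigmaNormSq {n : ℕ} (δ : ℝ) (f : L2 n) : ℝ≥0∞ :=
  weightedNorm δ f ^ 2 + weightedNorm δ (𝓕 f : L2 n) ^ 2

/-- Membership in `Σ_δ(ℝⁿ)`, for `f ∈ L²(ℝⁿ)`. -/
def MemSigma {n : ℕ} (δ : ℝ) (f : L2 n) : Prop :=
  sigmaNormSq δ f < ⊤

theorem memLp_phase_mul {n : ℕ} (t : ℝ) (g : L2 n) :
    MemLp (fun ξ : EuclideanSpace ℝ (Fin n) =>
      Complex.exp (((-(Real.pi * t * ‖ξ‖ ^ 2) : ℝ) : ℂ) * Complex.I) * g ξ) 2 volume := by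
  refine (Lp.memLp g).of_le (AEStronglyMeasurable.mul ?_ (Lp.aestronglyMeasurable g)) ?_
  · exact Continuous.aestronglyMeasurable (by fun_prop)
  · refine Filter.Eventually.of_forall fun ξ => ?_
    rw [norm_mul, Complex.norm_exp_ofReal_mul_I, one_mul]

/-- The solution `u(·, t) = e^{itħΔ/2} f` at time `t` of `∂ₜ u = (i/2) ħ Δ u`, `u(·, 0) = f`, where
`ħ = 1/(2π)`; on the Fourier side, `û(ξ, t) = e^{-πit|ξ|²} f̂(ξ)`. -/
noncomputable def schrodinger {n : ℕ} (t : ℝ) (f : L2 n) : L2 n :=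
  𝓕⁻ ((memLp_phase_mul t (𝓕 f : L2 n)).toLp _ : L2 n)

/-- The density `|x|^{2δ} |u(x,t)|²`. -/
noncomputable def dispersionDensity {n : ℕ} (δ : ℝ) (f : L2 n) (t : ℝ)
    (x : EuclideanSpace ℝ (Fin n)) : ℝ :=
  ‖x‖ ^ (2 * δ) * ‖schrodinger t f x‖ ^ 2

/-- `h_δ[f](t) = ∫ |x|^{2δ} |u(x,t)|² dx`. -/
noncomputable def dispersion {n : ℕ} (δ : ℝ) (f : L2 n) (t : ℝ) : ℝ :=
  ∫ x, dispersionDensity δ f t x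

/-- A smooth cutoff of `[-1, 1]`. -/
structure IsCutoff (ζ : ℝ → ℝ) : Prop where
  smooth : ContDiff ℝ ∞ ζ
  nonneg : ∀ x, 0 ≤ ζ x
  le_one : ∀ x, ζ x ≤ 1
  support_subset : Function.support ζ ⊆ Set.Icc (-1) 1
  eq_one : ∀ x ∈ Set.Icc (-(1 / 2) : ℝ) (1 / 2), ζ x = 1

/-- The symbol `ζ((|ξ| - c(I)) / |I|)`, where `I = [a, b]` has center `c(I)` and length `|I|`. -/
noncomputable def freqSymbol (ζ : ℝ → ℝ) (a b : ℝ) (ξ : ℝ) : ℂ :=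
  ((ζ ((|ξ| - (a + b) / 2) / (b - a)) : ℝ) : ℂ)

/-- The projection `P_{[a,b]} g` of a bounded function `g` to frequencies `|ξ| ∈ [a, b]`: the
Fourier multiplier with symbol `freqSymbol ζ a b`, that is, the convolution of `g` with the inverse
Fourier transform of the symbol (a Schwartz function, for the intervals used below). -/
noncomputable def freqProj (ζ : ℝ → ℝ) (a b : ℝ) (g : ℝ → ℂ) (x : ℝ) : ℂ :=
  ∫ y, (𝓕⁻ (freqSymbol ζ a b)) (x - y) * g y

/-- The norm of `Λ^α(ℝ)`: the least `C` such that `‖P_{[0,1]} g‖_∞ ≤ C` and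
`‖P_{[2^k,2^{k+1}]} g‖_∞ ≤ C 2^{-αk}` for all `k ≥ 0`. -/
noncomputable def lipschitzNorm (ζ : ℝ → ℝ) (α : ℝ) (g : ℝ → ℂ) : ℝ≥0∞ :=
  max (eLpNorm (freqProj ζ 0 1 g) ⊤ volume)
    (⨆ k : ℕ, ENNReal.ofReal ((2 : ℝ) ^ (α * (k : ℝ))) *
      eLpNorm (freqProj ζ (2 ^ k) (2 ^ (k + 1)) g) ⊤ volume)

/-- Membership in the Lipschitz (Hölder–Zygmund) space `Λ^α(ℝ)`. -/
def MemLipschitz (ζ : ℝ → ℝ) (α : ℝ) (g : ℝ → ℂ) : Prop :=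
  MemLp g ⊤ volume ∧ lipschitzNorm ζ α g < ⊤

/-- The exponents `α` for which `ψ h_δ[f] ∈ Λ^α` is asserted: `α = 2δ` if `n ≥ 2`, or if `n = 1`
and `δ < 1/2`; every `0 < α < 1` if `n = 1` and `δ = 1/2`; `α = 1/4 + 3δ/2` if `n = 1` and
`δ > 1/2`. -/
def IsRegularityExponent (n : ℕ) (δ α : ℝ) : Prop :=
  ((2 ≤ n ∨ (n = 1 ∧ δ < 1 / 2)) ∧ α = 2 * δ) ∨
  ((n = 1 ∧ δ = 1 / 2) ∧ 0 < α ∧ α < 1) ∨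
  ((n = 1 ∧ 1 / 2 < δ) ∧ α = 1 / 4 + 3 / 2 * δ)

/-- The threshold that the exponents cannot exceed: `2δ` if `n ≥ 2`, or if `n = 1` and `δ ≤ 1/2`
(so it is `1` if `n = 1` and `δ = 1/2`); `1/4 + 3δ/2` if `n = 1` and `δ > 1/2`. -/
noncomputable def criticalExponent (n : ℕ) (δ : ℝ) : ℝ :=
  if n = 1 ∧ 1 / 2 < δ then 1 / 4 + 3 / 2 * δ else 2 * δ

end SchrodingerDispersion

namespace SchrodingerDispersion

/-! ### Plancherel's identity for translation differences -/

/-! The weight |x|^{2δ} becomes a double integral on the Fourier side. Translating ĝ by v multiplies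
g by a character, and ∫ |e^{-2πi v·x} - 1|² |v|^{-(n+2δ)} dv = c|x|^{2δ}, so c‖|x|^δ g‖₂² is the
integral of |ĝ(ξ) - ĝ(η)|² |ξ-η|^{-(n+2δ)} over all pairs
(`lintegral_fourier_sub_gagliardoMeasure`). For g = u(·,t) and F = f̂ the integrand is
|e^{-πit|ξ|²}F(ξ) - e^{-πit|η|²}F(η)|². Finiteness at every time follows by splitting off the
difference of the phases (`gagliardoEnergy_phase_mul_le`).

Time enters only through the cross term of the pair, with frequency (|ξ|²-|η|²)/2. In the second
difference h(t+s) + h(t-s) - 2h(t) the terms |F(ξ)|² and |F(η)|² cancel, which leaves at most a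
constant times min(1, s²(|ξ|²-|η|²)²)|F(ξ)||F(η)| (`norm_sq_second_difference`). Where |ξ| and |η|
are comparable, ||ξ|²-|η|²| is at most a multiple of |ξ||ξ-η| and scaling gives |s|^{2δ}
(`oscillationForm_le`). Where |η| is much smaller than |ξ|, the kernel is |ξ|^{-n-2δ} min(1,
s²|ξ|⁴). Schur's test with a power weight then gives |s|^{δ+δ'} for δ' ≤ δ, δ' < n/2
(`exists_farForm_le`); δ' = δ is allowed if n ≥ 2 or δ < 1/2. If n = 1 and δ > 1/2, F is integrable,
and Cauchy-Schwarz in ξ alone gives |s|^{1/4+3δ/2} (`exists_farForm_le_of_half_lt`).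

A bound of second differences by |s|^α survives multiplication by ψ
(`exists_mul_second_difference_le`). It bounds the dyadic projections because their kernel is even
with mean zero (`norm_integral_kernel_mul_le_of_second_difference`). If α > 1 it also yields C¹
(`SecondDifferenceLE.contDiff_one`), and both exponents exceed 1 when δ > 1/2.

For sharpness take f̂ = (1+|ξ|)^{-p} with p slightly above n/2 + δ. The dyadic piece of h at time 0
is then -2/c times a double integral with nonnegative integrand
(`IsGagliardoConstant.integral_kernel_mul_dispersion`), so restricting to pairs |ξ| ~ 2^{k/2}, |η| <
r bounds its absolute value from below. The choice r = 2^{k/2} produces the exponent 2δ, the choice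
r = 1 produces n/4 + 3δ/2, each up to a small error. Localising by a ψ with 1 - ψ = O(t²) costs only
2^{-2k}, and the critical exponent is below 2. -/

/-- The multiplier `e^{-2πi x·v} - 1`, whose counterpart on the Fourier side is the translation
difference by `v`. -/
noncomputable def diffMultiplier {n : ℕ} (v x : EuclideanSpace ℝ (Fin n)) : ℂ :=
  Complex.exp (((-(2 * Real.pi * inner ℝ v x) : ℝ) : ℂ) * Complex.I) - 1

theorem continuous_diffMultiplier {n : ℕ} (v : EuclideanSpace ℝ (Fin n)) :
    Continuous (diffMultiplier v) := by
  unfold diffMultiplier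
  fun_prop

theorem norm_diffMultiplier_le {n : ℕ} (v x : EuclideanSpace ℝ (Fin n)) :
    ‖diffMultiplier v x‖ ≤ 2 := by
  refine (norm_sub_le _ _).trans ?_
  rw [Complex.norm_exp_ofReal_mul_I, norm_one]
  norm_num

-- Plancherel: a translation by v on the Fourier side is multiplication by e^{-2πi v·x} in space.
-- For Schwartz functions the inverse transform can be computed as an integral, by the substitution
-- ξ ↦ ξ - v.
open SchwartzMap in
theorem eLpNorm_fourier_translate_sub_schwartz {n : ℕ} (g : 𝓢(EuclideanSpace ℝ (Fin n), ℂ))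
    (v : EuclideanSpace ℝ (Fin n)) :
    eLpNorm (fun ξ => (𝓕 g) (ξ + v) - (𝓕 g) ξ) 2 volume =
      eLpNorm (fun x => diffMultiplier v x * g x) 2 volume := by
  set S : 𝓢(EuclideanSpace ℝ (Fin n), ℂ) := (𝓕 g).compSubConstCLM ℂ (-v) - 𝓕 g with hS
  have h1 : (fun ξ => (𝓕 g) (ξ + v) - (𝓕 g) ξ) = S := by
    ext ξ
    simp [hS]
  have h2 : (fun x => diffMultiplier v x * g x) = (𝓕⁻ S : 𝓢(EuclideanSpace ℝ (Fin n), ℂ)) := by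
    ext x
    rw [hS, sub_eq_add_neg, fourierInv_add, fourierInv_neg, fourierInv_fourier_eq]
    have h3 : (𝓕⁻ ((𝓕 g).compSubConstCLM ℂ (-v)) : 𝓢(EuclideanSpace ℝ (Fin n), ℂ)) x =
        Complex.exp (((-(2 * Real.pi * inner ℝ v x) : ℝ) : ℂ) * Complex.I) * g x := by
      have h4 : g x = (𝓕⁻ (𝓕 g) : 𝓢(EuclideanSpace ℝ (Fin n), ℂ)) x := by
        rw [fourierInv_fourier_eq]
      rw [h4, SchwartzMap.fourierInv_coe, SchwartzMap.fourierInv_coe, Real.fourierInv_eq',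
        Real.fourierInv_eq', ← integral_const_mul]
      rw [← integral_sub_right_eq_self _ v]
      congr 1
      ext ξ
      simp only [sub_add_cancel, compSubConstCLM_apply, sub_neg_eq_add, smul_eq_mul, ← mul_assoc]
      rw [← Complex.exp_add, inner_sub_left]
      congr 2
      push_cast
      ring
    rw [_root_.add_apply, h3, _root_.neg_apply, diffMultiplier]
    ring
  rw [h1, h2]
  have h3 := norm_fourier_toL2_eq (𝓕⁻ S)
  rw [fourier_fourierInv_eq, SchwartzMap.norm_toLp, SchwartzMap.norm_toLp] at h3
  exact (ENNReal.toReal_eq_toReal_iff' (S.memLp 2 volume).2.ne ((𝓕⁻ S).memLp 2 volume).2.ne).1 h3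

theorem memLp_bounded_mul {n : ℕ} {m : EuclideanSpace ℝ (Fin n) → ℂ} (hm : Continuous m) {C : ℝ}
    (hC : ∀ x, ‖m x‖ ≤ C) (f : L2 n) : MemLp (fun x => m x * f x) 2 volume := by
  refine (Lp.memLp f).of_le_mul (c := C)
    (hm.aestronglyMeasurable.mul (Lp.aestronglyMeasurable f)) (.of_forall fun x => ?_)
  rw [norm_mul]
  gcongr
  exact hC x

/-- Multiplication by a bounded continuous function, as an operator on `L²`. -/
noncomputable def mulL2 {n : ℕ} {m : EuclideanSpace ℝ (Fin n) → ℂ} (hm : Continuous m) {C : ℝ}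
    (hC : ∀ x, ‖m x‖ ≤ C) : L2 n →L[ℂ] L2 n :=
  LinearMap.mkContinuous
    { toFun := fun f => (memLp_bounded_mul hm hC f).toLp _
      map_add' := fun f g => by
        rw [← MemLp.toLp_add]
        refine MemLp.toLp_congr _ _ ?_
        filter_upwards [Lp.coeFn_add f g] with x hx
        rw [hx, Pi.add_apply, mul_add, Pi.add_apply]
      map_smul' := fun c f => by
        rw [RingHom.id_apply, ← MemLp.toLp_const_smul]
        refine MemLp.toLp_congr _ _ ?_
        filter_upwards [Lp.coeFn_smul c f] with x hx
        simp [hx, mul_left_comm] } C fun f => by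
    refine Lp.norm_le_mul_norm_of_ae_le_mul ?_
    filter_upwards [MemLp.coeFn_toLp (memLp_bounded_mul hm hC f)] with x hx
    simp only [LinearMap.coe_mk, AddHom.coe_mk]
    rw [hx, norm_mul]
    gcongr
    exact hC x

theorem coeFn_mulL2 {n : ℕ} {m : EuclideanSpace ℝ (Fin n) → ℂ} (hm : Continuous m) {C : ℝ}
    (hC : ∀ x, ‖m x‖ ≤ C) (f : L2 n) : mulL2 hm hC f =ᵐ[volume] fun x => m x * f x :=
  MemLp.coeFn_toLp (memLp_bounded_mul hm hC f)

/-- Translation on `L²`. -/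
noncomputable def translateL2 {n : ℕ} (v : EuclideanSpace ℝ (Fin n)) : L2 n →ₗᵢ[ℂ] L2 n :=
  Lp.compMeasurePreservingₗᵢ ℂ (fun ξ => ξ + v) (measurePreserving_add_right volume v)

theorem coeFn_translateL2 {n : ℕ} (v : EuclideanSpace ℝ (Fin n)) (f : L2 n) :
    translateL2 v f =ᵐ[volume] fun ξ => f (ξ + v) :=
  Lp.coeFn_compMeasurePreserving f (measurePreserving_add_right volume v)

/-- Both sides are continuous in f for the L² norm and agree on the dense subspace of Schwartz
functions. Translation and multiplication are packaged as operators on L² for this argument. -/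
theorem norm_translateL2_fourier_sub {n : ℕ} (v : EuclideanSpace ℝ (Fin n)) (f : L2 n) :
    ‖translateL2 v (𝓕 f) - 𝓕 f‖ =
      ‖mulL2 (continuous_diffMultiplier v) (norm_diffMultiplier_le v) f‖ := by
  have key (g : SchwartzMap (EuclideanSpace ℝ (Fin n)) ℂ) :
      ‖translateL2 v (𝓕 (g.toLp 2)) - 𝓕 (g.toLp 2)‖ =
        ‖mulL2 (continuous_diffMultiplier v) (norm_diffMultiplier_le v) (g.toLp 2)‖ := by
    rw [SchwartzMap.toLp_fourier_eq, Lp.norm_def, Lp.norm_def]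
    congr 1
    trans eLpNorm (fun ξ => (𝓕 g) (ξ + v) - (𝓕 g) ξ) 2 volume
    · refine eLpNorm_congr_ae ?_
      have h := (𝓕 g).coeFn_toLp 2 (volume : Measure (EuclideanSpace ℝ (Fin n)))
      have h' := (measurePreserving_add_right volume v).quasiMeasurePreserving.ae_eq_comp h
      filter_upwards [Lp.coeFn_sub (translateL2 v ((𝓕 g).toLp 2)) ((𝓕 g).toLp 2), h, h',
        coeFn_translateL2 v ((𝓕 g).toLp 2)] with ξ h1 h2 h3 h4
      rw [h1, Pi.sub_apply, h4, h2]
      simp only [Function.comp_apply] at h3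
      rw [h3]
    · rw [eLpNorm_fourier_translate_sub_schwartz]
      refine eLpNorm_congr_ae ?_
      filter_upwards [coeFn_mulL2 (continuous_diffMultiplier v) (norm_diffMultiplier_le v)
        (g.toLp 2), g.coeFn_toLp 2 (volume : Measure (EuclideanSpace ℝ (Fin n)))] with x h1 h2
      rw [h1, h2]
  have hclosed : IsClosed {f : L2 n | ‖translateL2 v (𝓕 f) - 𝓕 f‖ =
      ‖mulL2 (continuous_diffMultiplier v) (norm_diffMultiplier_le v) f‖} := by
    refine isClosed_eq ?_ (mulL2 _ _).continuous.norm
    exact (((translateL2 v).continuous.comp (Lp.fourierTransformₗᵢ _ _).continuous).sub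
      (Lp.fourierTransformₗᵢ _ _).continuous).norm
  have hdense : DenseRange (SchwartzMap.toLpCLM ℝ ℂ 2
      (volume : Measure (EuclideanSpace ℝ (Fin n)))) :=
    SchwartzMap.denseRange_toLpCLM ENNReal.ofNat_ne_top
  exact hclosed.closure_subset_iff.2 (Set.range_subset_iff.2 key) (hdense f)

theorem eLpNorm_two_sq {n : ℕ} (g : EuclideanSpace ℝ (Fin n) → ℂ) :
    eLpNorm g 2 volume ^ 2 = ∫⁻ x, ‖g x‖ₑ ^ 2 := by
  have h := eLpNorm_nnreal_pow_eq_lintegral (p := 2) (f := g) (μ := volume) two_ne_zero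
  simpa only [NNReal.coe_ofNat, ENNReal.coe_ofNat, ENNReal.rpow_ofNat] using h

theorem lintegral_fourier_translate_sub {n : ℕ} (f : L2 n) (v : EuclideanSpace ℝ (Fin n)) :
    ∫⁻ ξ, ‖(𝓕 f : L2 n) (ξ + v) - (𝓕 f : L2 n) ξ‖ₑ ^ 2 =
      ∫⁻ x, ‖diffMultiplier v x‖ₑ ^ 2 * ‖f x‖ₑ ^ 2 := by
  have h := norm_translateL2_fourier_sub v f
  rw [Lp.norm_def, Lp.norm_def, ENNReal.toReal_eq_toReal_iff' (Lp.eLpNorm_ne_top _)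
    (Lp.eLpNorm_ne_top _)] at h
  have h1 : eLpNorm (fun ξ => (𝓕 f : L2 n) (ξ + v) - (𝓕 f : L2 n) ξ) 2 volume =
      eLpNorm (fun x => diffMultiplier v x * f x) 2 volume := by
    rw [← eLpNorm_congr_ae
      (coeFn_mulL2 (continuous_diffMultiplier v) (norm_diffMultiplier_le v) f), ← h]
    refine eLpNorm_congr_ae ?_
    filter_upwards [Lp.coeFn_sub (translateL2 v (𝓕 f)) (𝓕 f), coeFn_translateL2 v (𝓕 f)]
      with ξ h1 h2
    rw [h1, Pi.sub_apply, h2]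
  have h2 := congrArg (fun r : ℝ≥0∞ => r ^ 2) h1
  simpa only [eLpNorm_two_sq, enorm_mul, mul_pow] using h2

end SchrodingerDispersion

namespace SchrodingerDispersion

/-! ### The Gagliardo measure -/

@[fun_prop]
theorem measurable_diffMultiplier {n : ℕ} {α : Type*} [MeasurableSpace α]
    {f g : α → EuclideanSpace ℝ (Fin n)} (hf : Measurable f) (hg : Measurable g) :
    Measurable fun a => diffMultiplier (f a) (g a) := by
  unfold diffMultiplier
  fun_prop

/-- The weight `|v|^{-(n+2δ)}`. -/
noncomputable def gagliardoWeight {n : ℕ} (δ : ℝ) (v : EuclideanSpace ℝ (Fin n)) : ℝ :=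
  ‖v‖ ^ (-(n + 2 * δ))

theorem gagliardoWeight_nonneg {n : ℕ} (δ : ℝ) (v : EuclideanSpace ℝ (Fin n)) :
    0 ≤ gagliardoWeight δ v :=
  Real.rpow_nonneg (norm_nonneg v) _

@[fun_prop]
theorem measurable_gagliardoWeight {n : ℕ} (δ : ℝ) :
    Measurable (gagliardoWeight (n := n) δ) := by
  unfold gagliardoWeight
  fun_prop

/-- The measure `|ξ-η|^{-(n+2δ)} dξ dη` on `ℝⁿ × ℝⁿ`. -/
noncomputable def gagliardoMeasure (n : ℕ) (δ : ℝ) :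
    Measure (EuclideanSpace ℝ (Fin n) × EuclideanSpace ℝ (Fin n)) :=
  (volume.prod volume).withDensity fun p => ENNReal.ofReal (gagliardoWeight δ (p.1 - p.2))

instance (n : ℕ) (δ : ℝ) : SigmaFinite (gagliardoMeasure n δ) := by
  unfold gagliardoMeasure
  infer_instance

theorem gagliardoMeasure_absolutelyContinuous (n : ℕ) (δ : ℝ) :
    gagliardoMeasure n δ ≪ (volume.prod volume :
      Measure (EuclideanSpace ℝ (Fin n) × EuclideanSpace ℝ (Fin n))) :=
  withDensity_absolutelyContinuous _ _

theorem lintegral_gagliardoMeasure {n : ℕ} (δ : ℝ)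
    {g : EuclideanSpace ℝ (Fin n) × EuclideanSpace ℝ (Fin n) → ℝ≥0∞} (hg : Measurable g) :
    ∫⁻ p, g p ∂gagliardoMeasure n δ =
      ∫⁻ ξ, ∫⁻ η, ENNReal.ofReal (gagliardoWeight δ (ξ - η)) * g (ξ, η) := by
  rw [gagliardoMeasure, lintegral_withDensity_eq_lintegral_mul _ (by fun_prop) hg,
    lintegral_prod _ (by fun_prop)]
  rfl

theorem gagliardoWeight_sub_comm {n : ℕ} (δ : ℝ) (ξ η : EuclideanSpace ℝ (Fin n)) :
    gagliardoWeight δ (ξ - η) = gagliardoWeight δ (η - ξ) := by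
  rw [gagliardoWeight, gagliardoWeight, norm_sub_rev]

theorem measurePreserving_swap_gagliardoMeasure (n : ℕ) (δ : ℝ) :
    MeasurePreserving Prod.swap (gagliardoMeasure n δ) (gagliardoMeasure n δ) := by
  refine ⟨measurable_swap, Measure.ext_of_lintegral _ fun g hg => ?_⟩
  rw [lintegral_map hg measurable_swap, lintegral_gagliardoMeasure δ (by fun_prop),
    lintegral_gagliardoMeasure δ hg, lintegral_lintegral_swap (by fun_prop)]
  simp only [Prod.swap_prod_mk, gagliardoWeight_sub_comm]

theorem lintegral_gagliardoMeasure_swap {n : ℕ} (δ : ℝ)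
    {g : EuclideanSpace ℝ (Fin n) × EuclideanSpace ℝ (Fin n) → ℝ≥0∞} (hg : Measurable g) :
    ∫⁻ p, g p.swap ∂gagliardoMeasure n δ = ∫⁻ p, g p ∂gagliardoMeasure n δ :=
  (measurePreserving_swap_gagliardoMeasure n δ).lintegral_comp hg

theorem lintegral_comp_smul {n : ℕ} (g : EuclideanSpace ℝ (Fin n) → ℝ≥0∞) {a : ℝ} (ha : 0 < a) :
    ∫⁻ x, g (a • x) = ENNReal.ofReal (a ^ (-(n : ℝ))) * ∫⁻ x, g x := by
  have h := Measure.map_addHaar_smul (volume : Measure (EuclideanSpace ℝ (Fin n))) ha.ne'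
  have h2 := lintegral_map_equiv (μ := volume) g
    (Homeomorph.smulOfNeZero (α := EuclideanSpace ℝ (Fin n)) a ha.ne').toMeasurableEquiv
  simp only [Homeomorph.toMeasurableEquiv_coe, Homeomorph.smulOfNeZero_apply] at h2
  rw [← h2]
  change ∫⁻ x, g x ∂(Measure.map (fun x => a • x) volume) = _
  rw [h, lintegral_smul_measure, finrank_euclideanSpace_fin, abs_of_pos (by positivity),
    Real.rpow_neg ha.le, Real.rpow_natCast, smul_eq_mul]

/-- The weight is homogeneous of degree -(n+2δ) and Lebesgue measure of degree n, which leaves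
a^{2δ}. The powers with exponent 2δ in the estimates come from this scaling. -/
theorem lintegral_comp_smul_mul_gagliardoWeight {n : ℕ} (δ : ℝ)
    (g : EuclideanSpace ℝ (Fin n) → ℝ≥0∞) {a : ℝ} (ha : 0 < a) :
    ∫⁻ v, g (a • v) * ENNReal.ofReal (gagliardoWeight δ v) =
      ENNReal.ofReal (a ^ (2 * δ)) * ∫⁻ v, g v * ENNReal.ofReal (gagliardoWeight δ v) := by
  have h1 (v : EuclideanSpace ℝ (Fin n)) :
      gagliardoWeight δ v = a ^ (n + 2 * δ) * gagliardoWeight δ (a • v) := by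
    rw [gagliardoWeight, gagliardoWeight, norm_smul, Real.norm_of_nonneg ha.le,
      Real.mul_rpow ha.le (norm_nonneg v), ← mul_assoc, ← Real.rpow_add ha, add_neg_cancel,
      Real.rpow_zero, one_mul]
  have h2 (v : EuclideanSpace ℝ (Fin n)) : g (a • v) * ENNReal.ofReal (gagliardoWeight δ v) =
      (fun v => ENNReal.ofReal (a ^ (n + 2 * δ)) *
        (g v * ENNReal.ofReal (gagliardoWeight δ v))) (a • v) := by
    rw [h1, ENNReal.ofReal_mul (by positivity)]
    ring
  rw [lintegral_congr h2, lintegral_comp_smul (fun v => ENNReal.ofReal (a ^ (n + 2 * δ)) *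
      (g v * ENNReal.ofReal (gagliardoWeight δ v))) ha, lintegral_const_mul' _ _ ENNReal.ofReal_ne_top, ← mul_assoc,
    ← ENNReal.ofReal_mul (by positivity), ← Real.rpow_add ha]
  congr 3
  ring

/-- The truncated weight integral `∫ min(1, |v|²) |v|^{-(n+2δ)} dv`. -/
noncomputable def truncatedMoment (n : ℕ) (δ : ℝ) : ℝ≥0∞ :=
  ∫⁻ v : EuclideanSpace ℝ (Fin n),
    ENNReal.ofReal (min 1 (‖v‖ ^ 2)) * ENNReal.ofReal (gagliardoWeight δ v)

/-- Near 0 the integrand is at most |v|^{2-n-2δ}, integrable because δ < 1; at infinity it is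
|v|^{-n-2δ}, integrable because δ > 0. -/
theorem truncatedMoment_lt_top {n : ℕ} (hn : 1 ≤ n) {δ : ℝ} (hδ₀ : 0 < δ) (hδ₁ : δ < 1) :
    truncatedMoment n δ < ⊤ := by
  have : Nontrivial (EuclideanSpace ℝ (Fin n)) := by
    apply Module.nontrivial_of_finrank_pos (R := ℝ)
    rw [finrank_euclideanSpace_fin]
    omega
  have hint : Integrable (fun v : EuclideanSpace ℝ (Fin n) =>
      min 1 (‖v‖ ^ 2) * gagliardoWeight δ v) := by
    rw [← integrableOn_univ, ← Set.union_compl_self (Metric.ball (0 : EuclideanSpace ℝ (Fin n)) 1)]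
    refine IntegrableOn.union ?_ ?_
    · refine integrableOn_ball_of_norm_le_rpow (C := 1) (α := n + 2 * δ - 2)
        (by rwa [finrank_euclideanSpace_fin])
        (by rw [finrank_euclideanSpace_fin]; linarith) (.of_forall fun v => ?_)
        (Measurable.aestronglyMeasurable (by fun_prop))
      rw [Real.norm_of_nonneg (mul_nonneg (by positivity) (gagliardoWeight_nonneg δ v)), one_mul]
      rcases eq_or_ne v 0 with rfl | hv
      · simp only [norm_zero, ne_eq, OfNat.ofNat_ne_zero, not_false_eq_true, zero_pow,
          zero_le_one, inf_of_le_right, zero_mul]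
        positivity
      have hv' : 0 < ‖v‖ := norm_pos_iff.2 hv
      calc min 1 (‖v‖ ^ 2) * gagliardoWeight δ v ≤ ‖v‖ ^ 2 * gagliardoWeight δ v :=
            mul_le_mul_of_nonneg_right (min_le_right _ _) (gagliardoWeight_nonneg δ v)
        _ = ‖v‖ ^ (-(n + 2 * δ - 2)) := by
            rw [gagliardoWeight, ← Real.rpow_natCast ‖v‖ 2, ← Real.rpow_add hv']
            congr 1
            push_cast
            ring
    · have h := (integrable_one_add_norm (E := EuclideanSpace ℝ (Fin n)) (μ := volume)
        (r := n + 2 * δ) (by rw [finrank_euclideanSpace_fin]; linarith)).const_mul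
          (2 ^ (n + 2 * δ))
      refine Integrable.mono' h.integrableOn (Measurable.aestronglyMeasurable (by fun_prop))
        ((ae_restrict_iff' measurableSet_ball.compl).2 (.of_forall fun v hv => ?_))
      have hv : 1 ≤ ‖v‖ := by simpa using hv
      have hv0 : 0 < ‖v‖ := by linarith
      rw [Real.norm_of_nonneg (mul_nonneg (by positivity) (gagliardoWeight_nonneg δ v))]
      calc min 1 (‖v‖ ^ 2) * gagliardoWeight δ v ≤ 1 * gagliardoWeight δ v :=
            mul_le_mul_of_nonneg_right (min_le_left _ _) (gagliardoWeight_nonneg δ v)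
        _ = 2 ^ (n + 2 * δ) * (2 * ‖v‖) ^ (-(n + 2 * δ)) := by
            rw [Real.mul_rpow (by norm_num) hv0.le, ← mul_assoc, ← Real.rpow_add (by norm_num),
              add_neg_cancel, Real.rpow_zero, gagliardoWeight]
        _ ≤ 2 ^ (n + 2 * δ) * (1 + ‖v‖) ^ (-(n + 2 * δ)) := by
            refine mul_le_mul_of_nonneg_left
              (Real.rpow_le_rpow_of_nonpos (by linarith) (by linarith) ?_) (by positivity)
            have : (0 : ℝ) ≤ n := by positivity
            linarith
  have h := hint.lintegral_lt_top
  simpa only [truncatedMoment, ← ENNReal.ofReal_mul (le_min zero_le_one (sq_nonneg _))] using h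

theorem lintegral_min_one_mul_gagliardoWeight {n : ℕ} (δ : ℝ) (hδ : 0 < δ) {a : ℝ} (ha : 0 ≤ a) :
    ∫⁻ v : EuclideanSpace ℝ (Fin n),
      ENNReal.ofReal (min 1 ((a * ‖v‖) ^ 2)) * ENNReal.ofReal (gagliardoWeight δ v) =
      ENNReal.ofReal (a ^ (2 * δ)) * truncatedMoment n δ := by
  rcases ha.eq_or_lt with rfl | ha
  · simp [Real.zero_rpow (mul_pos two_pos hδ).ne']
  · rw [truncatedMoment, ← lintegral_comp_smul_mul_gagliardoWeight δ _ ha]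
    simp only [norm_smul, Real.norm_of_nonneg ha.le]

theorem norm_diffMultiplier_sq_le {n : ℕ} (v x : EuclideanSpace ℝ (Fin n)) :
    ‖diffMultiplier v x‖ ^ 2 ≤ 4 * min 1 ((Real.pi * ‖x‖ * ‖v‖) ^ 2) := by
  have h1 := norm_diffMultiplier_le v x
  have h2 : ‖diffMultiplier v x‖ ≤ 2 * (Real.pi * ‖x‖ * ‖v‖) := by
    rw [diffMultiplier, mul_comm _ Complex.I]
    refine (Real.norm_exp_I_mul_ofReal_sub_one_le).trans ?_
    rw [norm_neg, norm_mul, norm_mul, Real.norm_of_nonneg zero_le_two,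
      Real.norm_of_nonneg Real.pi_pos.le]
    have := norm_inner_le_norm (𝕜 := ℝ) v x
    nlinarith [Real.pi_pos]
  rw [mul_min_of_nonneg _ _ (by norm_num)]
  refine le_min ?_ ?_
  · nlinarith [norm_nonneg (diffMultiplier v x)]
  · nlinarith [norm_nonneg (diffMultiplier v x)]

/-- The integral `∫ |e^{-2πi v·x} - 1|² |v|^{-(n+2δ)} dv`. -/
noncomputable def oscillationMoment {n : ℕ} (δ : ℝ) (x : EuclideanSpace ℝ (Fin n)) : ℝ≥0∞ :=
  ∫⁻ v, ‖diffMultiplier v x‖ₑ ^ 2 * ENNReal.ofReal (gagliardoWeight δ v)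

theorem oscillationMoment_smul {n : ℕ} (δ : ℝ) {a : ℝ} (ha : 0 < a)
    (x : EuclideanSpace ℝ (Fin n)) :
    oscillationMoment δ (a • x) = ENNReal.ofReal (a ^ (2 * δ)) * oscillationMoment δ x := by
  rw [oscillationMoment, oscillationMoment, ← lintegral_comp_smul_mul_gagliardoWeight δ _ ha]
  simp only [diffMultiplier, inner_smul_left, inner_smul_right]
  rfl

/-- The reflection in the hyperplane orthogonal to x - y sends x to y and preserves inner products,
norms and Lebesgue measure, so it can be absorbed in v. -/
theorem oscillationMoment_eq_of_norm_eq {n : ℕ} (δ : ℝ) {x y : EuclideanSpace ℝ (Fin n)}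
    (h : ‖x‖ = ‖y‖) : oscillationMoment δ x = oscillationMoment δ y := by
  set O := (ℝ ∙ (x - y))ᗮ.reflection with hO
  have hOx : O x = y := Submodule.reflection_sub h
  rw [← hOx, oscillationMoment, oscillationMoment]
  conv_rhs => rw [← O.measurePreserving.lintegral_comp_emb O.toHomeomorph.measurableEmbedding]
  simp only [diffMultiplier, LinearIsometryEquiv.inner_map_map, gagliardoWeight,
    LinearIsometryEquiv.norm_map]

/-- Homogeneity of degree 2δ and dependence on |x| alone determine the moment up to its value c at a
unit vector; what remains is that this value is neither 0 nor ∞. -/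
theorem exists_oscillationMoment_eq {n : ℕ} (hn : 1 ≤ n) {δ : ℝ} (hδ₀ : 0 < δ) (hδ₁ : δ < 1) :
    ∃ c : ℝ, 0 < c ∧ ∀ x : EuclideanSpace ℝ (Fin n),
      oscillationMoment δ x = ENNReal.ofReal (c * ‖x‖ ^ (2 * δ)) := by
  set e : EuclideanSpace ℝ (Fin n) := EuclideanSpace.single ⟨0, hn⟩ 1 with he
  have hnorm : ‖e‖ = 1 := by simp [he]
  have htop : oscillationMoment δ e ≠ ⊤ := by
    have h1 : oscillationMoment δ e ≤
        4 * (ENNReal.ofReal (Real.pi ^ (2 * δ)) * truncatedMoment n δ) := by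
      rw [← lintegral_min_one_mul_gagliardoWeight δ hδ₀ Real.pi_pos.le,
        ← lintegral_const_mul' _ _ (by norm_num), oscillationMoment]
      refine lintegral_mono fun v => ?_
      rw [← mul_assoc]
      gcongr
      have h2 := norm_diffMultiplier_sq_le v e
      rw [hnorm, mul_one] at h2
      have h3 : ENNReal.ofReal (‖diffMultiplier v e‖ ^ 2) ≤
        ENNReal.ofReal (4 * min 1 ((Real.pi * ‖v‖) ^ 2)) := ENNReal.ofReal_le_ofReal h2
      rwa [ENNReal.ofReal_pow (norm_nonneg _), ofReal_norm, ENNReal.ofReal_mul (by norm_num),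
        ENNReal.ofReal_ofNat] at h3
    refine (h1.trans_lt ?_).ne
    exact ENNReal.mul_lt_top (by norm_num)
      (ENNReal.mul_lt_top ENNReal.ofReal_lt_top (truncatedMoment_lt_top hn hδ₀ hδ₁))
  have hzero : oscillationMoment δ e ≠ 0 := by
    intro h0
    have hcont : Continuous fun v : EuclideanSpace ℝ (Fin n) => diffMultiplier v e := by
      unfold diffMultiplier
      fun_prop
    rw [oscillationMoment, lintegral_eq_zero_iff (by fun_prop)] at h0
    set U : Set (EuclideanSpace ℝ (Fin n)) := {v | v ≠ 0} ∩ {v | diffMultiplier v e ≠ 0} with hU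
    have hUo : IsOpen U := isOpen_ne.inter (isOpen_ne_fun hcont continuous_const)
    have hUne : U.Nonempty := by
      -- At v = e/2 the character equals e^{-πi} = -1, so the multiplier is -2 and the integrand is
      -- positive on an open set.
      refine ⟨(1 / 2 : ℝ) • e, ?_, ?_⟩
      · have : e ≠ 0 := norm_ne_zero_iff.1 (by rw [hnorm]; norm_num)
        simpa using this
      · have : (((-(2 * Real.pi * inner ℝ ((1 / 2 : ℝ) • e) e) : ℝ) : ℂ) * Complex.I) =
            -(Real.pi * Complex.I) := by
          rw [inner_smul_left, real_inner_self_eq_norm_sq, hnorm]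
          simp only [RCLike.conj_to_real]
          push_cast
          ring
        rw [Set.mem_ofPred_eq, diffMultiplier, this, Complex.exp_neg, Complex.exp_pi_mul_I]
        norm_num
    refine (hUo.measure_pos volume hUne).ne' ?_
    refine measure_mono_null (fun v hv => ?_) (ae_iff.1 h0)
    simp only [Pi.zero_apply, mul_eq_zero, not_or, Set.mem_ofPred_eq]
    refine ⟨by simpa using hv.2, ?_⟩
    have h1 : 0 < gagliardoWeight δ v := Real.rpow_pos_of_pos (norm_pos_iff.2 hv.1) _
    simpa using h1
  refine ⟨(oscillationMoment δ e).toReal, ENNReal.toReal_pos hzero htop, fun x => ?_⟩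
  rcases eq_or_ne x 0 with rfl | hx
  · rw [norm_zero, Real.zero_rpow (mul_pos two_pos hδ₀).ne', mul_zero, ENNReal.ofReal_zero]
    simp [oscillationMoment, diffMultiplier]
  · have hx' : 0 < ‖x‖ := norm_pos_iff.2 hx
    rw [ENNReal.ofReal_mul ENNReal.toReal_nonneg, ENNReal.ofReal_toReal htop, mul_comm,
      ← oscillationMoment_smul δ hx']
    refine oscillationMoment_eq_of_norm_eq δ ?_
    rw [norm_smul, hnorm, norm_norm, mul_one]

/-- Put ξ = η + v, use Plancherel in η for each fixed v, and integrate over v by Tonelli. Everything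
has values in `ℝ≥0∞`, so the identity also transfers finiteness between the two sides. -/
theorem lintegral_fourier_sub_gagliardoMeasure {n : ℕ} {δ c : ℝ} (hc : 0 ≤ c)
    (h : ∀ x : EuclideanSpace ℝ (Fin n),
      oscillationMoment δ x = ENNReal.ofReal (c * ‖x‖ ^ (2 * δ))) (f : L2 n) :
    ∫⁻ p, ‖(𝓕 f : L2 n) p.1 - (𝓕 f : L2 n) p.2‖ₑ ^ 2 ∂gagliardoMeasure n δ =
      ENNReal.ofReal c * ∫⁻ x, ENNReal.ofReal (‖x‖ ^ (2 * δ)) * ‖f x‖ₑ ^ 2 := by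
  have hF : Measurable (𝓕 f : L2 n) := (Lp.stronglyMeasurable _).measurable
  have hf : Measurable f := (Lp.stronglyMeasurable _).measurable
  calc ∫⁻ p, ‖(𝓕 f : L2 n) p.1 - (𝓕 f : L2 n) p.2‖ₑ ^ 2 ∂gagliardoMeasure n δ
      = ∫⁻ η, ∫⁻ v, ENNReal.ofReal (gagliardoWeight δ v) *
          ‖(𝓕 f : L2 n) (η + v) - (𝓕 f : L2 n) η‖ₑ ^ 2 := by
        rw [lintegral_gagliardoMeasure δ (by fun_prop), lintegral_lintegral_swap (by fun_prop)]
        refine lintegral_congr fun η => ?_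
        rw [← lintegral_add_left_eq_self _ η]
        simp only [add_sub_cancel_left]
    _ = ∫⁻ v, ∫⁻ x, ‖diffMultiplier v x‖ₑ ^ 2 * ENNReal.ofReal (gagliardoWeight δ v) *
          ‖f x‖ₑ ^ 2 := by
        rw [lintegral_lintegral_swap (by fun_prop)]
        refine lintegral_congr fun v => ?_
        rw [lintegral_const_mul' _ _ ENNReal.ofReal_ne_top, lintegral_fourier_translate_sub,
          ← lintegral_const_mul' _ _ ENNReal.ofReal_ne_top]
        refine lintegral_congr fun x => ?_
        ring
    _ = ∫⁻ x, oscillationMoment δ x * ‖f x‖ₑ ^ 2 := by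
        rw [lintegral_lintegral_swap]
        · refine lintegral_congr fun x => ?_
          rw [lintegral_mul_const' _ _ (by finiteness), oscillationMoment]
        · fun_prop
    _ = _ := by
        rw [← lintegral_const_mul' _ _ ENNReal.ofReal_ne_top]
        refine lintegral_congr fun x => ?_
        rw [h, ENNReal.ofReal_mul hc, mul_assoc]

end SchrodingerDispersion

namespace SchrodingerDispersion

/-! ### Estimates for the Gagliardo form -/

/-- `∫ |ξ|^{2δ} |F(ξ)|² dξ`. -/
noncomputable def weightedSq {n : ℕ} (δ : ℝ) (F : EuclideanSpace ℝ (Fin n) → ℂ) : ℝ≥0∞ :=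
  ∫⁻ ξ, ENNReal.ofReal (‖ξ‖ ^ (2 * δ)) * ‖F ξ‖ₑ ^ 2

/-- `∫∫ |F(ξ) - F(η)|² |ξ-η|^{-(n+2δ)} dξ dη`. -/
noncomputable def gagliardoEnergy {n : ℕ} (δ : ℝ) (F : EuclideanSpace ℝ (Fin n) → ℂ) : ℝ≥0∞ :=
  ∫⁻ p, ‖F p.1 - F p.2‖ₑ ^ 2 ∂gagliardoMeasure n δ

theorem weightedNorm_sq {n : ℕ} (δ : ℝ) (f : L2 n) : weightedNorm δ f ^ 2 = weightedSq δ f := by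
  rw [weightedNorm, eLpNorm_two_sq, weightedSq]
  refine lintegral_congr fun x => ?_
  rw [enorm_mul, mul_pow]
  congr 1
  have h : 0 ≤ ‖x‖ ^ δ := Real.rpow_nonneg (norm_nonneg x) _
  rw [← ofReal_norm, Complex.norm_real, Real.norm_of_nonneg h, ← ENNReal.ofReal_pow h,
    ← Real.rpow_natCast, ← Real.rpow_mul (norm_nonneg x)]
  congr 2
  push_cast
  ring

/-- For fixed ξ the integral over η is the truncated moment dilated by the factor a(ξ), hence
a(ξ)^{2δ} times a constant. -/
theorem lintegral_min_mul_gagliardoMeasure {n : ℕ} {δ : ℝ} (hδ : 0 < δ)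
    {a : EuclideanSpace ℝ (Fin n) → ℝ} (ha : Measurable a) (ha0 : ∀ ξ, 0 ≤ a ξ)
    {g : EuclideanSpace ℝ (Fin n) → ℝ≥0∞} (hg : Measurable g) (hg' : ∀ ξ, g ξ ≠ ⊤) :
    ∫⁻ p, ENNReal.ofReal (min 1 ((a p.1 * ‖p.1 - p.2‖) ^ 2)) * g p.1 ∂gagliardoMeasure n δ =
      truncatedMoment n δ * ∫⁻ ξ, ENNReal.ofReal (a ξ ^ (2 * δ)) * g ξ := by
  rw [lintegral_gagliardoMeasure δ (by fun_prop), ← lintegral_const_mul _ (by fun_prop)]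
  refine lintegral_congr fun ξ => ?_
  have h := lintegral_sub_left_eq_self (μ := volume) (fun v : EuclideanSpace ℝ (Fin n) =>
    ENNReal.ofReal (min 1 ((a ξ * ‖v‖) ^ 2)) * ENNReal.ofReal (gagliardoWeight δ v)) ξ
  rw [lintegral_min_one_mul_gagliardoWeight δ hδ (ha0 ξ)] at h
  rw [← mul_assoc, mul_comm (truncatedMoment n δ), ← h, ← lintegral_mul_const' _ _ (hg' ξ)]
  refine lintegral_congr fun η => ?_
  ring

theorem lintegral_add_swap_gagliardoMeasure {n : ℕ} (δ : ℝ)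
    {g : EuclideanSpace ℝ (Fin n) × EuclideanSpace ℝ (Fin n) → ℝ≥0∞} (hg : Measurable g) :
    ∫⁻ p, (g p + g p.swap) ∂gagliardoMeasure n δ = 2 * ∫⁻ p, g p ∂gagliardoMeasure n δ := by
  rw [lintegral_add_left hg, lintegral_gagliardoMeasure_swap δ hg, two_mul]

theorem abs_norm_sq_sub_le {n : ℕ} (ξ η : EuclideanSpace ℝ (Fin n)) :
    |‖ξ‖ ^ 2 - ‖η‖ ^ 2| ≤ ‖ξ - η‖ * (‖ξ‖ + ‖η‖) := by
  rw [sq_sub_sq, abs_mul, abs_of_nonneg (by positivity : 0 ≤ ‖ξ‖ + ‖η‖), mul_comm]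
  gcongr
  exact abs_norm_sub_norm_le ξ η

/-- The phase `e^{-πit|ξ|²}`. -/
noncomputable def phase {n : ℕ} (t : ℝ) (ξ : EuclideanSpace ℝ (Fin n)) : ℂ :=
  Complex.exp (((-(Real.pi * t * ‖ξ‖ ^ 2) : ℝ) : ℂ) * Complex.I)

@[fun_prop]
theorem continuous_phase {n : ℕ} (t : ℝ) : Continuous (phase (n := n) t) := by
  unfold phase
  fun_prop

theorem norm_phase {n : ℕ} (t : ℝ) (ξ : EuclideanSpace ℝ (Fin n)) : ‖phase t ξ‖ = 1 := by
  rw [phase, Complex.norm_exp_ofReal_mul_I]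

theorem norm_phase_sub_le {n : ℕ} (t : ℝ) (ξ η : EuclideanSpace ℝ (Fin n)) :
    ‖phase t ξ - phase t η‖ ≤ Real.pi * |t| * |‖ξ‖ ^ 2 - ‖η‖ ^ 2| := by
  have h : phase t ξ - phase t η = phase t η *
      (Complex.exp (Complex.I * ((-(Real.pi * t * (‖ξ‖ ^ 2 - ‖η‖ ^ 2)) : ℝ) : ℂ)) - 1) := by
    rw [phase, phase, mul_sub, ← Complex.exp_add, mul_one]
    congr 2
    push_cast
    ring
  rw [h, norm_mul, norm_phase, one_mul]
  refine Real.norm_exp_I_mul_ofReal_sub_one_le.trans ?_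
  rw [norm_neg, Real.norm_eq_abs, abs_mul, abs_mul, abs_of_pos Real.pi_pos]

/-- The difference of the phases is put on the value of F at the larger frequency, so that
||ξ|²-|η|²| ≤ 2|ξ||ξ-η| involves only the frequency that also carries F. -/
theorem enorm_phase_mul_sub_sq_le {n : ℕ} (t : ℝ) (F : EuclideanSpace ℝ (Fin n) → ℂ)
    {ξ η : EuclideanSpace ℝ (Fin n)} (h : ‖η‖ ≤ ‖ξ‖) :
    ‖phase t ξ * F ξ - phase t η * F η‖ₑ ^ 2 ≤ 2 * ‖F ξ - F η‖ₑ ^ 2 +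
      8 * (ENNReal.ofReal (min 1 ((Real.pi * |t| * ‖ξ‖ * ‖ξ - η‖) ^ 2)) * ‖F ξ‖ₑ ^ 2) := by
  have h1 : ‖phase t ξ * F ξ - phase t η * F η‖ ≤
      ‖F ξ - F η‖ + ‖phase t ξ - phase t η‖ * ‖F ξ‖ := by
    have : phase t ξ * F ξ - phase t η * F η =
        phase t η * (F ξ - F η) + (phase t ξ - phase t η) * F ξ := by ring
    rw [this]
    refine (norm_add_le _ _).trans ?_
    rw [norm_mul, norm_mul, norm_phase, one_mul]
  have h2 : ‖phase t ξ - phase t η‖ ^ 2 ≤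
      4 * min 1 ((Real.pi * |t| * ‖ξ‖ * ‖ξ - η‖) ^ 2) := by
    have h3 : ‖phase t ξ - phase t η‖ ≤ 2 := by
      refine (norm_sub_le _ _).trans ?_
      rw [norm_phase, norm_phase]
      norm_num
    have h4 : ‖phase t ξ - phase t η‖ ≤ 2 * (Real.pi * |t| * ‖ξ‖ * ‖ξ - η‖) := by
      refine (norm_phase_sub_le t ξ η).trans ?_
      have h5 : |‖ξ‖ ^ 2 - ‖η‖ ^ 2| ≤ ‖ξ - η‖ * (2 * ‖ξ‖) :=
        (abs_norm_sq_sub_le ξ η).trans (by gcongr; linarith)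
      calc Real.pi * |t| * |‖ξ‖ ^ 2 - ‖η‖ ^ 2| ≤ Real.pi * |t| * (‖ξ - η‖ * (2 * ‖ξ‖)) := by
            gcongr
        _ = _ := by ring
    rw [mul_min_of_nonneg _ _ (by norm_num)]
    refine le_min ?_ ?_
    · nlinarith [norm_nonneg (phase t ξ - phase t η)]
    · nlinarith [norm_nonneg (phase t ξ - phase t η)]
  have h3 : ‖phase t ξ * F ξ - phase t η * F η‖ ^ 2 ≤ 2 * ‖F ξ - F η‖ ^ 2 +
      8 * (min 1 ((Real.pi * |t| * ‖ξ‖ * ‖ξ - η‖) ^ 2) * ‖F ξ‖ ^ 2) := by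
    have h4 : ‖phase t ξ * F ξ - phase t η * F η‖ ^ 2 ≤
        (‖F ξ - F η‖ + ‖phase t ξ - phase t η‖ * ‖F ξ‖) ^ 2 := by gcongr
    have h5 : ‖phase t ξ - phase t η‖ ^ 2 * ‖F ξ‖ ^ 2 ≤
        4 * min 1 ((Real.pi * |t| * ‖ξ‖ * ‖ξ - η‖) ^ 2) * ‖F ξ‖ ^ 2 := by gcongr
    nlinarith [sq_nonneg (‖F ξ - F η‖ - ‖phase t ξ - phase t η‖ * ‖F ξ‖)]
  have h4 := ENNReal.ofReal_le_ofReal h3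
  have hm : 0 ≤ min 1 ((Real.pi * |t| * ‖ξ‖ * ‖ξ - η‖) ^ 2) := le_min zero_le_one (sq_nonneg _)
  rw [ENNReal.ofReal_add (by positivity) (by positivity), ENNReal.ofReal_mul (by norm_num),
    ENNReal.ofReal_mul (by norm_num), ENNReal.ofReal_mul hm, ENNReal.ofReal_pow (norm_nonneg _),
    ENNReal.ofReal_pow (norm_nonneg _), ENNReal.ofReal_pow (norm_nonneg _), ofReal_norm,
    ofReal_norm, ofReal_norm, ENNReal.ofReal_ofNat, ENNReal.ofReal_ofNat] at h4
  exact h4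

/-- The free evolution preserves finiteness of the energy, with a loss of order |t|^{2δ}. The
weighted norm of F pays for the oscillation of the phase, each unordered pair being charged to its
larger frequency. -/
theorem gagliardoEnergy_phase_mul_le {n : ℕ} {δ : ℝ} (hδ : 0 < δ) (t : ℝ)
    {F : EuclideanSpace ℝ (Fin n) → ℂ} (hF : Measurable F) :
    gagliardoEnergy δ (fun ξ => phase t ξ * F ξ) ≤ 2 * gagliardoEnergy δ F +
      16 * truncatedMoment n δ * ENNReal.ofReal ((Real.pi * |t|) ^ (2 * δ)) * weightedSq δ F := by
  set A : EuclideanSpace ℝ (Fin n) × EuclideanSpace ℝ (Fin n) → ℝ≥0∞ := fun p =>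
    ENNReal.ofReal (min 1 ((Real.pi * |t| * ‖p.1‖ * ‖p.1 - p.2‖) ^ 2)) * ‖F p.1‖ₑ ^ 2 with hA
  have hAm : Measurable A := by fun_prop
  have h1 (p : EuclideanSpace ℝ (Fin n) × EuclideanSpace ℝ (Fin n)) :
      ‖phase t p.1 * F p.1 - phase t p.2 * F p.2‖ₑ ^ 2 ≤
        2 * ‖F p.1 - F p.2‖ₑ ^ 2 + 8 * (A p + A p.swap) := by
    rcases le_total ‖p.2‖ ‖p.1‖ with h | h
    · refine (enorm_phase_mul_sub_sq_le t F h).trans ?_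
      gcongr
      exact le_self_add
    · rw [enorm_sub_rev, enorm_sub_rev (F p.1)]
      refine (enorm_phase_mul_sub_sq_le t F h).trans ?_
      gcongr
      exact le_add_self
  calc gagliardoEnergy δ (fun ξ => phase t ξ * F ξ)
      ≤ ∫⁻ p, (2 * ‖F p.1 - F p.2‖ₑ ^ 2 + 8 * (A p + A p.swap)) ∂gagliardoMeasure n δ :=
        lintegral_mono h1
    _ = 2 * gagliardoEnergy δ F + 8 * (2 * ∫⁻ p, A p ∂gagliardoMeasure n δ) := by
        rw [lintegral_add_left (by fun_prop), lintegral_const_mul _ (by fun_prop),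
          lintegral_const_mul _ (by fun_prop), lintegral_add_swap_gagliardoMeasure δ hAm]
        rfl
    _ = _ := by
        congr 1
        rw [hA, lintegral_min_mul_gagliardoMeasure hδ (a := fun ξ => Real.pi * |t| * ‖ξ‖)
          (by fun_prop) (fun ξ => by positivity) (g := fun ξ => ‖F ξ‖ₑ ^ 2) (by fun_prop)
          (fun ξ => by finiteness)]
        have h2 (ξ : EuclideanSpace ℝ (Fin n)) :
            ENNReal.ofReal ((Real.pi * |t| * ‖ξ‖) ^ (2 * δ)) * ‖F ξ‖ₑ ^ 2 =
            ENNReal.ofReal ((Real.pi * |t|) ^ (2 * δ)) *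
              (ENNReal.ofReal (‖ξ‖ ^ (2 * δ)) * ‖F ξ‖ₑ ^ 2) := by
          rw [Real.mul_rpow (by positivity) (norm_nonneg ξ), ENNReal.ofReal_mul (by positivity),
            mul_assoc]
        rw [lintegral_congr h2, lintegral_const_mul' _ _ ENNReal.ofReal_ne_top, weightedSq]
        ring

/-- The quadratic form that controls second differences in time. -/
noncomputable def oscillationForm {n : ℕ} (δ σ : ℝ) (F : EuclideanSpace ℝ (Fin n) → ℂ) : ℝ≥0∞ :=
  ∫⁻ p, ENNReal.ofReal (min 1 ((σ * (‖p.1‖ ^ 2 - ‖p.2‖ ^ 2)) ^ 2)) * (‖F p.1‖ₑ * ‖F p.2‖ₑ)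
    ∂gagliardoMeasure n δ

/-- The part of `oscillationForm` with `|η| < |ξ|/2`, up to constants. -/
noncomputable def farForm {n : ℕ} (δ σ : ℝ) (F : EuclideanSpace ℝ (Fin n) → ℂ) : ℝ≥0∞ :=
  ∫⁻ ξ, ∫⁻ η in Metric.ball (0 : EuclideanSpace ℝ (Fin n)) ‖ξ‖,
    ENNReal.ofReal (‖ξ‖ ^ (-(n + 2 * δ)) * min 1 ((σ * ‖ξ‖ ^ 2) ^ 2)) * (‖F ξ‖ₑ * ‖F η‖ₑ)

theorem ENNReal_mul_le_sq_add_sq (a b : ℝ≥0∞) : a * b ≤ a ^ 2 + b ^ 2 := by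
  rcases le_total a b with h | h
  · calc a * b ≤ b * b := by gcongr
      _ = b ^ 2 := (sq b).symm
      _ ≤ _ := le_add_self
  · calc a * b ≤ a * a := by gcongr
      _ = a ^ 2 := (sq a).symm
      _ ≤ _ := le_self_add

/-- Pairs within a factor 2 of each other satisfy ||ξ|²-|η|²| ≤ 3|ξ||ξ-η|; there |F(ξ)||F(η)| ≤
|F(ξ)|² + |F(η)|² reduces to one variable at a time. For the remaining pairs |ξ-η| is comparable to
the larger norm, so the singular weight becomes a power of that norm. -/
theorem oscillationForm_le {n : ℕ} {δ : ℝ} (hδ : 0 < δ) {σ : ℝ} (hσ : 0 ≤ σ)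
    {F : EuclideanSpace ℝ (Fin n) → ℂ} (hF : Measurable F) :
    oscillationForm δ σ F ≤
      2 * truncatedMoment n δ * ENNReal.ofReal ((3 * σ) ^ (2 * δ)) * weightedSq δ F +
      2 * ENNReal.ofReal (2 ^ (n + 2 * δ)) * farForm δ σ F := by
  set B : EuclideanSpace ℝ (Fin n) × EuclideanSpace ℝ (Fin n) → ℝ≥0∞ := fun p =>
    ENNReal.ofReal (min 1 ((3 * σ * ‖p.1‖ * ‖p.1 - p.2‖) ^ 2)) * ‖F p.1‖ₑ ^ 2 with hB
  set S : Set (EuclideanSpace ℝ (Fin n) × EuclideanSpace ℝ (Fin n)) :=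
    {p | 2 * ‖p.2‖ < ‖p.1‖} with hS
  have hSm : MeasurableSet S := measurableSet_lt (by fun_prop) (by fun_prop)
  set Φ : EuclideanSpace ℝ (Fin n) × EuclideanSpace ℝ (Fin n) → ℝ≥0∞ :=
    S.indicator fun p => ENNReal.ofReal (min 1 ((σ * ‖p.1‖ ^ 2) ^ 2)) *
      (‖F p.1‖ₑ * ‖F p.2‖ₑ) with hΦ
  have hBm : Measurable B := by fun_prop
  have hΦm : Measurable Φ := Measurable.indicator (by fun_prop) hSm
  have far {ξ η : EuclideanSpace ℝ (Fin n)} (h : 2 * ‖η‖ < ‖ξ‖) :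
      (σ * (‖ξ‖ ^ 2 - ‖η‖ ^ 2)) ^ 2 ≤ (σ * ‖ξ‖ ^ 2) ^ 2 := by
    have h1 : ‖η‖ ^ 2 ≤ ‖ξ‖ ^ 2 := by
      gcongr
      linarith [norm_nonneg η]
    have h2 : 0 ≤ ‖ξ‖ ^ 2 - ‖η‖ ^ 2 := by linarith
    gcongr
    linarith [sq_nonneg ‖η‖]
  have near {ξ η : EuclideanSpace ℝ (Fin n)} (h : ‖η‖ ≤ 2 * ‖ξ‖) :
      (σ * (‖ξ‖ ^ 2 - ‖η‖ ^ 2)) ^ 2 ≤ (3 * σ * ‖ξ‖ * ‖ξ - η‖) ^ 2 := by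
    rw [sq_le_sq, abs_mul, abs_of_nonneg hσ,
      abs_of_nonneg (by positivity : 0 ≤ 3 * σ * ‖ξ‖ * ‖ξ - η‖)]
    calc σ * |‖ξ‖ ^ 2 - ‖η‖ ^ 2| ≤ σ * (‖ξ - η‖ * (3 * ‖ξ‖)) := by
          gcongr
          refine (abs_norm_sq_sub_le ξ η).trans ?_
          gcongr
          linarith
      _ = _ := by ring
  have mm {x y : ℝ} (h : x ≤ y) : ENNReal.ofReal (min 1 x) ≤ ENNReal.ofReal (min 1 y) :=
    ENNReal.ofReal_le_ofReal (min_le_min_left _ h)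
  have h1 (p : EuclideanSpace ℝ (Fin n) × EuclideanSpace ℝ (Fin n)) :
      ENNReal.ofReal (min 1 ((σ * (‖p.1‖ ^ 2 - ‖p.2‖ ^ 2)) ^ 2)) * (‖F p.1‖ₑ * ‖F p.2‖ₑ) ≤
        (B p + B p.swap) + (Φ p + Φ p.swap) := by
    by_cases hp1 : p ∈ S
    · refine le_trans ?_ (le_add_self.trans' le_self_add)
      rw [hΦ, Set.indicator_of_mem hp1]
      exact mul_le_mul' (mm (far hp1)) le_rfl
    by_cases hp2 : p.swap ∈ S
    · refine le_trans ?_ (le_add_self.trans' le_add_self)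
      rw [hΦ, Set.indicator_of_mem hp2]
      have := far hp2
      simp only [Prod.fst_swap, Prod.snd_swap] at this ⊢
      rw [mul_comm ‖F p.2‖ₑ]
      refine mul_le_mul' (mm (le_trans (le_of_eq ?_) this)) le_rfl
      ring
    · refine le_trans ?_ le_self_add
      simp only [hS, Set.mem_ofPred_eq, Prod.fst_swap, Prod.snd_swap, not_lt] at hp1 hp2
      refine (mul_le_mul_right (ENNReal_mul_le_sq_add_sq _ _) _).trans ?_
      rw [mul_add]
      simp only [hB, Prod.fst_swap, Prod.snd_swap]
      refine add_le_add (mul_le_mul' (mm (near hp2)) le_rfl)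
        (mul_le_mul' (mm (le_trans (le_of_eq ?_) (near hp1))) le_rfl)
      ring
  have h2 : ∫⁻ p, B p ∂gagliardoMeasure n δ =
      truncatedMoment n δ * ENNReal.ofReal ((3 * σ) ^ (2 * δ)) * weightedSq δ F := by
    rw [hB, lintegral_min_mul_gagliardoMeasure hδ (a := fun ξ => 3 * σ * ‖ξ‖)
      (by fun_prop) (fun ξ => by positivity) (g := fun ξ => ‖F ξ‖ₑ ^ 2) (by fun_prop)
      (fun ξ => by finiteness)]
    have h2 (ξ : EuclideanSpace ℝ (Fin n)) :
        ENNReal.ofReal ((3 * σ * ‖ξ‖) ^ (2 * δ)) * ‖F ξ‖ₑ ^ 2 =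
        ENNReal.ofReal ((3 * σ) ^ (2 * δ)) *
          (ENNReal.ofReal (‖ξ‖ ^ (2 * δ)) * ‖F ξ‖ₑ ^ 2) := by
      rw [Real.mul_rpow (by positivity) (norm_nonneg ξ), ENNReal.ofReal_mul (by positivity),
        mul_assoc]
    rw [lintegral_congr h2, lintegral_const_mul' _ _ ENNReal.ofReal_ne_top, weightedSq]
    ring
  have h3 : ∫⁻ p, Φ p ∂gagliardoMeasure n δ ≤
      ENNReal.ofReal (2 ^ (n + 2 * δ)) * farForm δ σ F := by
    rw [lintegral_gagliardoMeasure δ hΦm, farForm,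
      ← lintegral_const_mul' _ _ ENNReal.ofReal_ne_top]
    refine lintegral_mono fun ξ => ?_
    rw [← lintegral_const_mul' _ _ ENNReal.ofReal_ne_top,
      ← lintegral_indicator measurableSet_ball]
    refine lintegral_mono fun η => ?_
    by_cases hp : (ξ, η) ∈ S
    · have hp' : 2 * ‖η‖ < ‖ξ‖ := hp
      have hξ : 0 < ‖ξ‖ := by linarith [norm_nonneg η]
      -- `farForm` integrates over the larger ball |η| < |ξ|; the enlargement is harmless for a
      -- nonnegative integrand.
      have hmem : η ∈ Metric.ball (0 : EuclideanSpace ℝ (Fin n)) ‖ξ‖ := by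
        rw [mem_ball_zero_iff]
        linarith [norm_nonneg η]
      rw [hΦ, Set.indicator_of_mem hp, Set.indicator_of_mem hmem,
        ENNReal.ofReal_mul (by positivity : 0 ≤ ‖ξ‖ ^ (-(n + 2 * δ))),
        mul_assoc (ENNReal.ofReal (‖ξ‖ ^ _)), ← mul_assoc (ENNReal.ofReal (2 ^ _)),
        ← ENNReal.ofReal_mul (by positivity)]
      refine mul_le_mul' (ENNReal.ofReal_le_ofReal ?_) le_rfl
      have h4 : ‖ξ‖ / 2 ≤ ‖ξ - η‖ := by
        have := norm_sub_norm_le ξ η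
        linarith
      calc gagliardoWeight δ (ξ - η) ≤ (‖ξ‖ / 2) ^ (-(n + 2 * δ)) := by
            refine Real.rpow_le_rpow_of_nonpos (by positivity) h4 ?_
            have : (0 : ℝ) ≤ n := by positivity
            linarith
        _ = 2 ^ (n + 2 * δ) * ‖ξ‖ ^ (-(n + 2 * δ)) := by
            rw [Real.div_rpow hξ.le (by norm_num), Real.rpow_neg (by norm_num : (0 : ℝ) ≤ 2),
              div_inv_eq_mul, mul_comm]
    · rw [hΦ, Set.indicator_of_notMem hp, mul_zero]
      exact zero_le
  calc oscillationForm δ σ F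
      ≤ ∫⁻ p, ((B p + B p.swap) + (Φ p + Φ p.swap)) ∂gagliardoMeasure n δ := lintegral_mono h1
    _ = 2 * ∫⁻ p, B p ∂gagliardoMeasure n δ + 2 * ∫⁻ p, Φ p ∂gagliardoMeasure n δ := by
        rw [lintegral_add_left (by fun_prop), lintegral_add_swap_gagliardoMeasure δ hBm,
          lintegral_add_swap_gagliardoMeasure δ hΦm]
    _ ≤ _ := by
        rw [h2, mul_assoc 2 (ENNReal.ofReal _), mul_assoc 2 (truncatedMoment n δ), mul_assoc 2]
        gcongr

end SchrodingerDispersion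

namespace SchrodingerDispersion

/-! ### Power integrals and Schur's test for the far part -/

theorem nontrivial_euclideanSpace {n : ℕ} (hn : 1 ≤ n) : Nontrivial (EuclideanSpace ℝ (Fin n)) := by
  apply Module.nontrivial_of_finrank_pos (R := ℝ)
  rw [finrank_euclideanSpace_fin]
  omega

theorem lintegral_ball_rpow {n : ℕ} (q : ℝ) {R : ℝ} (hR : 0 < R) :
    ∫⁻ η in Metric.ball (0 : EuclideanSpace ℝ (Fin n)) R, ENNReal.ofReal (‖η‖ ^ (-q)) =
      ENNReal.ofReal (R ^ (n - q)) *
        ∫⁻ η in Metric.ball (0 : EuclideanSpace ℝ (Fin n)) 1, ENNReal.ofReal (‖η‖ ^ (-q)) := by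
  set g : EuclideanSpace ℝ (Fin n) → ℝ≥0∞ :=
    (Metric.ball (0 : EuclideanSpace ℝ (Fin n)) R).indicator fun η => ENNReal.ofReal (‖η‖ ^ (-q))
    with hg
  have h1 := lintegral_comp_smul g hR
  have h2 (x : EuclideanSpace ℝ (Fin n)) : g (R • x) = ENNReal.ofReal (R ^ (-q)) *
      (Metric.ball (0 : EuclideanSpace ℝ (Fin n)) 1).indicator
        (fun η => ENNReal.ofReal (‖η‖ ^ (-q))) x := by
    have h3 : R • x ∈ Metric.ball (0 : EuclideanSpace ℝ (Fin n)) R ↔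
        x ∈ Metric.ball (0 : EuclideanSpace ℝ (Fin n)) 1 := by
      rw [mem_ball_zero_iff, mem_ball_zero_iff, norm_smul, Real.norm_of_nonneg hR.le]
      constructor <;> intro h <;> nlinarith
    by_cases hx : x ∈ Metric.ball (0 : EuclideanSpace ℝ (Fin n)) 1
    · rw [hg, Set.indicator_of_mem (h3.2 hx), Set.indicator_of_mem hx, norm_smul,
        Real.norm_of_nonneg hR.le, Real.mul_rpow hR.le (norm_nonneg x),
        ENNReal.ofReal_mul (by positivity)]
    · rw [hg, Set.indicator_of_notMem (mt h3.1 hx), Set.indicator_of_notMem hx, mul_zero]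
  rw [lintegral_congr h2, lintegral_const_mul' _ _ ENNReal.ofReal_ne_top,
    lintegral_indicator measurableSet_ball, hg, lintegral_indicator measurableSet_ball] at h1
  have h4 := congrArg (fun z => ENNReal.ofReal (R ^ (n : ℝ)) * z) h1
  simp only [← mul_assoc] at h4
  rw [← ENNReal.ofReal_mul (by positivity), ← ENNReal.ofReal_mul (by positivity),
    ← Real.rpow_add hR, ← Real.rpow_add hR, add_neg_cancel, Real.rpow_zero, ENNReal.ofReal_one,
    one_mul, ← sub_eq_add_neg] at h4
  exact h4.symm

theorem lintegral_compl_closedBall_rpow {n : ℕ} (r : ℝ) {R : ℝ} (hR : 0 < R) :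
    ∫⁻ η in (Metric.closedBall (0 : EuclideanSpace ℝ (Fin n)) R)ᶜ,
        ENNReal.ofReal (‖η‖ ^ (-(n + r))) =
      ENNReal.ofReal (R ^ (-r)) *
        ∫⁻ η in (Metric.closedBall (0 : EuclideanSpace ℝ (Fin n)) 1)ᶜ,
          ENNReal.ofReal (‖η‖ ^ (-(n + r))) := by
  set g : EuclideanSpace ℝ (Fin n) → ℝ≥0∞ :=
    (Metric.closedBall (0 : EuclideanSpace ℝ (Fin n)) R)ᶜ.indicator
      fun η => ENNReal.ofReal (‖η‖ ^ (-(n + r))) with hg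
  have h1 := lintegral_comp_smul g hR
  have h2 (x : EuclideanSpace ℝ (Fin n)) : g (R • x) = ENNReal.ofReal (R ^ (-(n + r))) *
      (Metric.closedBall (0 : EuclideanSpace ℝ (Fin n)) 1)ᶜ.indicator
        (fun η => ENNReal.ofReal (‖η‖ ^ (-(n + r)))) x := by
    have h3 : R • x ∈ (Metric.closedBall (0 : EuclideanSpace ℝ (Fin n)) R)ᶜ ↔
        x ∈ (Metric.closedBall (0 : EuclideanSpace ℝ (Fin n)) 1)ᶜ := by
      rw [Set.mem_compl_iff, Set.mem_compl_iff, mem_closedBall_zero_iff, mem_closedBall_zero_iff,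
        norm_smul, Real.norm_of_nonneg hR.le, not_le, not_le]
      constructor <;> intro h <;> nlinarith
    by_cases hx : x ∈ (Metric.closedBall (0 : EuclideanSpace ℝ (Fin n)) 1)ᶜ
    · rw [hg, Set.indicator_of_mem (h3.2 hx), Set.indicator_of_mem hx, norm_smul,
        Real.norm_of_nonneg hR.le, Real.mul_rpow hR.le (norm_nonneg x),
        ENNReal.ofReal_mul (by positivity)]
    · rw [hg, Set.indicator_of_notMem (mt h3.1 hx), Set.indicator_of_notMem hx, mul_zero]
  rw [lintegral_congr h2, lintegral_const_mul' _ _ ENNReal.ofReal_ne_top,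
    lintegral_indicator measurableSet_closedBall.compl, hg,
    lintegral_indicator measurableSet_closedBall.compl] at h1
  have h4 := congrArg (fun z => ENNReal.ofReal (R ^ (n : ℝ)) * z) h1
  simp only [← mul_assoc] at h4
  rw [← ENNReal.ofReal_mul (by positivity), ← ENNReal.ofReal_mul (by positivity),
    ← Real.rpow_add hR, ← Real.rpow_add hR, add_neg_cancel, Real.rpow_zero, ENNReal.ofReal_one,
    one_mul] at h4
  rw [← h4]
  congr 3
  ring

theorem lintegral_ball_rpow_lt_top {n : ℕ} (hn : 1 ≤ n) {q : ℝ} (hq : q < n) (R : ℝ) :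
    ∫⁻ η in Metric.ball (0 : EuclideanSpace ℝ (Fin n)) R, ENNReal.ofReal (‖η‖ ^ (-q)) < ⊤ := by
  have := nontrivial_euclideanSpace hn
  refine Integrable.lintegral_lt_top (integrableOn_ball_of_norm_le_rpow (C := 1) (α := q)
    (by rwa [finrank_euclideanSpace_fin]) (by rwa [finrank_euclideanSpace_fin])
    (.of_forall fun v => ?_) (Measurable.aestronglyMeasurable (by fun_prop)))
  rw [one_mul, Real.norm_of_nonneg (by positivity)]

theorem rpow_neg_le_one_add_norm {n : ℕ} {r : ℝ} (hr : 0 ≤ r) {v : EuclideanSpace ℝ (Fin n)}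
    (hv : 1 ≤ ‖v‖) : ‖v‖ ^ (-r) ≤ 2 ^ r * (1 + ‖v‖) ^ (-r) := by
  have hv0 : 0 < ‖v‖ := by linarith
  calc ‖v‖ ^ (-r) = 2 ^ r * (2 * ‖v‖) ^ (-r) := by
        rw [Real.mul_rpow (by norm_num) hv0.le, ← mul_assoc, ← Real.rpow_add (by norm_num),
          add_neg_cancel, Real.rpow_zero, one_mul]
    _ ≤ 2 ^ r * (1 + ‖v‖) ^ (-r) :=
        mul_le_mul_of_nonneg_left (Real.rpow_le_rpow_of_nonpos (by linarith) (by linarith)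
          (by linarith)) (by positivity)

theorem lintegral_compl_closedBall_rpow_lt_top {n : ℕ} {r : ℝ} (hr : 0 < r) :
    ∫⁻ η in (Metric.closedBall (0 : EuclideanSpace ℝ (Fin n)) 1)ᶜ,
          ENNReal.ofReal (‖η‖ ^ (-(n + r))) < ⊤ := by
  have h := (integrable_one_add_norm (E := EuclideanSpace ℝ (Fin n)) (μ := volume)
    (r := n + r) (by rw [finrank_euclideanSpace_fin]; linarith)).const_mul (2 ^ (n + r))
  refine Integrable.lintegral_lt_top (Integrable.mono' h.integrableOn
    (Measurable.aestronglyMeasurable (by fun_prop))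
    ((ae_restrict_iff' measurableSet_closedBall.compl).2 (.of_forall fun v hv => ?_)))
  have hv : 1 < ‖v‖ := by simpa using hv
  rw [Real.norm_of_nonneg (by positivity)]
  exact rpow_neg_le_one_add_norm (by positivity) hv.le

/-- Weighted arithmetic-geometric mean with A ≤ √B √C: the pointwise step of Schur's test. -/
theorem ENNReal_ofReal_mul_enorm_mul_le {A B C : ℝ} (hA : 0 ≤ A) (hB : 0 ≤ B) (hC : 0 ≤ C)
    (h : A ^ 2 ≤ B * C) (z w : ℂ) : ENNReal.ofReal A * (‖z‖ₑ * ‖w‖ₑ) ≤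
      ENNReal.ofReal B * ‖z‖ₑ ^ 2 + ENNReal.ofReal C * ‖w‖ₑ ^ 2 := by
  rw [← ofReal_norm, ← ofReal_norm, ← ENNReal.ofReal_mul (norm_nonneg z),
    ← ENNReal.ofReal_mul hA, ← ENNReal.ofReal_pow (norm_nonneg z),
    ← ENNReal.ofReal_pow (norm_nonneg w), ← ENNReal.ofReal_mul hB, ← ENNReal.ofReal_mul hC,
    ← ENNReal.ofReal_add (by positivity) (by positivity)]
  refine ENNReal.ofReal_le_ofReal ?_
  have h1 : A ≤ √B * √C := by
    rw [← Real.sqrt_mul hB]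
    exact Real.le_sqrt_of_sq_le h
  have h2 : 0 ≤ ‖z‖ * ‖w‖ := by positivity
  nlinarith [mul_le_mul_of_nonneg_right h1 h2, sq_nonneg (√B * ‖z‖ - √C * ‖w‖), Real.sq_sqrt hB,
    Real.sq_sqrt hC, mul_nonneg hB (sq_nonneg ‖z‖), mul_nonneg hC (sq_nonneg ‖w‖)]

theorem min_one_sq_le_rpow {x γ : ℝ} (hx : 0 ≤ x) (hγ₀ : 0 ≤ γ) (hγ₂ : γ ≤ 2) :
    min 1 (x ^ 2) ≤ x ^ γ := by
  rcases le_total x 1 with h | h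
  · refine (min_le_right _ _).trans ?_
    rcases hx.eq_or_lt with rfl | hx
    · simp only [ne_eq, OfNat.ofNat_ne_zero, not_false_eq_true, zero_pow]
      positivity
    · rw [← Real.rpow_natCast]
      exact Real.rpow_le_rpow_of_exponent_ge hx h (by simpa using hγ₂)
  · exact (min_le_left _ _).trans (Real.one_le_rpow h hγ₀)

theorem lintegral_lintegral_const_mul_add {α β : Type*} [MeasurableSpace α] [MeasurableSpace β]
    {μ : Measure α} {ν : Measure β} [SFinite ν] {c : ℝ≥0∞} (hc : c ≠ ⊤) {U : α → β → ℝ≥0∞}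
    (hU : Measurable (Function.uncurry U)) (V : α → β → ℝ≥0∞) :
    ∫⁻ a, ∫⁻ b, c * (U a b + V a b) ∂ν ∂μ =
      c * ((∫⁻ a, ∫⁻ b, U a b ∂ν ∂μ) + ∫⁻ a, ∫⁻ b, V a b ∂ν ∂μ) := by
  have h1 := lintegral_add_left (μ := μ) (hU.lintegral_prod_right' (ν := ν))
    (fun a => ∫⁻ b, V a b ∂ν)
  simp only [Function.uncurry_apply_pair] at h1
  rw [← h1, ← lintegral_const_mul' _ _ hc]
  refine lintegral_congr fun a => ?_
  have h2 := lintegral_add_left (μ := ν) (hU.comp (measurable_prodMk_left (x := a))) (V a)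
  simp only [Function.comp_apply, Function.uncurry_apply_pair] at h2
  rw [lintegral_const_mul' _ _ hc, h2]

/-- Replacing min(1, (σ|ξ|²)²) by (σ|ξ|²)^{δ+δ'} leaves the kernel |ξ|^{-n+2δ'} on |η| < |ξ|, which
is bounded on the space weighted by |ξ|^{2δ'} by Schur's test with the weight |η|^q. -/
theorem exists_farForm_le {n : ℕ} (hn : 1 ≤ n) {δ δ' : ℝ} (hδ₁ : δ < 1) (hδ'₀ : 0 ≤ δ')
    (hδ' : δ' ≤ δ) (hδ'n : δ' < n / 2) :
    ∃ C : ℝ≥0, ∀ F : EuclideanSpace ℝ (Fin n) → ℂ, Measurable F → ∀ σ : ℝ, 0 ≤ σ →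
      farForm δ σ F ≤ C * ENNReal.ofReal (σ ^ (δ + δ')) * weightedSq δ' F := by
  have hn' : (1 : ℝ) ≤ n := by exact_mod_cast hn
  -- The integral of |η|^{-q} over |η| < |ξ| needs q < n, and that of |ξ|^{-(n+q-2δ')} over |ξ| >
  -- |η| needs q > 2δ'. This q is the midpoint of the interval (2δ', n), which is nonempty exactly
  -- when δ' < n/2.
  set q : ℝ := n / 2 + δ' with hq
  set C₁ := ∫⁻ η in Metric.ball (0 : EuclideanSpace ℝ (Fin n)) 1, ENNReal.ofReal (‖η‖ ^ (-q))
    with hC₁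
  have hC₁t : C₁ ≠ ⊤ := (lintegral_ball_rpow_lt_top hn (by linarith) 1).ne
  set r : ℝ := q - 2 * δ' with hr
  set C₂ := ∫⁻ η in (Metric.closedBall (0 : EuclideanSpace ℝ (Fin n)) 1)ᶜ,
          ENNReal.ofReal (‖η‖ ^ (-(n + r))) with hC₂
  have hC₂t : C₂ ≠ ⊤ := (lintegral_compl_closedBall_rpow_lt_top (by linarith)).ne
  refine ⟨(C₁ + C₂).toNNReal, fun F hF σ hσ => ?_⟩
  rw [ENNReal.coe_toNNReal (by finiteness)]
  set S : Set (EuclideanSpace ℝ (Fin n) × EuclideanSpace ℝ (Fin n)) := {p | ‖p.2‖ < ‖p.1‖} with hS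
  have hSm : MeasurableSet S := measurableSet_lt (by fun_prop) (by fun_prop)
  set U : EuclideanSpace ℝ (Fin n) → EuclideanSpace ℝ (Fin n) → ℝ≥0∞ := fun ξ η =>
    S.indicator (fun p => ENNReal.ofReal (‖p.1‖ ^ (-n + 2 * δ' + q)) * ‖F p.1‖ₑ ^ 2 *
      ENNReal.ofReal (‖p.2‖ ^ (-q))) (ξ, η) with hU
  set V : EuclideanSpace ℝ (Fin n) → EuclideanSpace ℝ (Fin n) → ℝ≥0∞ := fun ξ η =>
    S.indicator (fun p => ENNReal.ofReal (‖p.2‖ ^ q) * ‖F p.2‖ₑ ^ 2 *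
      ENNReal.ofReal (‖p.1‖ ^ (-(n + r)))) (ξ, η) with hV
  have hUm : Measurable (Function.uncurry U) := Measurable.indicator (by fun_prop) hSm
  have hVm : Measurable (Function.uncurry V) := Measurable.indicator (by fun_prop) hSm
  have h1 : ∫⁻ ξ, ∫⁻ η, U ξ η ≤ C₁ * weightedSq δ' F := by
    rw [weightedSq, ← lintegral_const_mul _ (by fun_prop)]
    refine lintegral_mono fun ξ => ?_
    have h2 : ∫⁻ η, U ξ η = ENNReal.ofReal (‖ξ‖ ^ (-n + 2 * δ' + q)) * ‖F ξ‖ₑ ^ 2 *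
        ∫⁻ η in Metric.ball (0 : EuclideanSpace ℝ (Fin n)) ‖ξ‖, ENNReal.ofReal (‖η‖ ^ (-q)) := by
      rw [← lintegral_const_mul' _ _ (by finiteness), ← lintegral_indicator measurableSet_ball]
      refine lintegral_congr fun η => ?_
      simp only [hU, hS, Set.indicator, Set.mem_ofPred_eq, mem_ball_zero_iff]
    rw [h2]
    rcases (norm_nonneg ξ).eq_or_lt with h0 | h0
    · rw [← h0, Metric.ball_zero, setLIntegral_empty, mul_zero]
      exact zero_le
    · rw [lintegral_ball_rpow q h0, ← hC₁]
      refine le_of_eq ?_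
      have h3 : ‖ξ‖ ^ (2 * δ') = ‖ξ‖ ^ (-n + 2 * δ' + q) * ‖ξ‖ ^ (n - q) := by
        rw [← Real.rpow_add h0]
        congr 1
        ring
      rw [h3, ENNReal.ofReal_mul (by positivity)]
      ring
  have h2 : ∫⁻ ξ, ∫⁻ η, V ξ η ≤ C₂ * weightedSq δ' F := by
    rw [lintegral_lintegral_swap hVm.aemeasurable, weightedSq,
      ← lintegral_const_mul _ (by fun_prop)]
    refine lintegral_mono fun η => ?_
    have h2 : ∫⁻ ξ, V ξ η = ENNReal.ofReal (‖η‖ ^ q) * ‖F η‖ₑ ^ 2 *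
        ∫⁻ ξ in (Metric.closedBall (0 : EuclideanSpace ℝ (Fin n)) ‖η‖)ᶜ,
          ENNReal.ofReal (‖ξ‖ ^ (-(n + r))) := by
      rw [← lintegral_const_mul' _ _ (by finiteness),
        ← lintegral_indicator measurableSet_closedBall.compl]
      refine lintegral_congr fun ξ => ?_
      simp only [hV, hS, Set.indicator, Set.mem_ofPred_eq, Set.mem_compl_iff,
        mem_closedBall_zero_iff, not_le]
    rw [h2]
    rcases (norm_nonneg η).eq_or_lt with h0 | h0
    · rw [← h0, Real.zero_rpow (by linarith : 0 < q).ne', ENNReal.ofReal_zero, zero_mul,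
        zero_mul]
      exact zero_le
    · rw [lintegral_compl_closedBall_rpow r h0, ← hC₂]
      refine le_of_eq ?_
      have h3 : ‖η‖ ^ (2 * δ') = ‖η‖ ^ q * ‖η‖ ^ (-r) := by
        rw [← Real.rpow_add h0]
        congr 1
        ring
      rw [h3, ENNReal.ofReal_mul (by positivity)]
      ring
  have := nontrivial_euclideanSpace hn
  have h3 : farForm δ σ F ≤
      ∫⁻ ξ, ∫⁻ η, ENNReal.ofReal (σ ^ (δ + δ')) * (U ξ η + V ξ η) := by
    refine lintegral_mono fun ξ => ?_
    rw [← lintegral_indicator measurableSet_ball]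
    refine lintegral_mono_ae ?_
    filter_upwards [compl_mem_ae_iff.2 (measure_singleton (μ := volume)
      (0 : EuclideanSpace ℝ (Fin n)))] with η hη
    have hη0 : 0 < ‖η‖ := norm_pos_iff.2 hη
    by_cases hmem : ‖η‖ < ‖ξ‖
    · have hξ0 : 0 < ‖ξ‖ := hη0.trans hmem
      have hmem1 : η ∈ Metric.ball (0 : EuclideanSpace ℝ (Fin n)) ‖ξ‖ := by simpa using hmem
      have hmem2 : (ξ, η) ∈ S := hmem
      rw [Set.indicator_of_mem hmem1, hU, hV]
      simp only [Set.indicator_of_mem hmem2]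
      have h4 : ‖ξ‖ ^ (-(n + 2 * δ)) * min 1 ((σ * ‖ξ‖ ^ 2) ^ 2) ≤
          σ ^ (δ + δ') * ‖ξ‖ ^ (-n + 2 * δ') := by
        calc ‖ξ‖ ^ (-(n + 2 * δ)) * min 1 ((σ * ‖ξ‖ ^ 2) ^ 2) ≤
            ‖ξ‖ ^ (-(n + 2 * δ)) * (σ * ‖ξ‖ ^ 2) ^ (δ + δ') := by
              gcongr
              exact min_one_sq_le_rpow (by positivity) (by linarith) (by linarith)
          _ = σ ^ (δ + δ') * (‖ξ‖ ^ (-(n + 2 * δ)) * ‖ξ‖ ^ (2 * (δ + δ'))) := by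
              rw [Real.mul_rpow hσ (by positivity), ← Real.rpow_natCast ‖ξ‖ 2,
                ← Real.rpow_mul hξ0.le]
              push_cast
              ring
          _ = _ := by
              rw [← Real.rpow_add hξ0]
              congr 2
              ring
      -- B and C split the kernel so that BC = A² exactly; B carries |F(ξ)|² with an integrable
      -- power of η, and C carries |F(η)|² with an integrable power of ξ.
      have h5 := ENNReal_ofReal_mul_enorm_mul_le (A := ‖ξ‖ ^ (-n + 2 * δ'))
        (B := ‖ξ‖ ^ (-n + 2 * δ' + q) * ‖η‖ ^ (-q)) (C := ‖η‖ ^ q * ‖ξ‖ ^ (-(n + r)))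
        (by positivity) (by positivity) (by positivity) (by
          have h6 : ‖ξ‖ ^ (-n + 2 * δ' + q) * ‖η‖ ^ (-q) * (‖η‖ ^ q * ‖ξ‖ ^ (-(n + r))) =
              (‖ξ‖ ^ (-n + 2 * δ' + q) * ‖ξ‖ ^ (-(n + r))) * (‖η‖ ^ (-q) * ‖η‖ ^ q) := by ring
          rw [h6, ← Real.rpow_add hη0, neg_add_cancel, Real.rpow_zero, mul_one,
            ← Real.rpow_add hξ0, ← Real.rpow_natCast, ← Real.rpow_mul hξ0.le]
          refine le_of_eq ?_
          congr 1
          push_cast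
          ring) (F ξ) (F η)
      calc ENNReal.ofReal (‖ξ‖ ^ (-(n + 2 * δ)) * min 1 ((σ * ‖ξ‖ ^ 2) ^ 2)) * (‖F ξ‖ₑ * ‖F η‖ₑ)
          ≤ ENNReal.ofReal (σ ^ (δ + δ') * ‖ξ‖ ^ (-n + 2 * δ')) * (‖F ξ‖ₑ * ‖F η‖ₑ) :=
            mul_le_mul' (ENNReal.ofReal_le_ofReal h4) le_rfl
        _ = ENNReal.ofReal (σ ^ (δ + δ')) *
            (ENNReal.ofReal (‖ξ‖ ^ (-n + 2 * δ')) * (‖F ξ‖ₑ * ‖F η‖ₑ)) := by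
            rw [ENNReal.ofReal_mul (by positivity), mul_assoc]
        _ ≤ _ := by
            refine mul_le_mul' le_rfl (h5.trans (le_of_eq ?_))
            rw [ENNReal.ofReal_mul (by positivity), ENNReal.ofReal_mul (by positivity)]
            ring
    · rw [Set.indicator_of_notMem (by simpa using hmem)]
      exact zero_le
  refine h3.trans ?_
  rw [lintegral_lintegral_const_mul_add ENNReal.ofReal_ne_top hUm]
  calc ENNReal.ofReal (σ ^ (δ + δ')) * ((∫⁻ ξ, ∫⁻ η, U ξ η) + ∫⁻ ξ, ∫⁻ η, V ξ η)
      ≤ ENNReal.ofReal (σ ^ (δ + δ')) * (C₁ * weightedSq δ' F + C₂ * weightedSq δ' F) := by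
        gcongr
    _ = _ := by ring

end SchrodingerDispersion

namespace SchrodingerDispersion

/-! ### Low frequencies and the critical one-dimensional far part -/

theorem lintegral_mul_sq_le {α : Type*} [MeasurableSpace α] {μ : Measure α} {f g : α → ℝ≥0∞}
    (hf : AEMeasurable f μ) (hg : AEMeasurable g μ) :
    (∫⁻ a, f a * g a ∂μ) ^ 2 ≤ (∫⁻ a, f a ^ 2 ∂μ) * ∫⁻ a, g a ^ 2 ∂μ := by
  have h := ENNReal.lintegral_mul_le_Lp_mul_Lq μ Real.HolderConjugate.two_two hf hg
  calc (∫⁻ a, f a * g a ∂μ) ^ 2 ≤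
      ((∫⁻ a, f a ^ (2 : ℝ) ∂μ) ^ (1 / 2 : ℝ) * (∫⁻ a, g a ^ (2 : ℝ) ∂μ) ^ (1 / 2 : ℝ)) ^ 2 := by
        gcongr
        exact h
    _ = _ := by
        rw [mul_pow, ← ENNReal.rpow_natCast, ← ENNReal.rpow_natCast, ← ENNReal.rpow_mul,
          ← ENNReal.rpow_mul]
        norm_num

/-- The norm of Σ_δ contains no ‖f‖₂ and its weight vanishes at ξ = 0. The low frequencies are
recovered by comparison with the annulus 1 < |η| < 3: |F(ξ)|² ≤ 2|F(ξ)-F(η)|² + 2|F(η)|², where the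
first term is controlled by the energy because |ξ-η| ≤ 4, and the second by the weighted norm
because |η| > 1. Integrating over η in the annulus gives the bound. -/
theorem exists_lintegral_ball_enorm_sq_le {n : ℕ} (hn : 1 ≤ n) {δ : ℝ} (hδ : 0 < δ) :
    ∃ C : ℝ≥0, ∀ F : EuclideanSpace ℝ (Fin n) → ℂ, Measurable F →
      ∫⁻ ξ in Metric.ball 0 1, ‖F ξ‖ₑ ^ 2 ≤ C * (gagliardoEnergy δ F + weightedSq δ F) := by
  have := nontrivial_euclideanSpace hn
  set B : Set (EuclideanSpace ℝ (Fin n)) := Metric.ball 0 1 with hB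
  set A : Set (EuclideanSpace ℝ (Fin n)) := Metric.ball 0 3 \ Metric.closedBall 0 1 with hA
  have hAm : MeasurableSet A := measurableSet_ball.diff measurableSet_closedBall
  have hA0 : volume A ≠ 0 := by
    obtain ⟨e, he⟩ := exists_norm_eq (EuclideanSpace ℝ (Fin n)) zero_le_two
    refine ((Metric.isOpen_ball.sdiff Metric.isClosed_closedBall).measure_pos volume
      ⟨e, ?_, ?_⟩).ne'
    · rw [mem_ball_zero_iff, he]; norm_num
    · rw [mem_closedBall_zero_iff, he]; norm_num
  have hAt : volume A ≠ ⊤ := ((measure_mono Set.sdiff_subset).trans_lt measure_ball_lt_top).ne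
  have hBt : volume B ≠ ⊤ := measure_ball_lt_top.ne
  have h4 : (4 : ℝ) ^ (n + 2 * δ) ≠ 0 := by positivity
  set K : ℝ≥0∞ := 2 * ENNReal.ofReal (4 ^ (n + 2 * δ)) + 2 * volume B with hK
  have hKt : K ≠ ⊤ := by finiteness
  refine ⟨((volume A)⁻¹ * K).toNNReal, fun F hF => ?_⟩
  rw [ENNReal.coe_toNNReal (ENNReal.mul_ne_top (ENNReal.inv_ne_top.2 hA0) hKt), mul_assoc]
  suffices h : volume A * ∫⁻ ξ in B, ‖F ξ‖ₑ ^ 2 ≤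
      K * (gagliardoEnergy δ F + weightedSq δ F) by
    calc ∫⁻ ξ in B, ‖F ξ‖ₑ ^ 2 = (volume A)⁻¹ * (volume A * ∫⁻ ξ in B, ‖F ξ‖ₑ ^ 2) := by
          rw [← mul_assoc, ENNReal.inv_mul_cancel hA0 hAt, one_mul]
      _ ≤ _ := mul_le_mul' le_rfl h
  have h1 : volume A * ∫⁻ ξ in B, ‖F ξ‖ₑ ^ 2 =
      ∫⁻ ξ in B, ∫⁻ η in A, ‖F ξ‖ₑ ^ 2 := by
    simp only [setLIntegral_const]
    rw [lintegral_mul_const' _ _ hAt, mul_comm]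
  have h2 : ∫⁻ ξ in B, ∫⁻ η in A, ‖F ξ‖ₑ ^ 2 ≤
      ∫⁻ ξ in B, ∫⁻ η in A, (2 * ENNReal.ofReal (4 ^ (n + 2 * δ)) *
        (ENNReal.ofReal (gagliardoWeight δ (ξ - η)) * ‖F ξ - F η‖ₑ ^ 2) +
        2 * (ENNReal.ofReal (‖η‖ ^ (2 * δ)) * ‖F η‖ₑ ^ 2)) := by
    refine setLIntegral_mono' measurableSet_ball fun ξ hξ => setLIntegral_mono' hAm fun η hη => ?_
    have hξ1 : ‖ξ‖ < 1 := by simpa [hB] using hξ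
    have hη1 : 1 < ‖η‖ := by simpa using hη.2
    have hη3 : ‖η‖ < 3 := by simpa using hη.1
    have h3 : 1 ≤ 4 ^ (n + 2 * δ) * gagliardoWeight δ (ξ - η) := by
      have h5 : ‖ξ - η‖ ≤ 4 := (norm_sub_le ξ η).trans (by linarith)
      have h6 : 0 < ‖ξ - η‖ := by
        have := norm_sub_norm_le η ξ
        rw [norm_sub_rev] at this
        linarith
      have h7 : (4 : ℝ) ^ (-(n + 2 * δ)) ≤ gagliardoWeight δ (ξ - η) :=
        Real.rpow_le_rpow_of_nonpos h6 h5 (by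
          have : (0 : ℝ) ≤ n := by positivity
          linarith)
      calc (1 : ℝ) = 4 ^ (n + 2 * δ) * 4 ^ (-(n + 2 * δ)) := by
            rw [← Real.rpow_add (by norm_num), add_neg_cancel, Real.rpow_zero]
        _ ≤ _ := by gcongr
    have h5 : 1 ≤ ‖η‖ ^ (2 * δ) := Real.one_le_rpow hη1.le (by positivity)
    have h6 : ‖F ξ‖ ^ 2 ≤ 2 * 4 ^ (n + 2 * δ) * (gagliardoWeight δ (ξ - η) * ‖F ξ - F η‖ ^ 2) +
        2 * (‖η‖ ^ (2 * δ) * ‖F η‖ ^ 2) := by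
      have h7 : ‖F ξ‖ ≤ ‖F ξ - F η‖ + ‖F η‖ := by
        simpa using norm_add_le (F ξ - F η) (F η)
      have h8 : ‖F ξ‖ ^ 2 ≤ (‖F ξ - F η‖ + ‖F η‖) ^ 2 := by gcongr
      nlinarith [sq_nonneg (‖F ξ - F η‖ - ‖F η‖),
        mul_le_mul_of_nonneg_right h3 (sq_nonneg ‖F ξ - F η‖),
        mul_le_mul_of_nonneg_right h5 (sq_nonneg ‖F η‖)]
    have h7 := ENNReal.ofReal_le_ofReal h6
    have hw := gagliardoWeight_nonneg δ (ξ - η)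
    rw [ENNReal.ofReal_add (by positivity) (by positivity), ENNReal.ofReal_mul (by positivity),
      ENNReal.ofReal_mul (zero_le_two (α := ℝ)), ENNReal.ofReal_mul hw,
      ENNReal.ofReal_mul (zero_le_two (α := ℝ)), ENNReal.ofReal_mul (by positivity), ENNReal.ofReal_pow (norm_nonneg _),
      ENNReal.ofReal_pow (norm_nonneg _), ENNReal.ofReal_pow (norm_nonneg _), ofReal_norm,
      ofReal_norm, ofReal_norm, ENNReal.ofReal_ofNat] at h7
    exact h7
  rw [h1]
  refine h2.trans ?_
  have h3 (ξ : EuclideanSpace ℝ (Fin n)) :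
      ∫⁻ η in A, (2 * ENNReal.ofReal (4 ^ (n + 2 * δ)) *
        (ENNReal.ofReal (gagliardoWeight δ (ξ - η)) * ‖F ξ - F η‖ₑ ^ 2) +
        2 * (ENNReal.ofReal (‖η‖ ^ (2 * δ)) * ‖F η‖ₑ ^ 2)) ≤
      2 * ENNReal.ofReal (4 ^ (n + 2 * δ)) *
        (∫⁻ η, ENNReal.ofReal (gagliardoWeight δ (ξ - η)) * ‖F ξ - F η‖ₑ ^ 2) +
        2 * weightedSq δ F := by
    refine (setLIntegral_le_lintegral _ _).trans ?_
    rw [lintegral_add_left (by fun_prop), lintegral_const_mul' _ _ (by finiteness),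
      lintegral_const_mul' _ _ (by finiteness), weightedSq]
  refine (lintegral_mono h3).trans ?_
  rw [lintegral_add_left (by fun_prop), lintegral_const_mul' _ _ (by finiteness),
    setLIntegral_const]
  calc 2 * ENNReal.ofReal (4 ^ (n + 2 * δ)) * (∫⁻ ξ in B, ∫⁻ η,
        ENNReal.ofReal (gagliardoWeight δ (ξ - η)) * ‖F ξ - F η‖ₑ ^ 2) +
        2 * weightedSq δ F * volume B
      ≤ 2 * ENNReal.ofReal (4 ^ (n + 2 * δ)) * gagliardoEnergy δ F +
        2 * volume B * weightedSq δ F := by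
        rw [gagliardoEnergy, lintegral_gagliardoMeasure δ (by fun_prop)]
        refine add_le_add (mul_le_mul' le_rfl (setLIntegral_le_lintegral _ _)) (le_of_eq ?_)
        ring
    _ ≤ K * gagliardoEnergy δ F + K * weightedSq δ F := by
        gcongr
        · exact le_self_add
        · exact le_add_self
    _ = _ := by ring

/-- Outside the unit ball |ξ|^{2δ'} ≤ |ξ|^{2δ}; inside it the weight is at most 1 and the comparison
with the annulus applies. The constant does not depend on δ'. -/
theorem exists_weightedSq_le {n : ℕ} (hn : 1 ≤ n) {δ : ℝ} (hδ : 0 < δ) :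
    ∃ C : ℝ≥0, ∀ F : EuclideanSpace ℝ (Fin n) → ℂ, Measurable F → ∀ δ' : ℝ, 0 ≤ δ' → δ' ≤ δ →
      weightedSq δ' F ≤ C * (gagliardoEnergy δ F + weightedSq δ F) := by
  obtain ⟨C, hC⟩ := exists_lintegral_ball_enorm_sq_le hn hδ
  refine ⟨C + 1, fun F hF δ' h0 h1 => ?_⟩
  have h2 (ξ : EuclideanSpace ℝ (Fin n)) : ENNReal.ofReal (‖ξ‖ ^ (2 * δ')) * ‖F ξ‖ₑ ^ 2 ≤
      (Metric.ball 0 1).indicator (fun ξ => ‖F ξ‖ₑ ^ 2) ξ +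
        ENNReal.ofReal (‖ξ‖ ^ (2 * δ)) * ‖F ξ‖ₑ ^ 2 := by
    by_cases h : ξ ∈ Metric.ball (0 : EuclideanSpace ℝ (Fin n)) 1
    · rw [Set.indicator_of_mem h]
      refine le_trans ?_ le_self_add
      refine mul_le_of_le_one_left' ?_
      rw [ENNReal.ofReal_le_one]
      exact Real.rpow_le_one (norm_nonneg _) (by simpa using (mem_ball_zero_iff.1 h).le)
        (by linarith)
    · refine le_trans ?_ le_add_self
      gcongr
      simpa using h
  calc weightedSq δ' F ≤ ∫⁻ ξ, ((Metric.ball 0 1).indicator (fun ξ => ‖F ξ‖ₑ ^ 2) ξ +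
        ENNReal.ofReal (‖ξ‖ ^ (2 * δ)) * ‖F ξ‖ₑ ^ 2) := lintegral_mono h2
    _ = (∫⁻ ξ in Metric.ball 0 1, ‖F ξ‖ₑ ^ 2) + weightedSq δ F := by
        rw [lintegral_add_right _ (by fun_prop), lintegral_indicator measurableSet_ball, weightedSq]
    _ ≤ C * (gagliardoEnergy δ F + weightedSq δ F) +
          1 * (gagliardoEnergy δ F + weightedSq δ F) := by
        rw [one_mul]
        exact add_le_add (hC F hF) le_add_self
    _ = _ := by
        push_cast
        ring

/-- `‖F‖₁² ≤ C(‖F‖₂² + ‖|ξ|^δ F‖₂²)` if `2δ > n`. -/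
theorem exists_lintegral_enorm_sq_le {n : ℕ} (hn : 1 ≤ n) {δ : ℝ} (hδ : n < 2 * δ) :
    ∃ C : ℝ≥0, ∀ F : EuclideanSpace ℝ (Fin n) → ℂ, Measurable F →
      (∫⁻ ξ, ‖F ξ‖ₑ) ^ 2 ≤ C * (gagliardoEnergy δ F + weightedSq δ F) := by
  have hn' : (1 : ℝ) ≤ n := by exact_mod_cast hn
  have hδ0 : 0 < δ := by linarith
  obtain ⟨C, hC⟩ := exists_weightedSq_le hn hδ0
  have hint := integrable_one_add_norm (E := EuclideanSpace ℝ (Fin n)) (μ := volume) (r := 2 * δ)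
    (by rwa [finrank_euclideanSpace_fin])
  set I : ℝ≥0∞ := ∫⁻ ξ : EuclideanSpace ℝ (Fin n), ENNReal.ofReal ((1 + ‖ξ‖) ^ (-(2 * δ)))
  have hI : I ≠ ⊤ := hint.lintegral_lt_top.ne
  refine ⟨I.toNNReal * (ENNReal.ofReal (2 ^ (2 * δ))).toNNReal * (2 * C), fun F hF => ?_⟩
  have h0 (ξ : EuclideanSpace ℝ (Fin n)) : 0 < 1 + ‖ξ‖ := by positivity
  -- Cauchy-Schwarz against (1+|ξ|)^{-δ}, which is square integrable because 2δ > n.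
  have h1 (ξ : EuclideanSpace ℝ (Fin n)) :
      ‖F ξ‖ₑ = ENNReal.ofReal ((1 + ‖ξ‖) ^ (-δ)) *
        (ENNReal.ofReal ((1 + ‖ξ‖) ^ δ) * ‖F ξ‖ₑ) := by
    rw [← mul_assoc, ← ENNReal.ofReal_mul (by positivity), ← Real.rpow_add (h0 ξ),
      neg_add_cancel, Real.rpow_zero, ENNReal.ofReal_one, one_mul]
  rw [lintegral_congr h1]
  refine (lintegral_mul_sq_le (by fun_prop) (by fun_prop)).trans ?_
  have h2 : ∫⁻ ξ : EuclideanSpace ℝ (Fin n), ENNReal.ofReal ((1 + ‖ξ‖) ^ (-δ)) ^ 2 = I := by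
    refine lintegral_congr fun ξ => ?_
    rw [← ENNReal.ofReal_pow (by positivity), ← Real.rpow_natCast, ← Real.rpow_mul (h0 ξ).le]
    congr 2
    push_cast
    ring
  have h3 : ∫⁻ ξ, (ENNReal.ofReal ((1 + ‖ξ‖) ^ δ) * ‖F ξ‖ₑ) ^ 2 ≤
      ENNReal.ofReal (2 ^ (2 * δ)) * (weightedSq 0 F + weightedSq δ F) := by
    rw [weightedSq, weightedSq, ← lintegral_add_left (by fun_prop),
      ← lintegral_const_mul' _ _ ENNReal.ofReal_ne_top]
    refine lintegral_mono fun ξ => ?_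
    rw [mul_pow, ← add_mul, ← mul_assoc]
    refine mul_le_mul' ?_ le_rfl
    rw [← ENNReal.ofReal_pow (by positivity), ← ENNReal.ofReal_add (by positivity) (by positivity),
      ← ENNReal.ofReal_mul (by positivity)]
    refine ENNReal.ofReal_le_ofReal ?_
    rw [← Real.rpow_natCast, ← Real.rpow_mul (h0 ξ).le, mul_zero, Real.rpow_zero,
      mul_comm δ, Nat.cast_ofNat]
    rcases le_total ‖ξ‖ 1 with h | h
    · have h5 : (0 : ℝ) ≤ ‖ξ‖ ^ (2 * δ) := by positivity
      calc (1 + ‖ξ‖) ^ (2 * δ) ≤ 2 ^ (2 * δ) :=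
            Real.rpow_le_rpow (h0 ξ).le (by linarith) (by positivity)
        _ = 2 ^ (2 * δ) * 1 := (mul_one _).symm
        _ ≤ _ := by gcongr; linarith
    · calc (1 + ‖ξ‖) ^ (2 * δ) ≤ (2 * ‖ξ‖) ^ (2 * δ) :=
            Real.rpow_le_rpow (h0 ξ).le (by linarith) (by positivity)
        _ = 2 ^ (2 * δ) * ‖ξ‖ ^ (2 * δ) := Real.mul_rpow (by norm_num) (norm_nonneg ξ)
        _ ≤ _ := by gcongr; linarith
  rw [h2]
  push_cast
  rw [ENNReal.coe_toNNReal hI, ENNReal.coe_toNNReal ENNReal.ofReal_ne_top]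
  calc I * _ ≤ I * (ENNReal.ofReal (2 ^ (2 * δ)) * (weightedSq 0 F + weightedSq δ F)) := by
        gcongr
    _ ≤ I * (ENNReal.ofReal (2 ^ (2 * δ)) * (C * (gagliardoEnergy δ F + weightedSq δ F) +
          C * (gagliardoEnergy δ F + weightedSq δ F))) := by
        gcongr
        · exact hC F hF 0 le_rfl hδ0.le
        · exact hC F hF δ hδ0.le le_rfl
    _ = _ := by ring

/-- The one-dimensional bound of the far part when `δ > 1/2`. -/
theorem exists_farForm_le_of_half_lt {δ : ℝ} (hδ₀ : 1 / 2 < δ) (hδ₁ : δ < 1) :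
    ∃ C : ℝ≥0, ∀ F : EuclideanSpace ℝ (Fin 1) → ℂ, Measurable F → ∀ σ : ℝ, 0 ≤ σ →
      farForm δ σ F ≤ C * ENNReal.ofReal (σ ^ (1 / 4 + 3 / 2 * δ)) *
        (gagliardoEnergy δ F + weightedSq δ F) := by
  obtain ⟨C₁, hC₁⟩ := exists_lintegral_enorm_sq_le le_rfl
    (by push_cast; linarith : ((1 : ℕ) : ℝ) < 2 * δ)
  -- This is the far kernel at σ = 1 divided by |ξ|^δ, the factor |ξ|^δ being kept with F. For
  -- general σ it becomes τ^{1+3δ} k(τξ) with τ = √σ, so all dependence on σ is a dilation.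
  set k : EuclideanSpace ℝ (Fin 1) → ℝ := fun ξ =>
    ‖ξ‖ ^ (-(1 + 3 * δ)) * min 1 ((‖ξ‖ ^ 2) ^ 2) with hk
  have hk0 (ξ : EuclideanSpace ℝ (Fin 1)) : 0 ≤ k ξ := by positivity
  set I : ℝ≥0∞ := ∫⁻ ξ, ENNReal.ofReal (k ξ ^ 2) with hI
  have hIt : I ≠ ⊤ := by
    -- The square of k is at most |ξ|^{6-6δ} near 0 and |ξ|^{-2-6δ} at infinity; both are integrable
    -- on the line.
    have hle (ξ : EuclideanSpace ℝ (Fin 1)) : ENNReal.ofReal (k ξ ^ 2) ≤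
        (Metric.ball 0 2).indicator (fun ξ => ENNReal.ofReal (‖ξ‖ ^ (-(6 * δ - 6)))) ξ +
        (Metric.closedBall 0 1)ᶜ.indicator
          (fun ξ => ENNReal.ofReal (‖ξ‖ ^ (-((1 : ℕ) + (1 + 6 * δ))))) ξ := by
      rcases le_or_gt ‖ξ‖ 1 with h | h
      · have hm : ξ ∈ Metric.ball (0 : EuclideanSpace ℝ (Fin 1)) 2 := by
          rw [mem_ball_zero_iff]
          linarith
        rw [Set.indicator_of_mem hm]
        refine le_trans (ENNReal.ofReal_le_ofReal ?_) le_self_add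
        rcases (norm_nonneg ξ).eq_or_lt with h0 | h0
        · simp only [hk, ← h0]
          norm_num
          positivity
        · calc k ξ ^ 2 ≤ (‖ξ‖ ^ (-(1 + 3 * δ)) * (‖ξ‖ ^ 2) ^ 2) ^ 2 := by
                gcongr
                exact mul_le_mul_of_nonneg_left (min_le_right _ _) (by positivity)
            _ = ‖ξ‖ ^ (-(6 * δ - 6)) := by
                rw [mul_pow, ← pow_mul, ← pow_mul, ← Real.rpow_natCast, ← Real.rpow_natCast,
                  ← Real.rpow_mul h0.le, ← Real.rpow_add h0]
                congr 1
                push_cast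
                ring
      · have hm : ξ ∈ (Metric.closedBall (0 : EuclideanSpace ℝ (Fin 1)) 1)ᶜ := by
          rw [Set.mem_compl_iff, mem_closedBall_zero_iff]
          linarith
        rw [Set.indicator_of_mem hm]
        refine le_trans (ENNReal.ofReal_le_ofReal ?_) le_add_self
        have h0 : 0 < ‖ξ‖ := by linarith
        calc k ξ ^ 2 ≤ (‖ξ‖ ^ (-(1 + 3 * δ)) * 1) ^ 2 := by
              gcongr
              exact mul_le_mul_of_nonneg_left (min_le_left _ _) (by positivity)
          _ = ‖ξ‖ ^ (-((1 : ℕ) + (1 + 6 * δ))) := by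
              rw [mul_one, ← Real.rpow_natCast, ← Real.rpow_mul h0.le]
              congr 1
              push_cast
              ring
    refine ne_top_of_le_ne_top ?_ (lintegral_mono hle)
    rw [lintegral_add_left (Measurable.indicator (by fun_prop) measurableSet_ball),
      lintegral_indicator measurableSet_ball, lintegral_indicator measurableSet_closedBall.compl]
    exact ENNReal.add_ne_top.2 ⟨
      (lintegral_ball_rpow_lt_top (n := 1) le_rfl (by push_cast; linarith) 2).ne,
      (lintegral_compl_closedBall_rpow_lt_top (n := 1) (by linarith)).ne⟩
  refine ⟨C₁ + I.toNNReal, fun F hF σ hσ => ?_⟩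
  set N := gagliardoEnergy δ F + weightedSq δ F with hN
  rcases hσ.eq_or_lt with rfl | hσ
  · have : farForm δ 0 F = 0 := by simp [farForm]
    rw [this]
    exact zero_le
  set τ := √σ with hτ
  have hτ0 : 0 < τ := Real.sqrt_pos.2 hσ
  have hτ2 : τ ^ 2 = σ := Real.sq_sqrt hσ.le
  set G : ℝ≥0∞ := ∫⁻ ξ, ENNReal.ofReal (τ ^ (1 + 3 * δ) * k (τ • ξ)) *
    (ENNReal.ofReal (‖ξ‖ ^ δ) * ‖F ξ‖ₑ) with hG
  have h1 : farForm δ σ F ≤ (∫⁻ η, ‖F η‖ₑ) * G := by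
    rw [hG, ← lintegral_const_mul _ (by fun_prop)]
    refine lintegral_mono fun ξ => ?_
    refine (setLIntegral_le_lintegral _ _).trans ?_
    have h2 (η : EuclideanSpace ℝ (Fin 1)) :
        ENNReal.ofReal (‖ξ‖ ^ (-((1 : ℕ) + 2 * δ)) * min 1 ((σ * ‖ξ‖ ^ 2) ^ 2)) *
          (‖F ξ‖ₑ * ‖F η‖ₑ) =
        ENNReal.ofReal (‖ξ‖ ^ (-((1 : ℕ) + 2 * δ)) * min 1 ((σ * ‖ξ‖ ^ 2) ^ 2)) * ‖F ξ‖ₑ *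
          ‖F η‖ₑ := by ring
    rw [lintegral_congr h2, lintegral_const_mul _ (by fun_prop), mul_comm]
    refine mul_le_mul' le_rfl ?_
    rw [← mul_assoc, ← ENNReal.ofReal_mul (by positivity)]
    refine mul_le_mul' (ENNReal.ofReal_le_ofReal ?_) le_rfl
    rcases (norm_nonneg ξ).eq_or_lt with h0 | h0
    · rw [← h0, Real.zero_rpow (by linarith : (0:ℝ) < δ).ne']
      norm_num
    · refine le_of_eq ?_
      simp only [hk]
      rw [norm_smul, Real.norm_of_nonneg hτ0.le, Real.mul_rpow hτ0.le h0.le, mul_pow τ, hτ2]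
      have h3 : τ ^ (1 + 3 * δ) * (τ ^ (-(1 + 3 * δ)) * ‖ξ‖ ^ (-(1 + 3 * δ)) *
          min 1 ((σ * ‖ξ‖ ^ 2) ^ 2)) * ‖ξ‖ ^ δ = (τ ^ (1 + 3 * δ) * τ ^ (-(1 + 3 * δ))) *
          (‖ξ‖ ^ (-(1 + 3 * δ)) * ‖ξ‖ ^ δ) * min 1 ((σ * ‖ξ‖ ^ 2) ^ 2) := by ring
      rw [h3, ← Real.rpow_add hτ0, ← Real.rpow_add h0, add_neg_cancel, Real.rpow_zero, one_mul]
      congr 2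
      push_cast
      ring
  -- Cauchy-Schwarz in ξ. The prefactor contributes τ^{2+6δ} and the dilation τ^{-1}; the product
  -- τ^{1+6δ} is the square of σ^{1/4+3δ/2}.
  have h2 : G ^ 2 ≤ ENNReal.ofReal (σ ^ (1 / 4 + 3 / 2 * δ)) ^ 2 * I * N := by
    refine (lintegral_mul_sq_le (by fun_prop) (by fun_prop)).trans ?_
    refine mul_le_mul' (le_of_eq ?_) ?_
    · have h3 (ξ : EuclideanSpace ℝ (Fin 1)) :
          ENNReal.ofReal (τ ^ (1 + 3 * δ) * k (τ • ξ)) ^ 2 =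
            ENNReal.ofReal (τ ^ (2 + 6 * δ)) * ENNReal.ofReal (k (τ • ξ) ^ 2) := by
        rw [← ENNReal.ofReal_pow (mul_nonneg (by positivity) (hk0 _)), mul_pow,
          ENNReal.ofReal_mul (by positivity), ← Real.rpow_natCast (τ ^ _), ← Real.rpow_mul hτ0.le]
        congr 3
        push_cast
        ring
      rw [lintegral_congr h3, lintegral_const_mul' _ _ ENNReal.ofReal_ne_top,
        lintegral_comp_smul (fun ξ => ENNReal.ofReal (k ξ ^ 2)) hτ0, ← mul_assoc,
        ← ENNReal.ofReal_mul (by positivity), ← hI, ← Real.rpow_add hτ0,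
        ← ENNReal.ofReal_pow (by positivity), ← hτ2, ← Real.rpow_natCast τ 2,
        ← Real.rpow_mul hτ0.le, ← Real.rpow_natCast (τ ^ _), ← Real.rpow_mul hτ0.le]
      congr 3
      push_cast
      ring
    · refine le_trans (le_of_eq ?_) (le_add_self : weightedSq δ F ≤ N)
      refine lintegral_congr fun ξ => ?_
      rw [mul_pow, ← ENNReal.ofReal_pow (by positivity), ← Real.rpow_natCast,
        ← Real.rpow_mul (norm_nonneg ξ)]
      congr 3
      push_cast
      ring
  have h3 : farForm δ σ F ^ 2 ≤
      ((C₁ + I.toNNReal : ℝ≥0) * ENNReal.ofReal (σ ^ (1 / 4 + 3 / 2 * δ)) * N) ^ 2 := by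
    calc farForm δ σ F ^ 2 ≤ ((∫⁻ η, ‖F η‖ₑ) * G) ^ 2 := by gcongr
      _ = (∫⁻ η, ‖F η‖ₑ) ^ 2 * G ^ 2 := mul_pow _ _ _
      _ ≤ (C₁ * N) * (ENNReal.ofReal (σ ^ (1 / 4 + 3 / 2 * δ)) ^ 2 * I * N) := by
          gcongr
          exact hC₁ F hF
      _ = (C₁ * I) * (ENNReal.ofReal (σ ^ (1 / 4 + 3 / 2 * δ)) * N) ^ 2 := by ring
      -- The product C₁I is replaced by a square so that the estimate of squares can be undone.
      _ ≤ (C₁ + I) ^ 2 * (ENNReal.ofReal (σ ^ (1 / 4 + 3 / 2 * δ)) * N) ^ 2 := by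
          gcongr
          rw [sq]
          gcongr
          · exact le_self_add
          · exact le_add_self
      _ = _ := by
          rw [ENNReal.coe_add, ENNReal.coe_toNNReal hIt]
          ring
  exact (ENNReal.pow_le_pow_left_iff two_ne_zero).1 h3

/-- The bound of `oscillationForm` that yields the regularity of the dispersion. -/
theorem exists_oscillationForm_le {n : ℕ} (hn : 1 ≤ n) {δ α : ℝ} (hδ₀ : 0 < δ) (hδ₁ : δ < 1)
    (hα : IsRegularityExponent n δ α) :
    ∃ C : ℝ≥0, ∀ F : EuclideanSpace ℝ (Fin n) → ℂ, Measurable F → ∀ σ : ℝ, 0 ≤ σ → σ ≤ 1 →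
      oscillationForm δ σ F ≤ C * ENNReal.ofReal (σ ^ α) *
        (gagliardoEnergy δ F + weightedSq δ F) := by
  have hT : truncatedMoment n δ ≠ ⊤ := (truncatedMoment_lt_top hn hδ₀ hδ₁).ne
  have key : 0 < α ∧ α ≤ 2 * δ ∧
      ∃ C : ℝ≥0, ∀ F : EuclideanSpace ℝ (Fin n) → ℂ, Measurable F → ∀ σ : ℝ, 0 ≤ σ → σ ≤ 1 →
        farForm δ σ F ≤ C * ENNReal.ofReal (σ ^ α) * (gagliardoEnergy δ F + weightedSq δ F) := by
    have far (δ' : ℝ) (h0 : 0 ≤ δ') (h1 : δ' ≤ δ) (h2 : δ' < n / 2) (hα : 0 < α)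
        (h3 : α ≤ δ + δ') : ∃ C : ℝ≥0, ∀ F : EuclideanSpace ℝ (Fin n) → ℂ, Measurable F →
        ∀ σ : ℝ, 0 ≤ σ → σ ≤ 1 →
        farForm δ σ F ≤ C * ENNReal.ofReal (σ ^ α) * (gagliardoEnergy δ F + weightedSq δ F) := by
      obtain ⟨C, hC⟩ := exists_farForm_le hn hδ₁ h0 h1 h2
      obtain ⟨C', hC'⟩ := exists_weightedSq_le hn hδ₀
      refine ⟨C * C', fun F hF σ hσ0 hσ1 => (hC F hF σ hσ0).trans ?_⟩
      calc C * ENNReal.ofReal (σ ^ (δ + δ')) * weightedSq δ' F ≤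
          C * ENNReal.ofReal (σ ^ α) * (C' * (gagliardoEnergy δ F + weightedSq δ F)) := by
            refine mul_le_mul' (mul_le_mul' le_rfl (ENNReal.ofReal_le_ofReal ?_))
              (hC' F hF δ' h0 h1)
            exact Real.rpow_le_rpow_of_exponent_ge_of_imp hσ0 hσ1 h3 (fun _ h => by linarith)
        _ = _ := by
            push_cast
            ring
    rcases hα with ⟨h, rfl⟩ | ⟨⟨rfl, rfl⟩, h0, h1⟩ | ⟨⟨rfl, h⟩, rfl⟩
    · refine ⟨by linarith, le_rfl, far δ hδ₀.le le_rfl ?_ (by linarith) (by linarith)⟩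
      rcases h with h | ⟨rfl, h⟩
      · have : (2 : ℝ) ≤ n := by exact_mod_cast h
        linarith
      · push_cast
        linarith
    -- For n = 1, δ = 1/2 Schur's test requires δ' < 1/2 strictly, while exponent α requires δ + δ'
    -- ≥ α; this δ' satisfies both precisely because α < 1.
    · refine ⟨h0, by linarith, far (max 0 (α - 1 / 2)) (le_max_left _ _)
        (max_le (by norm_num) (by linarith)) (max_lt (by norm_num) ?_) h0 ?_⟩
      · push_cast
        linarith
      · linarith [le_max_right 0 (α - 1 / 2)]
    · refine ⟨by linarith, by linarith, ?_⟩
      obtain ⟨C, hC⟩ := exists_farForm_le_of_half_lt h hδ₁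
      exact ⟨C, fun F hF σ h0 _ => hC F hF σ h0⟩
  obtain ⟨hα0, hαδ, C, hC⟩ := key
  set K₁ : ℝ≥0∞ := 2 * truncatedMoment n δ * ENNReal.ofReal (3 ^ (2 * δ)) with hK₁
  set K₂ : ℝ≥0∞ := 2 * ENNReal.ofReal (2 ^ (n + 2 * δ)) with hK₂
  have hK₁t : K₁ ≠ ⊤ := by finiteness
  have hK₂t : K₂ ≠ ⊤ := by finiteness
  refine ⟨K₁.toNNReal + K₂.toNNReal * C, fun F hF σ hσ0 hσ1 => ?_⟩
  refine (oscillationForm_le hδ₀ hσ0 hF).trans ?_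
  push_cast
  rw [ENNReal.coe_toNNReal hK₁t, ENNReal.coe_toNNReal hK₂t]
  have h1 : ENNReal.ofReal ((3 * σ) ^ (2 * δ)) ≤
      ENNReal.ofReal (3 ^ (2 * δ)) * ENNReal.ofReal (σ ^ α) := by
    rw [← ENNReal.ofReal_mul (by positivity), Real.mul_rpow (by norm_num) hσ0]
    refine ENNReal.ofReal_le_ofReal (mul_le_mul_of_nonneg_left ?_ (by positivity))
    exact Real.rpow_le_rpow_of_exponent_ge_of_imp hσ0 hσ1 hαδ (fun _ h => by linarith)
  calc 2 * truncatedMoment n δ * ENNReal.ofReal ((3 * σ) ^ (2 * δ)) * weightedSq δ F +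
        2 * ENNReal.ofReal (2 ^ (n + 2 * δ)) * farForm δ σ F
      ≤ 2 * truncatedMoment n δ * (ENNReal.ofReal (3 ^ (2 * δ)) * ENNReal.ofReal (σ ^ α)) *
          (gagliardoEnergy δ F + weightedSq δ F) +
        K₂ * (C * ENNReal.ofReal (σ ^ α) * (gagliardoEnergy δ F + weightedSq δ F)) := by
        gcongr
        · exact le_add_self
        · exact hC F hF σ hσ0 hσ1
    _ = _ := by
        rw [hK₁]
        ring

end SchrodingerDispersion

namespace SchrodingerDispersion

/-! ### The dispersion as a Gagliardo energy -/

theorem gagliardoEnergy_congr_ae {n : ℕ} (δ : ℝ) {F G : EuclideanSpace ℝ (Fin n) → ℂ}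
    (h : F =ᵐ[volume] G) : gagliardoEnergy δ F = gagliardoEnergy δ G := by
  refine lintegral_congr_ae ((gagliardoMeasure_absolutelyContinuous n δ).ae_le ?_)
  filter_upwards [Measure.quasiMeasurePreserving_fst.ae_eq_comp h,
    Measure.quasiMeasurePreserving_snd.ae_eq_comp h] with p h1 h2
  simp only [Function.comp_apply] at h1 h2
  rw [h1, h2]

theorem fourier_schrodinger_ae {n : ℕ} (t : ℝ) (f : L2 n) :
    (𝓕 (schrodinger t f) : L2 n) =ᵐ[volume] fun ξ => phase t ξ * (𝓕 f : L2 n) ξ := by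
  rw [schrodinger, fourier_fourierInv_eq]
  exact MemLp.coeFn_toLp (memLp_phase_mul t (𝓕 f : L2 n))

theorem measurable_fourier {n : ℕ} (f : L2 n) : Measurable (𝓕 f : L2 n) :=
  (Lp.stronglyMeasurable _).measurable

theorem sigmaNormSq_eq {n : ℕ} (δ : ℝ) (f : L2 n) :
    sigmaNormSq δ f = weightedSq δ f + weightedSq δ (𝓕 f : L2 n) := by
  rw [sigmaNormSq, weightedNorm_sq, weightedNorm_sq]

theorem ofReal_dispersionDensity {n : ℕ} (δ : ℝ) (f : L2 n) (t : ℝ)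
    (x : EuclideanSpace ℝ (Fin n)) : ENNReal.ofReal (dispersionDensity δ f t x) =
      ENNReal.ofReal (‖x‖ ^ (2 * δ)) * ‖schrodinger t f x‖ₑ ^ 2 := by
  rw [dispersionDensity, ENNReal.ofReal_mul (by positivity), ENNReal.ofReal_pow (norm_nonneg _),
    ofReal_norm]

theorem dispersionDensity_nonneg {n : ℕ} (δ : ℝ) (f : L2 n) (t : ℝ)
    (x : EuclideanSpace ℝ (Fin n)) : 0 ≤ dispersionDensity δ f t x := by
  unfold dispersionDensity
  positivity

theorem measurable_dispersionDensity {n : ℕ} (δ : ℝ) (f : L2 n) (t : ℝ) :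
    Measurable (dispersionDensity δ f t) := by
  have h : Measurable (schrodinger t f) := (Lp.stronglyMeasurable _).measurable
  unfold dispersionDensity
  fun_prop

/-- `c` is the constant in the Gagliardo representation of `‖|x|^δ g‖₂²`. -/
def IsGagliardoConstant (n : ℕ) (δ c : ℝ) : Prop :=
  0 < c ∧ ∀ x : EuclideanSpace ℝ (Fin n),
    oscillationMoment δ x = ENNReal.ofReal (c * ‖x‖ ^ (2 * δ))

variable {n : ℕ} {δ c : ℝ}

theorem IsGagliardoConstant.energy_eq (hc : IsGagliardoConstant n δ c) (f : L2 n) :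
    gagliardoEnergy δ (𝓕 f : L2 n) = ENNReal.ofReal c * weightedSq δ f :=
  lintegral_fourier_sub_gagliardoMeasure hc.1.le hc.2 f

theorem IsGagliardoConstant.energy_phase_eq (hc : IsGagliardoConstant n δ c) (f : L2 n) (t : ℝ) :
    gagliardoEnergy δ (fun ξ => phase t ξ * (𝓕 f : L2 n) ξ) =
      ENNReal.ofReal c * ∫⁻ x, ENNReal.ofReal (dispersionDensity δ f t x) := by
  rw [← gagliardoEnergy_congr_ae δ (fourier_schrodinger_ae t f), hc.energy_eq, weightedSq]
  simp only [ofReal_dispersionDensity]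

/-- The energy controlled by the norm of `Σ_δ`. -/
theorem IsGagliardoConstant.energy_add_le (hc : IsGagliardoConstant n δ c) (f : L2 n) :
    gagliardoEnergy δ (𝓕 f : L2 n) + weightedSq δ (𝓕 f : L2 n) ≤
      ENNReal.ofReal (c + 1) * sigmaNormSq δ f := by
  rw [hc.energy_eq, sigmaNormSq_eq, mul_add]
  have h1 : ENNReal.ofReal c ≤ ENNReal.ofReal (c + 1) := ENNReal.ofReal_le_ofReal (by linarith)
  have h2 : 1 ≤ ENNReal.ofReal (c + 1) := by
    rw [ENNReal.one_le_ofReal]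
    linarith [hc.1]
  exact add_le_add (mul_le_mul' h1 le_rfl) (le_mul_of_one_le_left' h2)

theorem IsGagliardoConstant.energy_phase_le (hc : IsGagliardoConstant n δ c) (hδ : 0 < δ)
    (f : L2 n) (t : ℝ) :
    gagliardoEnergy δ (fun ξ => phase t ξ * (𝓕 f : L2 n) ξ) ≤
      (2 + 16 * truncatedMoment n δ * ENNReal.ofReal ((Real.pi * |t|) ^ (2 * δ))) *
        (ENNReal.ofReal (c + 1) * sigmaNormSq δ f) := by
  refine (gagliardoEnergy_phase_mul_le hδ t (measurable_fourier f)).trans ?_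
  rw [add_mul]
  gcongr
  · exact le_self_add.trans (hc.energy_add_le f)
  · exact le_add_self.trans (hc.energy_add_le f)

theorem IsGagliardoConstant.energy_phase_lt_top (hc : IsGagliardoConstant n δ c) (hn : 1 ≤ n)
    (hδ₀ : 0 < δ) (hδ₁ : δ < 1) {f : L2 n} (hf : MemSigma δ f) (t : ℝ) :
    gagliardoEnergy δ (fun ξ => phase t ξ * (𝓕 f : L2 n) ξ) < ⊤ := by
  refine (hc.energy_phase_le hδ₀ f t).trans_lt ?_
  have h1 := truncatedMoment_lt_top hn hδ₀ hδ₁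
  have h2 : sigmaNormSq δ f < ⊤ := hf
  have h3 : 16 * truncatedMoment n δ * ENNReal.ofReal ((Real.pi * |t|) ^ (2 * δ)) < ⊤ :=
    ENNReal.mul_lt_top (ENNReal.mul_lt_top (by norm_num) h1) ENNReal.ofReal_lt_top
  exact ENNReal.mul_lt_top (ENNReal.add_lt_top.2 ⟨by norm_num, h3⟩)
    (ENNReal.mul_lt_top ENNReal.ofReal_lt_top h2)

theorem IsGagliardoConstant.integrable_dispersionDensity (hc : IsGagliardoConstant n δ c)
    (hn : 1 ≤ n) (hδ₀ : 0 < δ) (hδ₁ : δ < 1) {f : L2 n} (hf : MemSigma δ f) (t : ℝ) :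
    Integrable (dispersionDensity δ f t) := by
  refine ⟨(measurable_dispersionDensity δ f t).aestronglyMeasurable, ?_⟩
  rw [hasFiniteIntegral_iff_ofReal (.of_forall (dispersionDensity_nonneg δ f t))]
  have h := hc.energy_phase_lt_top hn hδ₀ hδ₁ hf t
  rw [hc.energy_phase_eq] at h
  exact ENNReal.lt_top_of_mul_ne_top_right h.ne (by simpa using hc.1)

theorem IsGagliardoConstant.ofReal_mul_dispersion (hc : IsGagliardoConstant n δ c)
    (hn : 1 ≤ n) (hδ₀ : 0 < δ) (hδ₁ : δ < 1) {f : L2 n} (hf : MemSigma δ f) (t : ℝ) :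
    ENNReal.ofReal (c * dispersion δ f t) =
      gagliardoEnergy δ (fun ξ => phase t ξ * (𝓕 f : L2 n) ξ) := by
  rw [ENNReal.ofReal_mul hc.1.le, dispersion,
    ofReal_integral_eq_lintegral_ofReal (hc.integrable_dispersionDensity hn hδ₀ hδ₁ hf t)
      (.of_forall (dispersionDensity_nonneg δ f t)), hc.energy_phase_eq]

theorem dispersion_nonneg (δ : ℝ) (f : L2 n) (t : ℝ) : 0 ≤ dispersion δ f t :=
  integral_nonneg (dispersionDensity_nonneg δ f t)

/-- The integrand of the Gagliardo energy of `e^{-πit|ξ|²} F`. -/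
noncomputable def energyDensity (F : EuclideanSpace ℝ (Fin n) → ℂ) (t : ℝ)
    (p : EuclideanSpace ℝ (Fin n) × EuclideanSpace ℝ (Fin n)) : ℝ :=
  ‖phase t p.1 * F p.1 - phase t p.2 * F p.2‖ ^ 2

theorem energyDensity_nonneg (F : EuclideanSpace ℝ (Fin n) → ℂ) (t : ℝ)
    (p : EuclideanSpace ℝ (Fin n) × EuclideanSpace ℝ (Fin n)) : 0 ≤ energyDensity F t p :=
  sq_nonneg _

theorem measurable_energyDensity {F : EuclideanSpace ℝ (Fin n) → ℂ} (hF : Measurable F) (t : ℝ) :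
    Measurable (energyDensity F t) := by
  unfold energyDensity
  fun_prop

theorem lintegral_energyDensity (δ : ℝ) (F : EuclideanSpace ℝ (Fin n) → ℂ) (t : ℝ) :
    ∫⁻ p, ENNReal.ofReal (energyDensity F t p) ∂gagliardoMeasure n δ =
      gagliardoEnergy δ (fun ξ => phase t ξ * F ξ) := by
  rw [gagliardoEnergy]
  refine lintegral_congr fun p => ?_
  rw [energyDensity, ENNReal.ofReal_pow (norm_nonneg _), ofReal_norm]

theorem IsGagliardoConstant.integrable_energyDensity (hc : IsGagliardoConstant n δ c)
    (hn : 1 ≤ n) (hδ₀ : 0 < δ) (hδ₁ : δ < 1) {f : L2 n} (hf : MemSigma δ f) (t : ℝ) :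
    Integrable (energyDensity (𝓕 f : L2 n) t) (gagliardoMeasure n δ) := by
  refine ⟨(measurable_energyDensity (measurable_fourier f) t).aestronglyMeasurable, ?_⟩
  rw [hasFiniteIntegral_iff_ofReal (.of_forall (energyDensity_nonneg _ t)), lintegral_energyDensity]
  exact hc.energy_phase_lt_top hn hδ₀ hδ₁ hf t

theorem IsGagliardoConstant.integral_energyDensity (hc : IsGagliardoConstant n δ c)
    (hn : 1 ≤ n) (hδ₀ : 0 < δ) (hδ₁ : δ < 1) {f : L2 n} (hf : MemSigma δ f) (t : ℝ) :
    ∫ p, energyDensity (𝓕 f : L2 n) t p ∂gagliardoMeasure n δ = c * dispersion δ f t := by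
  have h1 : 0 ≤ ∫ p, energyDensity (𝓕 f : L2 n) t p ∂gagliardoMeasure n δ :=
    integral_nonneg (energyDensity_nonneg _ t)
  rw [← ENNReal.ofReal_eq_ofReal_iff h1 (mul_nonneg hc.1.le (dispersion_nonneg δ f t)),
    hc.ofReal_mul_dispersion hn hδ₀ hδ₁ hf t, ofReal_integral_eq_lintegral_ofReal
      (hc.integrable_energyDensity hn hδ₀ hδ₁ hf t) (.of_forall (energyDensity_nonneg _ t)),
    lintegral_energyDensity]

/-- The energy bound for the evolved function, read through the Gagliardo identity. It gives local
boundedness of h, and polynomial growth for integration against Schwartz kernels. -/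
theorem exists_dispersion_le (hn : 1 ≤ n) (hδ₀ : 0 < δ) (hδ₁ : δ < 1) :
    ∃ C : ℝ≥0, ∀ f : L2 n, MemSigma δ f → ∀ t : ℝ,
      dispersion δ f t ≤ C * (1 + |t| ^ (2 * δ)) * (sigmaNormSq δ f).toReal := by
  obtain ⟨c, hc⟩ : ∃ c, IsGagliardoConstant n δ c := exists_oscillationMoment_eq hn hδ₀ hδ₁
  set T := (truncatedMoment n δ).toReal with hT
  have hTe : truncatedMoment n δ = ENNReal.ofReal T :=
    (ENNReal.ofReal_toReal (truncatedMoment_lt_top hn hδ₀ hδ₁).ne).symm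
  have hT0 : 0 ≤ T := ENNReal.toReal_nonneg
  have hc0 := hc.1
  refine ⟨(c⁻¹ * ((2 + 16 * T * Real.pi ^ (2 * δ)) * (c + 1))).toNNReal, fun f hf t => ?_⟩
  set N := (sigmaNormSq δ f).toReal with hN
  have hNe : sigmaNormSq δ f = ENNReal.ofReal N := (ENNReal.ofReal_toReal (ne_of_lt hf)).symm
  have hN0 : 0 ≤ N := ENNReal.toReal_nonneg
  have h1 := hc.energy_phase_le hδ₀ f t
  have h16 : (16 : ℝ≥0∞) = ENNReal.ofReal 16 := (ENNReal.ofReal_ofNat 16).symm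
  have h2 : (2 : ℝ≥0∞) = ENNReal.ofReal 2 := (ENNReal.ofReal_ofNat 2).symm
  rw [← hc.ofReal_mul_dispersion hn hδ₀ hδ₁ hf t, hTe, hNe, h16, h2,
    ← ENNReal.ofReal_mul (by norm_num), ← ENNReal.ofReal_mul (by positivity),
    ← ENNReal.ofReal_add (by norm_num) (by positivity), ← ENNReal.ofReal_mul (by positivity),
    ← ENNReal.ofReal_mul (by positivity), ENNReal.ofReal_le_ofReal_iff (by positivity)] at h1
  have h3 : dispersion δ f t = c⁻¹ * (c * dispersion δ f t) := by field_simp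
  have h4 : (0 : ℝ) ≤ |t| ^ (2 * δ) := by positivity
  rw [h3, Real.coe_toNNReal _ (by positivity)]
  calc c⁻¹ * (c * dispersion δ f t) ≤
        c⁻¹ * ((2 + 16 * T * (Real.pi * |t|) ^ (2 * δ)) * ((c + 1) * N)) := by gcongr
    _ = c⁻¹ * ((2 * 1 + 16 * T * Real.pi ^ (2 * δ) * |t| ^ (2 * δ)) * ((c + 1) * N)) := by
        rw [Real.mul_rpow Real.pi_pos.le (abs_nonneg t)]
        ring
    _ ≤ c⁻¹ * ((2 * (1 + |t| ^ (2 * δ)) +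
          16 * T * Real.pi ^ (2 * δ) * (1 + |t| ^ (2 * δ))) * ((c + 1) * N)) := by
        gcongr <;> linarith
    _ = _ := by ring

/-- With z, w unimodular the terms in |a|² and |b|² cancel, and the cross term keeps the factor 4(1
- Re(z w̄)) = 2|z-w|². Here z and w are the phases over the time step s, their conjugates the phases
over -s. -/
theorem norm_sq_second_difference {z w : ℂ} (hz : ‖z‖ = 1) (hw : ‖w‖ = 1) (a b : ℂ) :
    ‖z * a - w * b‖ ^ 2 + ‖starRingEnd ℂ z * a - starRingEnd ℂ w * b‖ ^ 2 - 2 * ‖a - b‖ ^ 2 =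
      2 * ‖z - w‖ ^ 2 * (a * starRingEnd ℂ b).re := by
  have hz' : z.re * z.re + z.im * z.im = 1 := by
    rw [← Complex.normSq_apply, ← Complex.sq_norm, hz, one_pow]
  have hw' : w.re * w.re + w.im * w.im = 1 := by
    rw [← Complex.normSq_apply, ← Complex.sq_norm, hw, one_pow]
  simp only [Complex.sq_norm, Complex.normSq_apply, Complex.sub_re, Complex.sub_im,
    Complex.mul_re, Complex.mul_im, Complex.conj_re, Complex.conj_im]
  linear_combination
    (2 * (a.re ^ 2 + a.im ^ 2) - 2 * (a.re * b.re + a.im * b.im)) * hz' +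
    (2 * (b.re ^ 2 + b.im ^ 2) - 2 * (a.re * b.re + a.im * b.im)) * hw'

theorem phase_add (s t : ℝ) (ξ : EuclideanSpace ℝ (Fin n)) :
    phase (t + s) ξ = phase s ξ * phase t ξ := by
  rw [phase, phase, phase, ← Complex.exp_add]
  congr 1
  push_cast
  ring

theorem conj_phase (s : ℝ) (ξ : EuclideanSpace ℝ (Fin n)) :
    starRingEnd ℂ (phase s ξ) = phase (-s) ξ := by
  rw [phase, phase, ← Complex.exp_conj, map_mul, Complex.conj_I, Complex.conj_ofReal]
  congr 1
  push_cast
  ring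

theorem abs_energyDensity_second_difference_le (F : EuclideanSpace ℝ (Fin n) → ℂ) (t s : ℝ)
    (p : EuclideanSpace ℝ (Fin n) × EuclideanSpace ℝ (Fin n)) :
    |energyDensity F (t + s) p + energyDensity F (t - s) p - 2 * energyDensity F t p| ≤
      8 * (min 1 ((Real.pi * |s| / 2 * (‖p.1‖ ^ 2 - ‖p.2‖ ^ 2)) ^ 2) * (‖F p.1‖ * ‖F p.2‖)) := by
  have h1 := norm_sq_second_difference (norm_phase s p.1) (norm_phase s p.2)
    (phase t p.1 * F p.1) (phase t p.2 * F p.2)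
  have h2 : ‖phase s p.1 - phase s p.2‖ ^ 2 ≤
      4 * min 1 ((Real.pi * |s| / 2 * (‖p.1‖ ^ 2 - ‖p.2‖ ^ 2)) ^ 2) := by
    have h3 : ‖phase s p.1 - phase s p.2‖ ≤ 2 := by
      refine (norm_sub_le _ _).trans ?_
      rw [norm_phase, norm_phase]
      norm_num
    have h4 := norm_phase_sub_le s p.1 p.2
    rw [mul_min_of_nonneg _ _ (by norm_num)]
    refine le_min ?_ ?_
    · nlinarith [norm_nonneg (phase s p.1 - phase s p.2)]
    · calc ‖phase s p.1 - phase s p.2‖ ^ 2 ≤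
            (Real.pi * |s| * |‖p.1‖ ^ 2 - ‖p.2‖ ^ 2|) ^ 2 := by gcongr
        _ = (Real.pi * |s|) ^ 2 * (‖p.1‖ ^ 2 - ‖p.2‖ ^ 2) ^ 2 := by rw [mul_pow, sq_abs]
        _ = _ := by ring
  rw [energyDensity, energyDensity, energyDensity, sub_eq_add_neg t s, phase_add, phase_add,
    phase_add, phase_add, ← conj_phase, ← conj_phase, mul_assoc, mul_assoc, mul_assoc, mul_assoc,
    h1, abs_mul, abs_of_nonneg (by positivity)]
  have h3 : |(phase t p.1 * F p.1 * starRingEnd ℂ (phase t p.2 * F p.2)).re| ≤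
      ‖F p.1‖ * ‖F p.2‖ := by
    refine (Complex.abs_re_le_norm _).trans ?_
    rw [norm_mul, norm_mul, Complex.norm_conj, norm_mul, norm_phase, norm_phase, one_mul, one_mul]
  calc 2 * ‖phase s p.1 - phase s p.2‖ ^ 2 * _ ≤
        2 * (4 * min 1 ((Real.pi * |s| / 2 * (‖p.1‖ ^ 2 - ‖p.2‖ ^ 2)) ^ 2)) *
          (‖F p.1‖ * ‖F p.2‖) := by gcongr
    _ = _ := by ring

/-- The energies at the three times are finite, so they can be combined under one integral, where
the cancellation takes place before absolute values are taken. -/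
theorem IsGagliardoConstant.abs_dispersion_second_difference_le
    (hc : IsGagliardoConstant n δ c) (hn : 1 ≤ n) (hδ₀ : 0 < δ) (hδ₁ : δ < 1) {f : L2 n}
    (hf : MemSigma δ f) (t s : ℝ) :
    ENNReal.ofReal
      (c * |dispersion δ f (t + s) + dispersion δ f (t - s) - 2 * dispersion δ f t|) ≤
      8 * oscillationForm δ (Real.pi * |s| / 2) (𝓕 f : L2 n) := by
  set F := (𝓕 f : L2 n) with hF
  have hi (t : ℝ) := hc.integrable_energyDensity hn hδ₀ hδ₁ hf t
  have h1 : c * (dispersion δ f (t + s) + dispersion δ f (t - s) - 2 * dispersion δ f t) =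
      ∫ p, (energyDensity F (t + s) p + energyDensity F (t - s) p - 2 * energyDensity F t p)
        ∂gagliardoMeasure n δ := by
    rw [integral_sub (f := fun p => energyDensity F (t + s) p + energyDensity F (t - s) p)
      ((hi _).add (hi _)) ((hi t).const_mul 2), integral_add (hi _) (hi _), integral_const_mul, hc.integral_energyDensity hn hδ₀ hδ₁ hf,
      hc.integral_energyDensity hn hδ₀ hδ₁ hf, hc.integral_energyDensity hn hδ₀ hδ₁ hf]
    ring
  have h2 : c * |dispersion δ f (t + s) + dispersion δ f (t - s) - 2 * dispersion δ f t| =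
      ‖∫ p, (energyDensity F (t + s) p + energyDensity F (t - s) p - 2 * energyDensity F t p)
        ∂gagliardoMeasure n δ‖ := by
    rw [← h1, Real.norm_eq_abs, abs_mul, abs_of_pos hc.1]
  rw [h2, ofReal_norm]
  refine (enorm_integral_le_lintegral_enorm _).trans ?_
  rw [oscillationForm, ← lintegral_const_mul' _ _ (by norm_num)]
  refine lintegral_mono fun p => ?_
  have hm : 0 ≤ min 1 ((Real.pi * |s| / 2 * (‖p.1‖ ^ 2 - ‖p.2‖ ^ 2)) ^ 2) :=
    le_min zero_le_one (sq_nonneg _)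
  have h3 := ENNReal.ofReal_le_ofReal (abs_energyDensity_second_difference_le F t s p)
  rwa [← Real.norm_eq_abs, ofReal_norm, ENNReal.ofReal_mul (by norm_num), ENNReal.ofReal_mul hm,
    ENNReal.ofReal_mul (norm_nonneg _), ofReal_norm, ofReal_norm, ENNReal.ofReal_ofNat] at h3

/-- The second difference in time of the dispersion, uniformly in time. -/
theorem exists_dispersion_second_difference_le (hn : 1 ≤ n) (hδ₀ : 0 < δ) (hδ₁ : δ < 1) {α : ℝ}
    (hα : IsRegularityExponent n δ α) (hα₀ : 0 < α) :
    ∃ C : ℝ≥0, ∀ f : L2 n, MemSigma δ f → ∀ t s : ℝ, |s| ≤ 1 →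
      |dispersion δ f (t + s) + dispersion δ f (t - s) - 2 * dispersion δ f t| ≤
        C * (sigmaNormSq δ f).toReal * |s| ^ α := by
  obtain ⟨c, hc⟩ : ∃ c, IsGagliardoConstant n δ c := exists_oscillationMoment_eq hn hδ₀ hδ₁
  obtain ⟨K, hK⟩ := exists_oscillationForm_le hn hδ₀ hδ₁ hα
  have hc0 := hc.1
  set A : ℝ := c⁻¹ * (8 * (K * (Real.pi / 2) ^ α * (c + 1))) with hA
  have hA0 : 0 ≤ A := by positivity
  refine ⟨(4 * A).toNNReal, fun f hf t s hs => ?_⟩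
  set N := (sigmaNormSq δ f).toReal with hN
  have hNe : sigmaNormSq δ f = ENNReal.ofReal N := (ENNReal.ofReal_toReal (ne_of_lt hf)).symm
  have hN0 : 0 ≤ N := ENNReal.toReal_nonneg
  set h := dispersion δ f with hh
  -- The bound of `oscillationForm` is for σ = π|s|/2 ≤ 1, which |s| ≤ 1/2 ensures.
  have small (t s : ℝ) (hs : |s| ≤ 1 / 2) : |h (t + s) + h (t - s) - 2 * h t| ≤
      A * N * |s| ^ α := by
    have h1 := hc.abs_dispersion_second_difference_le hn hδ₀ hδ₁ hf t s
    have h2 : Real.pi * |s| / 2 ≤ 1 := by nlinarith [Real.pi_lt_four, Real.pi_pos]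
    have h3 := hK _ (measurable_fourier f) (Real.pi * |s| / 2) (by positivity) h2
    have h4 : ENNReal.ofReal (c * |h (t + s) + h (t - s) - 2 * h t|) ≤
        ENNReal.ofReal (8 * (K * (Real.pi * |s| / 2) ^ α * ((c + 1) * N))) := by
      refine h1.trans ?_
      rw [ENNReal.ofReal_mul (by norm_num), ENNReal.ofReal_mul (by positivity),
        ENNReal.ofReal_mul (by positivity), ENNReal.ofReal_mul (by positivity), ← hNe,
        ENNReal.ofReal_coe_nnreal, ENNReal.ofReal_ofNat]
      refine mul_le_mul' le_rfl (h3.trans (mul_le_mul' le_rfl (hc.energy_add_le f)))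
    rw [ENNReal.ofReal_le_ofReal_iff (by positivity)] at h4
    have h5 : |h (t + s) + h (t - s) - 2 * h t| =
        c⁻¹ * (c * |h (t + s) + h (t - s) - 2 * h t|) := by field_simp
    rw [h5]
    calc c⁻¹ * (c * |h (t + s) + h (t - s) - 2 * h t|) ≤
        c⁻¹ * (8 * (K * (Real.pi * |s| / 2) ^ α * ((c + 1) * N))) := by gcongr
      _ = c⁻¹ * (8 * (K * (Real.pi / 2 * |s|) ^ α * ((c + 1) * N))) := by
          congr 5
          ring
      _ = _ := by
          rw [Real.mul_rpow (by positivity) (abs_nonneg s), hA]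
          ring
  have hs2 : |s / 2| ≤ 1 / 2 := by
    rw [abs_div, abs_two]
    linarith
  have e1 := small (t + s / 2) (s / 2) hs2
  have e2 := small t (s / 2) hs2
  have e3 := small (t - s / 2) (s / 2) hs2
  have h6 : |s / 2| ^ α ≤ |s| ^ α := by
    refine Real.rpow_le_rpow (abs_nonneg _) ?_ hα₀.le
    rw [abs_div, abs_two]
    linarith [abs_nonneg s]
  -- The second difference of step s is the combination with weights 1, 2, 1 of those of step s/2.
  -- This extends the bound to |s| ≤ 1 and accounts for the factor 4 in the constant.
  have h7 : h (t + s) + h (t - s) - 2 * h t =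
      (h (t + s / 2 + s / 2) + h (t + s / 2 - s / 2) - 2 * h (t + s / 2)) +
      2 * (h (t + s / 2) + h (t - s / 2) - 2 * h t) +
      (h (t - s / 2 + s / 2) + h (t - s / 2 - s / 2) - 2 * h (t - s / 2)) := by
    have a1 : t + s / 2 + s / 2 = t + s := by ring
    have a2 : t - s / 2 - s / 2 = t - s := by ring
    rw [a1, a2, add_sub_cancel_right, sub_add_cancel]
    ring
  rw [h7, Real.coe_toNNReal _ (by positivity)]
  have h8 : A * N * |s / 2| ^ α ≤ A * N * |s| ^ α := by gcongr
  refine (abs_add_three _ _ _).trans ?_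
  rw [abs_mul, abs_two]
  linarith

theorem IsRegularityExponent.pos {α : ℝ} (hδ₀ : 0 < δ) (hα : IsRegularityExponent n δ α) :
    0 < α := by
  rcases hα with ⟨-, rfl⟩ | ⟨-, h, -⟩ | ⟨⟨-, h⟩, rfl⟩ <;> linarith

theorem IsRegularityExponent.lt_two {α : ℝ} (hδ₁ : δ < 1) (hα : IsRegularityExponent n δ α) :
    α < 2 := by
  rcases hα with ⟨-, rfl⟩ | ⟨-, -, h⟩ | ⟨⟨-, h⟩, rfl⟩ <;> linarith

end SchrodingerDispersion

namespace SchrodingerDispersion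

/-! ### Second differences on the line -/

/-- `|h(t+s) + h(t-s) - 2h(t)| ≤ M|s|^α` for `|s| ≤ 1`. -/
def SecondDifferenceLE (h : ℝ → ℝ) (M α : ℝ) : Prop :=
  ∀ t s : ℝ, |s| ≤ 1 → |h (t + s) + h (t - s) - 2 * h t| ≤ M * |s| ^ α

theorem SecondDifferenceLE.mono_exponent {h : ℝ → ℝ} {M α β : ℝ} (hM : 0 ≤ M) (hα : 0 < α)
    (hβα : β ≤ α) (hh : SecondDifferenceLE h M α) : SecondDifferenceLE h M β := by
  intro t s hs
  refine (hh t s hs).trans (mul_le_mul_of_nonneg_left ?_ hM)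
  exact Real.rpow_le_rpow_of_exponent_ge_of_imp (abs_nonneg s) hs hβα (fun _ h => by linarith)

/-- Twice the increment of step s is the increment of step 2s minus a second difference. Passing
from 2s to s therefore multiplies the Hölder constant by 2^{γ-1} < 1 and adds a fixed amount, so a
single constant propagates down the dyadic scales. -/
theorem exists_holder_of_secondDifferenceLE {γ : ℝ} (hγ₀ : 0 < γ) (hγ₁ : γ < 1) :
    ∃ C : ℝ, 0 ≤ C ∧ ∀ (h : ℝ → ℝ) (M : ℝ), 0 ≤ M → SecondDifferenceLE h M γ →
      ∀ t : ℝ, (∀ x ∈ Set.Icc t (t + 1), |h x| ≤ M) → ∀ s : ℝ, 0 ≤ s → s ≤ 1 →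
        |h (t + s) - h t| ≤ C * M * s ^ γ := by
  have h2 : (2 : ℝ) ^ (γ - 1) < 1 := Real.rpow_lt_one_of_one_lt_of_neg one_lt_two (by linarith)
  -- The summand 4 settles the steps s > 1/2, where s^γ ≥ 1/2 and the increment is at most 2M; the
  -- other summand absorbs the second difference in the induction.
  set C : ℝ := 4 + 1 / (1 - 2 ^ (γ - 1)) with hC
  have hC4 : 4 ≤ C := by
    have : 0 < 1 / (1 - (2 : ℝ) ^ (γ - 1)) := by
      apply one_div_pos.2
      linarith
    linarith
  have hC1 : 1 ≤ C * (1 - 2 ^ (γ - 1)) := by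
    have : 1 / (1 - (2 : ℝ) ^ (γ - 1)) * (1 - 2 ^ (γ - 1)) = 1 := by
      field_simp
      exact div_self (by linarith)
    nlinarith
  refine ⟨C, by linarith, fun h M hM hh t hb s hs0 hs1 => ?_⟩
  have base (s : ℝ) (hs : 1 / 2 < s) (hs1 : s ≤ 1) : |h (t + s) - h t| ≤ C * M * s ^ γ := by
    have h3 : (1 / 2 : ℝ) ≤ s ^ γ := by
      calc (1 / 2 : ℝ) ≤ s ^ (1 : ℝ) := by rw [Real.rpow_one]; exact hs.le
        _ ≤ s ^ γ := Real.rpow_le_rpow_of_exponent_ge (by linarith) hs1 hγ₁.le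
    have h4 := hb (t + s) ⟨by linarith, by linarith⟩
    have h5 := hb t ⟨le_rfl, by linarith⟩
    have h6 : 4 * (1 / 2) ≤ C * s ^ γ := mul_le_mul hC4 h3 (by norm_num) (by linarith)
    calc |h (t + s) - h t| ≤ |h (t + s)| + |h t| := abs_sub _ _
      _ ≤ 2 * M := by linarith
      _ ≤ (C * s ^ γ) * M := mul_le_mul_of_nonneg_right (by linarith) hM
      _ = _ := by ring
  have step (k : ℕ) : ∀ s : ℝ, (1 / 2) ^ (k + 1) < s → s ≤ 1 →
      |h (t + s) - h t| ≤ C * M * s ^ γ := by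
    induction k with
    | zero =>
      intro s hs hs1
      exact base s (by simpa using hs) hs1
    | succ k ih =>
      intro s hs hs1
      rcases lt_or_ge (1 / 2) s with h3 | h3
      · exact base s h3 hs1
      have hs0 : 0 < s := lt_trans (by positivity) hs
      have h4 := ih (2 * s) (by rw [pow_succ] at hs; linarith) (by linarith)
      have h5 := hh (t + s) s (by rw [abs_of_pos hs0]; exact hs1)
      rw [abs_of_pos hs0, add_sub_cancel_right, add_assoc, ← two_mul] at h5
      have h6 : (2 * s) ^ γ = 2 * (2 ^ (γ - 1) * s ^ γ) := by
        rw [Real.mul_rpow (by norm_num) hs0.le, Real.rpow_sub (by norm_num), Real.rpow_one]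
        ring
      have h7 : 0 ≤ s ^ γ := by positivity
      have h8 : 2 * |h (t + s) - h t| ≤ |h (t + 2 * s) - h t| +
          |h (t + 2 * s) + h t - 2 * h (t + s)| := by
        rw [← abs_two, ← abs_mul, abs_two]
        have : 2 * (h (t + s) - h t) = (h (t + 2 * s) - h t) -
          (h (t + 2 * s) + h t - 2 * h (t + s)) := by ring
        rw [this]
        exact abs_sub _ _
      rw [h6] at h4
      have h9 : M * s ^ γ ≤ C * (1 - 2 ^ (γ - 1)) * (M * s ^ γ) :=
        le_mul_of_one_le_left (by positivity) hC1
      nlinarith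
  rcases hs0.eq_or_lt with rfl | hs0
  · simp only [add_zero, sub_self, abs_zero]
    have : 0 ≤ C := by linarith
    positivity
  · obtain ⟨k, hk⟩ := exists_pow_lt_of_lt_one hs0 (by norm_num : (1 / 2 : ℝ) < 1)
    refine step k s (lt_of_le_of_lt ?_ hk) hs1
    exact pow_le_pow_of_le_one (by norm_num) (by norm_num) (Nat.le_succ k)

/-- Local Hölder continuity with exponent α/2, which lies in (0,1) even if α ≥ 1. -/
theorem SecondDifferenceLE.continuous {h : ℝ → ℝ} {M α : ℝ} (hM : 0 ≤ M) (hα₀ : 0 < α)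
    (hα₂ : α < 2) (hh : SecondDifferenceLE h M α)
    (hb : ∀ R : ℝ, ∃ B : ℝ, ∀ t : ℝ, |t| ≤ R → |h t| ≤ B) : Continuous h := by
  obtain ⟨C, hC0, hC⟩ := exists_holder_of_secondDifferenceLE (γ := α / 2) (by linarith)
    (by linarith)
  rw [continuous_iff_continuousAt]
  intro x
  obtain ⟨B, hB⟩ := hb (|x| + 2)
  set K := max M B with hK
  have hK0 : 0 ≤ K := hM.trans (le_max_left _ _)
  have hh' : SecondDifferenceLE h K (α / 2) := fun t s hs =>
    (hh.mono_exponent hM hα₀ (by linarith : α / 2 ≤ α) t s hs).trans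
      (mul_le_mul_of_nonneg_right (le_max_left _ _) (by positivity))
  have h1 (y : ℝ) (hy : |y - x| ≤ 1) : |h y - h x| ≤ C * K * |y - x| ^ (α / 2) := by
    have hy' := abs_le.1 hy
    have key (t s : ℝ) (ht : x - 1 ≤ t) (ht' : t ≤ x) (hs0 : 0 ≤ s) (hs : s ≤ 1) :
        |h (t + s) - h t| ≤ C * K * s ^ (α / 2) := by
      refine hC h K hK0 hh' t (fun z hz => (hB z ?_).trans (le_max_right _ _)) s hs0 hs
      have := abs_le.1 (le_refl |x|)
      rw [abs_le]
      constructor <;> linarith [hz.1, hz.2]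
    rcases le_total x y with hxy | hxy
    · have := key x (y - x) (by linarith) le_rfl (by linarith) (by linarith)
      rwa [add_sub_cancel, ← abs_of_nonneg (by linarith : 0 ≤ y - x)] at this
    · have := key y (x - y) (by linarith) hxy (by linarith) (by linarith)
      rw [add_sub_cancel, abs_sub_comm] at this
      rwa [abs_sub_comm y x, abs_of_nonneg (by linarith : 0 ≤ x - y)]
  rw [ContinuousAt, tendsto_iff_norm_sub_tendsto_zero]
  have h2 : Filter.Tendsto (fun y => C * K * |y - x| ^ (α / 2)) (nhds x) (nhds 0) := by
    have h3 : Continuous fun y : ℝ => C * K * |y - x| ^ (α / 2) :=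
      continuous_const.mul ((by fun_prop : Continuous fun y : ℝ => |y - x|).rpow_const
        fun _ => Or.inr (by linarith))
    have h4 := h3.tendsto x
    rwa [sub_self, abs_zero, Real.zero_rpow (by linarith), mul_zero] at h4
  refine squeeze_zero' (.of_forall fun y => norm_nonneg _) ?_ h2
  filter_upwards [Metric.closedBall_mem_nhds x one_pos] with y hy
  exact h1 y (by simpa [Real.dist_eq] using hy)

theorem exists_second_difference_le_of_contDiff {ψ : ℝ → ℂ} (hψ : ContDiff ℝ ∞ ψ)
    (hψc : HasCompactSupport ψ) : ∃ L : ℝ, 0 ≤ L ∧ (∀ t, ‖ψ t‖ ≤ L) ∧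
      (∀ x y, ‖ψ x - ψ y‖ ≤ L * |x - y|) ∧
      ∀ t s, ‖ψ (t + s) + ψ (t - s) - 2 * ψ t‖ ≤ L * |s| ^ 2 := by
  obtain ⟨L₀, hL₀⟩ := hψc.exists_bound_of_continuous hψ.continuous
  obtain ⟨L₁, hL₁⟩ := hψ.lipschitzWith_of_hasCompactSupport hψc (by simp)
  have hd : ContDiff ℝ ∞ (deriv ψ) := ((contDiff_succ_iff_deriv (n := ∞)).1 hψ).2.2
  obtain ⟨L₂, hL₂⟩ := hd.lipschitzWith_of_hasCompactSupport hψc.deriv (by simp)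
  have hL₀0 : 0 ≤ L₀ := (norm_nonneg _).trans (hL₀ 0)
  refine ⟨L₀ + L₁ + 2 * L₂, by positivity, fun t => ?_, fun x y => ?_, fun t s => ?_⟩
  · have : (0 : ℝ) ≤ L₁ + 2 * L₂ := by positivity
    linarith [hL₀ t]
  · have h1 := hL₁.dist_le_mul x y
    rw [dist_eq_norm, Real.dist_eq] at h1
    refine h1.trans (mul_le_mul_of_nonneg_right ?_ (abs_nonneg _))
    have : (0 : ℝ) ≤ 2 * L₂ := by positivity
    linarith
  · set φ : ℝ → ℂ := fun r => ψ (t + r) + ψ (t - r) - 2 * ψ t with hφ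
    have hψd : Differentiable ℝ ψ := hψ.differentiable (by simp)
    have h1 (r : ℝ) : HasDerivAt φ (deriv ψ (t + r) - deriv ψ (t - r)) r := by
      have e1 : HasDerivAt (fun r => ψ (t + r)) (deriv ψ (t + r)) r := by
        simpa using (hψd (t + r)).hasDerivAt.comp_const_add t r
      have e2 : HasDerivAt (fun r => ψ (t - r)) (-deriv ψ (t - r)) r := by
        simpa using (hψd (t - r)).hasDerivAt.comp_const_sub t r
      exact ((e1.add e2).sub_const (2 * ψ t)).congr_deriv (sub_eq_add_neg _ _).symm
    have h2 := (convex_closedBall (0 : ℝ) |s|).norm_image_sub_le_of_norm_hasDerivWithin_le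
      (f := φ) (C := 2 * L₂ * |s|) (fun r _ => (h1 r).hasDerivWithinAt) (fun r hr => by
        have h3 := hL₂.dist_le_mul (t + r) (t - r)
        rw [dist_eq_norm, Real.dist_eq] at h3
        refine h3.trans ?_
        have h4 : |r| ≤ |s| := by simpa using hr
        have h5 : t + r - (t - r) = 2 * r := by ring
        rw [h5, abs_mul, abs_two]
        have : (0 : ℝ) ≤ L₂ := L₂.2
        nlinarith)
      (x := 0) (y := s) (by simp) (by simp)
    have h3 : φ 0 = 0 := by simp only [hφ, add_zero, sub_zero]; ring
    rw [h3, sub_zero, sub_zero, Real.norm_eq_abs] at h2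
    calc ‖φ s‖ ≤ 2 * L₂ * |s| * |s| := h2
      _ ≤ (L₀ + L₁ + 2 * L₂) * |s| * |s| := by
          gcongr
          have : (0 : ℝ) ≤ L₁ := L₁.2
          linarith
      _ = _ := by ring

/-- A discrete product rule: the second difference of ψh is ψ times that of h, plus that of ψ times
h, plus a product of first differences. The last product is of order |s|·|s|^{α/2} ≤ |s|^α for |s| ≤
1, since α < 2; Hölder continuity of order α/2 is therefore enough. -/
theorem exists_mul_second_difference_le {ψ : ℝ → ℂ} (hψ : ContDiff ℝ ∞ ψ)
    (hψc : HasCompactSupport ψ) {α : ℝ} (hα₀ : 0 < α) (hα₂ : α < 2) :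
    ∃ R C : ℝ, 0 ≤ R ∧ 0 ≤ C ∧ ∀ (h : ℝ → ℝ) (M : ℝ), 0 ≤ M → SecondDifferenceLE h M α →
      (∀ t : ℝ, |t| ≤ R → |h t| ≤ M) →
      (∀ t : ℝ, ‖ψ t * (h t : ℂ)‖ ≤ C * M) ∧
      ∀ t s : ℝ, ‖ψ (t + s) * (h (t + s) : ℂ) + ψ (t - s) * (h (t - s) : ℂ) -
        2 * (ψ t * (h t : ℂ))‖ ≤ C * M * |s| ^ α := by
  obtain ⟨L, hL0, hLb, hL1, hL2⟩ := exists_second_difference_le_of_contDiff hψ hψc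
  obtain ⟨K, hK0, hK⟩ := exists_holder_of_secondDifferenceLE (γ := α / 2) (by linarith)
    (by linarith)
  obtain ⟨T₀, hT₀⟩ := hψc.isCompact.isBounded.subset_closedBall (0 : ℝ)
  set T := max T₀ 0 with hT
  have hzero (t : ℝ) (ht : T < |t|) : ψ t = 0 := by
    refine image_eq_zero_of_notMem_tsupport fun h => ?_
    have := hT₀ h
    rw [mem_closedBall_zero_iff, Real.norm_eq_abs] at this
    exact absurd (this.trans (le_max_left _ _)) (not_le.2 ht)
  -- With ψ supported in [-T, T] and |s| ≤ 1 only |t| ≤ T + 1 matters; the margin leaves room for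
  -- the unit intervals on which the Hölder estimate needs h bounded.
  refine ⟨T + 4, 4 * L + 2 * K * L, by positivity, by positivity, fun h M hM hh hb => ?_⟩
  have hg (t : ℝ) : ‖ψ t * (h t : ℂ)‖ ≤ L * M := by
    rcases lt_or_ge T |t| with ht | ht
    · rw [hzero t ht, zero_mul, norm_zero]
      positivity
    · rw [norm_mul, Complex.norm_real, Real.norm_eq_abs]
      exact mul_le_mul (hLb t) (hb t (by linarith)) (abs_nonneg _) hL0
  refine ⟨fun t => (hg t).trans ?_, fun t s => ?_⟩
  · refine mul_le_mul_of_nonneg_right ?_ hM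
    have : 0 ≤ K * L := by positivity
    linarith
  rcases lt_or_ge 1 |s| with hs | hs
  · have h1 : 1 ≤ |s| ^ α := Real.one_le_rpow hs.le hα₀.le
    calc ‖ψ (t + s) * (h (t + s) : ℂ) + ψ (t - s) * (h (t - s) : ℂ) - 2 * (ψ t * (h t : ℂ))‖
        ≤ ‖ψ (t + s) * (h (t + s) : ℂ)‖ + ‖ψ (t - s) * (h (t - s) : ℂ)‖ +
          ‖2 * (ψ t * (h t : ℂ))‖ := (norm_sub_le _ _).trans (by gcongr; exact norm_add_le _ _)
      _ ≤ L * M + L * M + 2 * (L * M) := by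
          rw [norm_mul 2, Complex.norm_ofNat]
          gcongr <;> exact hg _
      _ = 4 * L * M * 1 := by ring
      _ ≤ (4 * L + 2 * K * L) * M * |s| ^ α := by
          gcongr
          have : 0 ≤ K * L := by positivity
          linarith
  have hs' := abs_le.1 hs
  rcases lt_or_ge (T + 1) |t| with ht | ht
  · have e1 : T < |t + s| := by
      have := abs_sub_abs_le_abs_sub t (-s)
      rw [abs_neg, sub_neg_eq_add] at this
      linarith
    have e2 : T < |t - s| := by
      have := abs_sub_abs_le_abs_sub t s
      linarith
    rw [hzero _ e1, hzero _ e2, hzero t (by linarith)]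
    simp only [zero_mul, add_zero, mul_zero, sub_zero, norm_zero]
    positivity
  have ht' := abs_le.1 ht
  have hh' := hh.mono_exponent hM hα₀ (by linarith : α / 2 ≤ α)
  have holder (x r : ℝ) (hx : |x| ≤ T + 3) (hr0 : 0 ≤ r) (hr : r ≤ 1) :
      |h (x + r) - h x| ≤ K * M * r ^ (α / 2) := by
    refine hK h M hM hh' x (fun z hz => hb z ?_) r hr0 hr
    have := abs_le.1 hx
    rw [abs_le]
    constructor <;> linarith [hz.1, hz.2]
  have e1 : |h (t - s) - h (t + s)| ≤ 2 * (K * M * |s| ^ (α / 2)) := by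
    have a1 := holder t |s| (by linarith) (abs_nonneg s) hs
    have a2 := holder (t - |s|) |s| (by
      rw [abs_le]
      constructor <;> linarith [abs_nonneg s]) (abs_nonneg s) hs
    rw [sub_add_cancel] at a2
    have a3 : |h (t - s) - h (t + s)| = |h (t + |s|) - h (t - |s|)| := by
      rcases abs_cases s with ⟨h1, -⟩ | ⟨h1, -⟩
      · rw [h1, abs_sub_comm]
      · rw [h1, sub_neg_eq_add, ← sub_eq_add_neg]
    have a4 := abs_add_le (h (t + |s|) - h t) (h t - h (t - |s|))
    rw [sub_add_sub_cancel] at a4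
    rw [a3]
    linarith
  have key : ψ (t + s) * (h (t + s) : ℂ) + ψ (t - s) * (h (t - s) : ℂ) - 2 * (ψ t * (h t : ℂ)) =
      ψ t * ((h (t + s) + h (t - s) - 2 * h t : ℝ) : ℂ) +
      (ψ (t + s) + ψ (t - s) - 2 * ψ t) * (h (t + s) : ℂ) +
      (ψ (t - s) - ψ t) * ((h (t - s) - h (t + s) : ℝ) : ℂ) := by
    push_cast
    ring
  have p1 : |s| ^ 2 ≤ |s| ^ α := by
    rw [← Real.rpow_natCast]
    exact Real.rpow_le_rpow_of_exponent_ge_of_imp (abs_nonneg s) hs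
      (by push_cast; linarith) (fun _ h => by norm_num at h)
  have p2 : |s| * |s| ^ (α / 2) ≤ |s| ^ α := by
    rcases (abs_nonneg s).eq_or_lt with h0 | h0
    · rw [← h0, zero_mul]
      positivity
    · calc |s| * |s| ^ (α / 2) = |s| ^ (1 + α / 2) := by rw [Real.rpow_add h0, Real.rpow_one]
        _ ≤ _ := Real.rpow_le_rpow_of_exponent_ge h0 hs (by linarith)
  rw [key]
  refine (norm_add₃_le).trans ?_
  rw [norm_mul, norm_mul, norm_mul, Complex.norm_real, Complex.norm_real, Complex.norm_real,
    Real.norm_eq_abs, Real.norm_eq_abs, Real.norm_eq_abs]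
  have q1 : ‖ψ t‖ * |h (t + s) + h (t - s) - 2 * h t| ≤ L * (M * |s| ^ α) :=
    mul_le_mul (hLb t) (hh t s hs) (abs_nonneg _) hL0
  have q2 : ‖ψ (t + s) + ψ (t - s) - 2 * ψ t‖ * |h (t + s)| ≤ L * |s| ^ α * M := by
    refine mul_le_mul ((hL2 t s).trans (by gcongr)) (hb _ ?_) (abs_nonneg _) (by positivity)
    rw [abs_le]
    constructor <;> linarith
  have q3 : ‖ψ (t - s) - ψ t‖ * |h (t - s) - h (t + s)| ≤ 2 * K * L * M * |s| ^ α := by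
    have a1 := hL1 (t - s) t
    have a2 : t - s - t = -s := by ring
    rw [a2, abs_neg] at a1
    calc ‖ψ (t - s) - ψ t‖ * |h (t - s) - h (t + s)| ≤
          L * |s| * (2 * (K * M * |s| ^ (α / 2))) :=
          mul_le_mul a1 e1 (abs_nonneg _) (by positivity)
      _ = 2 * K * L * M * (|s| * |s| ^ (α / 2)) := by ring
      _ ≤ _ := by gcongr
  have q4 : 0 ≤ L * M * |s| ^ α := by positivity
  linarith

/-- Consecutive dyadic difference quotients of h differ by a second difference divided by the step,
hence by a geometric term of ratio 2^{1-α} < 1. They converge uniformly to a continuous function. -/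
theorem SecondDifferenceLE.contDiff_one {h : ℝ → ℝ} {M α : ℝ} (hM : 0 ≤ M) (hα : 1 < α)
    (hh : SecondDifferenceLE h M α) (hc : Continuous h) : ContDiff ℝ 1 h := by
  set r : ℕ → ℝ := fun k => (1 / 2) ^ k with hr
  have hr0 (k : ℕ) : 0 < r k := by positivity
  have hr1 (k : ℕ) : r k ≤ 1 := pow_le_one₀ (by norm_num) (by norm_num)
  have hrs (k : ℕ) : r k = 2 * r (k + 1) := by
    simp only [hr, pow_succ]
    ring
  set g : ℕ → ℝ → ℝ := fun k t => (h (t + r k) - h t) / r k with hg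
  have hgc (k : ℕ) : Continuous (g k) := by fun_prop
  have hdiff (k : ℕ) (t : ℝ) : dist (g k t) (g (k + 1) t) ≤ M * (2 ^ (1 - α)) ^ k := by
    have h0 := hr0 (k + 1)
    have h1 : g k t - g (k + 1) t =
        (h (t + r (k + 1) + r (k + 1)) + h (t + r (k + 1) - r (k + 1)) - 2 * h (t + r (k + 1))) /
          (2 * r (k + 1)) := by
      have e1 : t + r (k + 1) + r (k + 1) = t + r k := by rw [hrs k]; ring
      simp only [hg]
      rw [e1, add_sub_cancel_right, hrs k]
      field_simp
      ring
    have h2 := hh (t + r (k + 1)) (r (k + 1)) (by rw [abs_of_pos h0]; exact hr1 _)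
    rw [abs_of_pos h0] at h2
    rw [Real.dist_eq, h1, abs_div, abs_of_pos (by positivity : 0 < 2 * r (k + 1)), ← hrs,
      div_le_iff₀ (hr0 k)]
    refine h2.trans ?_
    rw [mul_assoc]
    refine mul_le_mul_of_nonneg_left ?_ hM
    have h3 : (2 ^ (1 - α) : ℝ) ^ k * r k = r k ^ α := by
      simp only [hr, one_div, inv_pow]
      rw [← Real.rpow_natCast, ← Real.rpow_natCast, ← Real.rpow_mul (by norm_num),
        ← Real.rpow_neg (by norm_num), ← Real.rpow_add (by norm_num),
        ← Real.rpow_mul (by norm_num)]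
      congr 1
      ring
    rw [h3]
    exact Real.rpow_le_rpow h0.le (by rw [hrs k]; linarith) (by linarith)
  have hρ : (2 : ℝ) ^ (1 - α) < 1 := Real.rpow_lt_one_of_one_lt_of_neg one_lt_two (by linarith)
  choose g' hg' using fun t => cauchySeq_tendsto_of_complete
    (cauchySeq_of_le_geometric _ _ hρ (fun k => hdiff k t))
  have hunif : TendstoUniformly g g' Filter.atTop := by
    rw [Metric.tendstoUniformly_iff]
    intro ε hε
    have h1 : Filter.Tendsto (fun k : ℕ => M * (2 ^ (1 - α)) ^ k / (1 - 2 ^ (1 - α)))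
        Filter.atTop (nhds 0) := by
      have := ((tendsto_pow_atTop_nhds_zero_of_lt_one (by positivity) hρ).const_mul M).div_const
        (1 - 2 ^ (1 - α))
      simpa using this
    filter_upwards [h1.eventually_lt_const hε] with k hk t
    rw [dist_comm]
    exact (dist_le_of_le_geometric_of_tendsto _ _ hρ (fun k => hdiff k t) (hg' t) k).trans_lt hk
  have hg'c : Continuous g' := hunif.continuous (.of_forall hgc)
  -- Dyadic quotients alone do not give a derivative. The averages (H(t+r)-H(t))/r of h are
  -- differentiable with these quotients as derivatives and tend to h, so the limit may be
  -- differentiated.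
  set H : ℝ → ℝ := fun t => ∫ x in (0)..t, h x with hH
  have hHd (t : ℝ) : HasDerivAt H (h t) t := hc.integral_hasStrictDerivAt 0 t |>.hasDerivAt
  have hGd (k : ℕ) (t : ℝ) : HasDerivAt (fun t => (H (t + r k) - H t) / r k) (g k t) t := by
    have e1 : HasDerivAt (fun t => H (t + r k)) (h (t + r k)) t := by
      simpa using (hHd (t + r k)).comp_add_const t (r k)
    exact (e1.sub (hHd t)).div_const (r k)
  have hGt (t : ℝ) : Filter.Tendsto (fun k => (H (t + r k) - H t) / r k) Filter.atTop
      (nhds (h t)) := by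
    have h1 := (hasDerivAt_iff_tendsto_slope_zero.1 (hHd t))
    have h2 : Filter.Tendsto r Filter.atTop (nhdsWithin 0 {0}ᶜ) := by
      refine tendsto_nhdsWithin_iff.2 ⟨tendsto_pow_atTop_nhds_zero_of_lt_one (by norm_num)
        (by norm_num), .of_forall fun k => (hr0 k).ne'⟩
    refine (h1.comp h2).congr fun k => ?_
    simp only [Function.comp_apply, smul_eq_mul]
    rw [div_eq_inv_mul]
  have hderiv (t : ℝ) : HasDerivAt h (g' t) t :=
    hasDerivAt_of_tendstoUniformly hunif (.of_forall fun k => hGd k) hGt t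
  rw [contDiff_one_iff_deriv]
  refine ⟨fun t => (hderiv t).differentiableAt, ?_⟩
  rwa [show deriv h = g' from funext fun t => (hderiv t).deriv]

end SchrodingerDispersion

namespace SchrodingerDispersion

/-! ### The frequency projections -/

/-- The symbol `ζ(|ξ| - c)`. -/
noncomputable def radialCutoff (ζ : ℝ → ℝ) (c ξ : ℝ) : ℂ :=
  ((ζ (|ξ| - c) : ℝ) : ℂ)

theorem freqSymbol_zero_one (ζ : ℝ → ℝ) : freqSymbol ζ 0 1 = radialCutoff ζ (1 / 2) := by
  funext ξ
  simp [freqSymbol, radialCutoff]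

theorem freqSymbol_two_pow (ζ : ℝ → ℝ) (k : ℕ) :
    freqSymbol ζ (2 ^ k) (2 ^ (k + 1)) = fun ξ => radialCutoff ζ (3 / 2) (ξ / 2 ^ k) := by
  funext ξ
  have h : (0 : ℝ) < 2 ^ k := by positivity
  simp only [freqSymbol, radialCutoff, abs_div, abs_of_pos h]
  congr 3
  rw [pow_succ]
  field_simp
  ring

/-- The only singularity of |ξ| is at 0, and near 0 the symbol is constant; hence the kernels are
Schwartz functions. -/
theorem IsCutoff.contDiff_radialCutoff {ζ : ℝ → ℝ} (hζ : IsCutoff ζ) {c : ℝ} {v : ℂ}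
    (hc : ∀ ξ : ℝ, |ξ| < 1 / 2 → radialCutoff ζ c ξ = v) : ContDiff ℝ ∞ (radialCutoff ζ c) := by
  rw [contDiff_iff_contDiffAt]
  intro ξ
  rcases eq_or_ne ξ 0 with rfl | hξ
  · refine (contDiffAt_const (c := v)).congr_of_eventuallyEq ?_
    filter_upwards [Metric.ball_mem_nhds (0 : ℝ) (by norm_num : (0 : ℝ) < 1 / 2)] with x hx
    exact hc x (by simpa using hx)
  · exact Complex.ofRealCLM.contDiff.contDiffAt.comp ξ (hζ.smooth.contDiffAt.comp ξ
      ((contDiffAt_abs hξ).sub contDiffAt_const))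

theorem IsCutoff.eq_zero {ζ : ℝ → ℝ} (hζ : IsCutoff ζ) {x : ℝ} (hx : 1 ≤ |x|) : ζ x = 0 := by
  have hζ' : ∀ y : ℝ, 1 < |y| → ζ y = 0 := fun y hy => by
    by_contra h
    exact absurd (abs_le.2 (hζ.support_subset h)) (not_le.2 hy)
  have h1 : Filter.Tendsto (fun k : ℕ => (1 + 1 / ((k : ℝ) + 1)) * x) Filter.atTop (nhds x) := by
    have := (tendsto_one_div_add_atTop_nhds_zero_nat (𝕜 := ℝ)).const_add 1 |>.mul_const x
    simpa using this
  have h2 := (hζ.smooth.continuous.tendsto x).comp h1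
  refine tendsto_nhds_unique h2 (tendsto_const_nhds.congr fun k => ?_)
  refine (hζ' _ ?_).symm
  have h3 : 0 < 1 / ((k : ℝ) + 1) := by positivity
  rw [abs_mul, abs_of_pos (by linarith)]
  nlinarith

theorem IsCutoff.radialCutoff_half {ζ : ℝ → ℝ} (hζ : IsCutoff ζ) {ξ : ℝ} (hξ : |ξ| < 1 / 2) :
    radialCutoff ζ (1 / 2) ξ = 1 := by
  rw [radialCutoff, hζ.eq_one, Complex.ofReal_one]
  constructor <;> linarith [abs_nonneg ξ]

theorem IsCutoff.radialCutoff_three_halves {ζ : ℝ → ℝ} (hζ : IsCutoff ζ) {ξ : ℝ}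
    (hξ : |ξ| < 1 / 2) : radialCutoff ζ (3 / 2) ξ = 0 := by
  rw [radialCutoff, hζ.eq_zero, Complex.ofReal_zero]
  rw [abs_of_nonpos] <;> linarith

theorem IsCutoff.hasCompactSupport_radialCutoff {ζ : ℝ → ℝ} (hζ : IsCutoff ζ) (c : ℝ) :
    HasCompactSupport (radialCutoff ζ c) := by
  refine HasCompactSupport.of_support_subset_isCompact (isCompact_closedBall (0 : ℝ) (|c| + 1))
    fun ξ hξ => ?_
  rw [mem_closedBall_zero_iff, Real.norm_eq_abs]
  have h1 : ζ (|ξ| - c) ≠ 0 := fun h => hξ (by rw [radialCutoff, h, Complex.ofReal_zero])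
  have := hζ.support_subset h1
  linarith [this.2, le_abs_self c]

theorem IsCutoff.exists_kernel {ζ : ℝ → ℝ} (hζ : IsCutoff ζ) {c : ℝ} {v : ℂ}
    (hc : ∀ ξ : ℝ, |ξ| < 1 / 2 → radialCutoff ζ c ξ = v) :
    ∃ K : SchwartzMap ℝ ℂ, (∀ y, K y = 𝓕⁻ (radialCutoff ζ c) y) ∧
      (∀ ξ, 𝓕 (K : ℝ → ℂ) ξ = radialCutoff ζ c ξ) ∧ ∀ y, K (-y) = K y := by
  set m : SchwartzMap ℝ ℂ := (hζ.hasCompactSupport_radialCutoff c).toSchwartzMap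
    (hζ.contDiff_radialCutoff hc) with hm
  have hK (y : ℝ) : (𝓕⁻ m : SchwartzMap ℝ ℂ) y = 𝓕⁻ (radialCutoff ζ c) y := by
    rw [SchwartzMap.fourierInv_coe]
    rfl
  refine ⟨𝓕⁻ m, hK, fun ξ => ?_, fun y => ?_⟩
  · rw [← SchwartzMap.fourier_coe, FourierTransform.fourier_fourierInv_eq]
    rfl
  · rw [hK, hK, Real.fourierInv_eq', Real.fourierInv_eq', ← integral_neg_eq_self]
    refine integral_congr_ae (.of_forall fun ξ => ?_)
    simp [radialCutoff]

theorem fourierInv_comp_div (m : ℝ → ℂ) {a : ℝ} (ha : 0 < a) (y : ℝ) :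
    𝓕⁻ (fun ξ => m (ξ / a)) y = (a : ℂ) * 𝓕⁻ m (a * y) := by
  rw [Real.fourierInv_eq', Real.fourierInv_eq']
  have h := Measure.integral_comp_div (fun v : ℝ =>
    Complex.exp (↑(2 * Real.pi * inner ℝ v (a * y)) * Complex.I) • m v) a
  rw [abs_of_pos ha, Complex.real_smul] at h
  rw [← h]
  refine integral_congr_ae (.of_forall fun ξ => ?_)
  have h1 : inner ℝ (ξ / a) (a * y) = inner ℝ ξ y := by
    simp only [RCLike.inner_apply, conj_trivial]
    field_simp
  simp only [h1]

theorem integral_kernel_mul_comp (K g : ℝ → ℂ) {a : ℝ} (ha : 0 < a) (x : ℝ) :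
    ∫ y, (a : ℂ) * K (a * (x - y)) * g y = ∫ w, K w * g (x - w / a) := by
  have h1 := integral_sub_left_eq_self (fun z => (a : ℂ) * K (a * z) * g (x - z)) volume x
  simp only [sub_sub_cancel] at h1
  rw [h1]
  have h2 := Measure.integral_comp_mul_left (fun w => (a : ℂ) * K w * g (x - w / a)) a
  have h3 (z : ℝ) : a * z / a = z := by field_simp
  simp only [h3] at h2
  rw [h2, abs_of_pos (inv_pos.2 ha), Complex.real_smul, ← integral_const_mul]
  refine integral_congr_ae (.of_forall fun w => ?_)
  have : (a : ℂ) ≠ 0 := by exact_mod_cast ha.ne'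
  simp only [Complex.ofReal_inv]
  field_simp

theorem IsCutoff.exists_low_kernel {ζ : ℝ → ℝ} (hζ : IsCutoff ζ) :
    ∃ K : SchwartzMap ℝ ℂ, ∀ g x, freqProj ζ 0 1 g x = ∫ w, K w * g (x - w) := by
  obtain ⟨K, hK, -, -⟩ := hζ.exists_kernel (fun ξ => hζ.radialCutoff_half)
  refine ⟨K, fun g x => ?_⟩
  have h := integral_kernel_mul_comp K g one_pos x
  simp only [Complex.ofReal_one, one_mul, div_one] at h
  rw [← h, freqProj, freqSymbol_zero_one]
  simp only [hK]

/-- All dyadic symbols are dilates of ζ(|ξ| - 3/2), so one even Schwartz kernel serves every k. Its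
mean is zero, as its transform vanishes near 0. -/
theorem IsCutoff.exists_dyadic_kernel {ζ : ℝ → ℝ} (hζ : IsCutoff ζ) :
    ∃ K : SchwartzMap ℝ ℂ, (∀ ξ, 𝓕 (K : ℝ → ℂ) ξ = radialCutoff ζ (3 / 2) ξ) ∧
      (∀ y, K (-y) = K y) ∧
      ∀ (k : ℕ) g x, freqProj ζ (2 ^ k) (2 ^ (k + 1)) g x = ∫ w, K w * g (x - w / 2 ^ k) := by
  obtain ⟨K, hK, hK', hKe⟩ := hζ.exists_kernel (fun ξ => hζ.radialCutoff_three_halves)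
  refine ⟨K, hK', hKe, fun k g x => ?_⟩
  have ha : (0 : ℝ) < 2 ^ k := by positivity
  rw [← integral_kernel_mul_comp K g ha x, freqProj, freqSymbol_two_pow]
  simp only [fourierInv_comp_div _ ha, hK]

theorem integral_kernel_eq_zero {K : SchwartzMap ℝ ℂ} (h : 𝓕 (K : ℝ → ℂ) 0 = 0) :
    ∫ w, K w = 0 := by
  rw [Real.fourier_eq'] at h
  simpa using h

theorem integrable_kernel_mul (K : SchwartzMap ℝ ℂ) {g : ℝ → ℂ} (hg : Continuous g) {A : ℝ}
    (hA : ∀ t, ‖g t‖ ≤ A) : Integrable fun w => K w * g w :=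
  K.integrable.mul_bdd hg.aestronglyMeasurable (.of_forall hA)

theorem norm_integral_kernel_mul_le (K : SchwartzMap ℝ ℂ) {g : ℝ → ℂ} {A : ℝ}
    (hA : ∀ t, ‖g t‖ ≤ A) : ‖∫ w, K w * g w‖ ≤ (∫ w, ‖K w‖) * A := by
  rw [← integral_mul_const]
  refine norm_integral_le_of_norm_le (K.integrable.norm.mul_const A) (.of_forall fun w => ?_)
  rw [norm_mul]
  exact mul_le_mul_of_nonneg_left (hA w) (norm_nonneg _)

theorem integrable_norm_kernel_mul_rpow (K : SchwartzMap ℝ ℂ) {α : ℝ} (hα₀ : 0 ≤ α)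
    (hα₂ : α ≤ 2) : Integrable fun w : ℝ => ‖K w‖ * |w| ^ α := by
  refine Integrable.mono' ((K.integrable_pow_mul volume 2).add K.integrable.norm)
    (Continuous.aestronglyMeasurable (K.continuous.norm.mul
      (continuous_abs.rpow_const fun _ => Or.inr hα₀))) (.of_forall fun w => ?_)
  rw [Real.norm_of_nonneg (by positivity)]
  simp only [Pi.add_apply, Real.norm_eq_abs]
  have : |w| ^ α ≤ |w| ^ 2 + 1 := by
    rcases le_total |w| 1 with h | h
    · have := Real.rpow_le_one (abs_nonneg w) h hα₀
      nlinarith [sq_nonneg |w|]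
    · have := Real.rpow_le_rpow_of_exponent_le h hα₂
      rw [Real.rpow_two] at this
      linarith
  nlinarith [norm_nonneg (K w)]

/-- Evenness symmetrises the convolution and the zero mean allows 2g(x) to be subtracted: twice the
integral is K integrated against a second difference of step w/a. -/
theorem norm_integral_kernel_mul_le_of_second_difference {K : SchwartzMap ℝ ℂ}
    (hKe : ∀ y, K (-y) = K y) (hK0 : ∫ w, K w = 0) {α : ℝ} (hα₀ : 0 ≤ α) (hα₂ : α ≤ 2) {A : ℝ}
    {g : ℝ → ℂ} (hgc : Continuous g) (hg : ∀ t, ‖g t‖ ≤ A)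
    (hgd : ∀ t s, ‖g (t + s) + g (t - s) - 2 * g t‖ ≤ A * |s| ^ α) {a : ℝ} (ha : 0 < a) (x : ℝ) :
    ‖∫ w, K w * g (x - w / a)‖ ≤ (∫ w, ‖K w‖ * |w| ^ α) * A * a ^ (-α) := by
  have i1 : Integrable fun w => K w * g (x - w / a) :=
    integrable_kernel_mul K (g := fun w => g (x - w / a)) (by fun_prop) (A := A) fun t => hg _
  have i2 : Integrable fun w => K w * g (x + w / a) :=
    integrable_kernel_mul K (g := fun w => g (x + w / a)) (by fun_prop) (A := A) fun t => hg _
  have i3 : Integrable fun w => K w * (2 * g x) := K.integrable.mul_const _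
  have h1 : ∫ w, K w * g (x + w / a) = ∫ w, K w * g (x - w / a) := by
    rw [← integral_neg_eq_self]
    refine integral_congr_ae (.of_forall fun w => ?_)
    simp only [hKe, neg_div, ← sub_eq_add_neg]
  have h2 : 2 * ∫ w, K w * g (x - w / a) =
      ∫ w, K w * (g (x + w / a) + g (x - w / a) - 2 * g x) := by
    have : (fun w => K w * (g (x + w / a) + g (x - w / a) - 2 * g x)) =
        fun w => K w * g (x + w / a) + K w * g (x - w / a) - K w * (2 * g x) := by
      funext w
      ring
    rw [this, integral_sub (f := fun w => K w * g (x + w / a) + K w * g (x - w / a)) (i2.add i1) i3,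
      integral_add i2 i1, h1, integral_mul_const, hK0]
    ring
  have h3 : ‖2 * ∫ w, K w * g (x - w / a)‖ ≤ (∫ w, ‖K w‖ * |w| ^ α) * (A * a ^ (-α)) := by
    rw [h2, ← integral_mul_const]
    refine norm_integral_le_of_norm_le
      ((integrable_norm_kernel_mul_rpow K hα₀ hα₂).mul_const _) (.of_forall fun w => ?_)
    rw [norm_mul, mul_assoc]
    refine mul_le_mul_of_nonneg_left ((hgd x (w / a)).trans (le_of_eq ?_)) (norm_nonneg _)
    rw [abs_div, abs_of_pos ha, Real.div_rpow (abs_nonneg _) ha.le, Real.rpow_neg ha.le]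
    ring
  rw [norm_mul, Complex.norm_ofNat] at h3
  have h4 := norm_nonneg (∫ w, K w * g (x - w / a))
  rw [mul_assoc]
  linarith

theorem eLpNorm_top_le_ofReal {g : ℝ → ℂ} {A : ℝ} (h : ∀ x, ‖g x‖ ≤ A) :
    eLpNorm g ⊤ volume ≤ ENNReal.ofReal A := by
  have := eLpNorm_le_of_ae_bound (p := ⊤) (μ := (volume : Measure ℝ)) (.of_forall h)
  simpa using this

/-- The set where a continuous function exceeds its essential supremum is open and null, hence
empty. This permits evaluating a projection at the single time 0. -/
theorem enorm_le_eLpNorm_top_of_continuous {g : ℝ → ℂ} (hg : Continuous g) (x : ℝ) :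
    ‖g x‖ₑ ≤ eLpNorm g ⊤ volume := by
  by_contra! h
  have h1 : IsOpen {y | eLpNorm g ⊤ volume < ‖g y‖ₑ} :=
    isOpen_lt continuous_const hg.enorm
  have h2 : volume {y | eLpNorm g ⊤ volume < ‖g y‖ₑ} = 0 := by
    have := ae_le_eLpNormEssSup (f := g) (μ := (volume : Measure ℝ))
    rw [ae_iff] at this
    rw [eLpNorm_exponent_top]
    simpa using this
  rw [h1.measure_eq_zero_iff (volume : Measure ℝ)] at h2
  exact (h2 ▸ h : x ∈ (∅ : Set ℝ))

theorem IsCutoff.exists_lipschitzNorm_le {ζ : ℝ → ℝ} (hζ : IsCutoff ζ) {α : ℝ} (hα₀ : 0 ≤ α)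
    (hα₂ : α ≤ 2) : ∃ C : ℝ, 0 ≤ C ∧ ∀ (g : ℝ → ℂ) (A : ℝ), Continuous g → (∀ t, ‖g t‖ ≤ A) →
      (∀ t s, ‖g (t + s) + g (t - s) - 2 * g t‖ ≤ A * |s| ^ α) →
      lipschitzNorm ζ α g ≤ ENNReal.ofReal (C * A) := by
  obtain ⟨K₀, hK₀⟩ := hζ.exists_low_kernel
  obtain ⟨K, hKF, hKe, hK⟩ := hζ.exists_dyadic_kernel
  have hK0 : ∫ w, K w = 0 := integral_kernel_eq_zero (by
    rw [hKF, hζ.radialCutoff_three_halves]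
    simp)
  have p1 : 0 ≤ ∫ w, ‖K₀ w‖ := integral_nonneg fun w => norm_nonneg _
  have p2 : 0 ≤ ∫ w : ℝ, ‖K w‖ * |w| ^ α := integral_nonneg fun w => by positivity
  refine ⟨(∫ w, ‖K₀ w‖) + ∫ w : ℝ, ‖K w‖ * |w| ^ α, by positivity, fun g A hgc hg hgd => ?_⟩
  have hA : 0 ≤ A := (norm_nonneg _).trans (hg 0)
  refine max_le ?_ (iSup_le fun k => ?_)
  · refine eLpNorm_top_le_ofReal fun x => ?_
    rw [hK₀]
    refine (norm_integral_kernel_mul_le K₀ (g := fun w => g (x - w)) fun t => hg _).trans ?_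
    exact mul_le_mul_of_nonneg_right (by linarith) hA
  · have ha : (0 : ℝ) < 2 ^ k := by positivity
    have h1 : eLpNorm (freqProj ζ (2 ^ k) (2 ^ (k + 1)) g) ⊤ volume ≤
        ENNReal.ofReal ((∫ w, ‖K w‖ * |w| ^ α) * A * (2 ^ k) ^ (-α)) := by
      refine eLpNorm_top_le_ofReal fun x => ?_
      rw [hK]
      exact norm_integral_kernel_mul_le_of_second_difference hKe hK0 hα₀ hα₂ hgc hg hgd ha x
    refine (mul_le_mul_right h1 _).trans ?_
    rw [← ENNReal.ofReal_mul (by positivity)]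
    refine ENNReal.ofReal_le_ofReal ?_
    have h2 : (2 : ℝ) ^ (α * (k : ℝ)) * (2 ^ k) ^ (-α) = 1 := by
      rw [← Real.rpow_natCast, ← Real.rpow_mul (by norm_num), ← Real.rpow_add (by norm_num)]
      rw [show α * (k : ℝ) + k * -α = 0 by ring, Real.rpow_zero]
    calc (2 : ℝ) ^ (α * (k : ℝ)) * ((∫ w, ‖K w‖ * |w| ^ α) * A * (2 ^ k) ^ (-α)) =
          (∫ w, ‖K w‖ * |w| ^ α) * A * ((2 : ℝ) ^ (α * (k : ℝ)) * (2 ^ k) ^ (-α)) := by ring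
      _ ≤ _ := by
        rw [h2, mul_one]
        exact mul_le_mul_of_nonneg_right (by linarith) hA

end SchrodingerDispersion

namespace SchrodingerDispersion

/-! ### Regularity of the dispersion -/

theorem MemSigma.sigmaNormSq_eq_ofReal {n : ℕ} {δ : ℝ} {f : L2 n} (hf : MemSigma δ f) :
    sigmaNormSq δ f = ENNReal.ofReal (sigmaNormSq δ f).toReal :=
  (ENNReal.ofReal_toReal hf.ne).symm

theorem exists_secondDifferenceLE_dispersion {n : ℕ} (hn : 1 ≤ n) {δ α : ℝ} (hδ₀ : 0 < δ)
    (hδ₁ : δ < 1) (hα : IsRegularityExponent n δ α) :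
    ∃ C : ℝ≥0, ∀ f : L2 n, MemSigma δ f →
      SecondDifferenceLE (dispersion δ f) (C * (sigmaNormSq δ f).toReal) α := by
  obtain ⟨C, hC⟩ := exists_dispersion_second_difference_le hn hδ₀ hδ₁ hα (hα.pos hδ₀)
  exact ⟨C, fun f hf t s hs => hC f hf t s hs⟩

theorem exists_abs_dispersion_le {n : ℕ} (hn : 1 ≤ n) {δ : ℝ} (hδ₀ : 0 < δ) (hδ₁ : δ < 1) (R : ℝ) :
    ∃ C : ℝ≥0, ∀ f : L2 n, MemSigma δ f → ∀ t : ℝ, |t| ≤ R →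
      |dispersion δ f t| ≤ C * (sigmaNormSq δ f).toReal := by
  obtain ⟨C, hC⟩ := exists_dispersion_le hn hδ₀ hδ₁
  refine ⟨C * (1 + |R| ^ (2 * δ)).toNNReal, fun f hf t ht => ?_⟩
  rw [abs_of_nonneg (dispersion_nonneg _ _ _)]
  refine (hC f hf t).trans ?_
  rw [NNReal.coe_mul, Real.coe_toNNReal _ (by positivity)]
  have h1 : |t| ^ (2 * δ) ≤ |R| ^ (2 * δ) :=
    Real.rpow_le_rpow (abs_nonneg t) (ht.trans (le_abs_self R)) (by positivity)
  exact mul_le_mul_of_nonneg_right (mul_le_mul_of_nonneg_left (by linarith) C.2)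
    ENNReal.toReal_nonneg

theorem continuous_dispersion {n : ℕ} (hn : 1 ≤ n) {δ α : ℝ} (hδ₀ : 0 < δ) (hδ₁ : δ < 1)
    (hα : IsRegularityExponent n δ α) {f : L2 n} (hf : MemSigma δ f) :
    Continuous (dispersion δ f) := by
  obtain ⟨C, hC⟩ := exists_secondDifferenceLE_dispersion hn hδ₀ hδ₁ hα
  refine (hC f hf).continuous (by positivity) (hα.pos hδ₀) (hα.lt_two hδ₁) fun R => ?_
  obtain ⟨B, hB⟩ := exists_abs_dispersion_le hn hδ₀ hδ₁ R
  exact ⟨_, hB f hf⟩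

theorem exists_memLipschitz {n : ℕ} (hn : 1 ≤ n) {δ α : ℝ} (hδ₀ : 0 < δ) (hδ₁ : δ < 1)
    {ζ : ℝ → ℝ} (hζ : IsCutoff ζ) (hα : IsRegularityExponent n δ α) {ψ : ℝ → ℂ}
    (hψ : ContDiff ℝ ∞ ψ) (hψc : HasCompactSupport ψ) :
    ∃ C : ℝ≥0, ∀ f : L2 n, MemSigma δ f →
      MemLipschitz ζ α (fun t => ψ t * (dispersion δ f t : ℂ)) ∧
      lipschitzNorm ζ α (fun t => ψ t * (dispersion δ f t : ℂ)) ≤ (C : ℝ≥0∞) * sigmaNormSq δ f := by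
  have hα₀ := hα.pos hδ₀
  have hα₂ := hα.lt_two hδ₁
  obtain ⟨C₁, hC₁⟩ := exists_secondDifferenceLE_dispersion hn hδ₀ hδ₁ hα
  obtain ⟨R, C₂, -, hC₂0, hC₂⟩ := exists_mul_second_difference_le hψ hψc hα₀ hα₂
  obtain ⟨C₃, hC₃⟩ := exists_abs_dispersion_le hn hδ₀ hδ₁ R
  obtain ⟨C₄, hC₄0, hC₄⟩ := hζ.exists_lipschitzNorm_le hα₀.le hα₂.le
  refine ⟨(C₄ * (C₂ * (C₁ + C₃))).toNNReal, fun f hf => ?_⟩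
  set N := (sigmaNormSq δ f).toReal with hN
  have hN0 : 0 ≤ N := ENNReal.toReal_nonneg
  have hg := hC₂ (dispersion δ f) ((C₁ + C₃) * N) (by positivity)
    (fun t s hs => (hC₁ f hf t s hs).trans (by
      gcongr
      exact le_add_of_nonneg_right C₃.2))
    (fun t ht => (hC₃ f hf t ht).trans (by
      gcongr
      exact le_add_of_nonneg_left C₁.2))
  have hgc : Continuous fun t => ψ t * (dispersion δ f t : ℂ) :=
    hψ.continuous.mul (Complex.continuous_ofReal.comp (continuous_dispersion hn hδ₀ hδ₁ hα hf))
  have hle := hC₄ _ _ hgc hg.1 hg.2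
  have heq : ENNReal.ofReal (C₄ * (C₂ * ((C₁ + C₃) * N))) =
      ((C₄ * (C₂ * (C₁ + C₃))).toNNReal : ℝ≥0∞) * sigmaNormSq δ f := by
    rw [hf.sigmaNormSq_eq_ofReal, ← hN, ← ENNReal.ofReal, ← ENNReal.ofReal_mul (by positivity)]
    congr 1
    ring
  refine ⟨⟨memLp_top_of_bound hgc.aestronglyMeasurable _ (.of_forall hg.1),
    hle.trans_lt ENNReal.ofReal_lt_top⟩, hle.trans heq.le⟩

theorem contDiff_one_dispersion {n : ℕ} (hn : 1 ≤ n) {δ : ℝ} (hδ : 1 / 2 < δ) (hδ₁ : δ < 1)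
    {f : L2 n} (hf : MemSigma δ f) : ContDiff ℝ 1 (dispersion δ f) := by
  -- For δ > 1/2 both 1/4 + 3δ/2 and 2δ exceed 1.
  obtain ⟨α, hα, hα₁⟩ : ∃ α, IsRegularityExponent n δ α ∧ 1 < α := by
    rcases hn.eq_or_lt with h | h
    · exact ⟨1 / 4 + 3 / 2 * δ, Or.inr (Or.inr ⟨⟨h.symm, hδ⟩, rfl⟩), by linarith⟩
    · exact ⟨2 * δ, Or.inl ⟨Or.inl h, rfl⟩, by linarith⟩
  have hδ₀ : 0 < δ := by linarith
  obtain ⟨C, hC⟩ := exists_secondDifferenceLE_dispersion hn hδ₀ hδ₁ hα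
  exact (hC f hf).contDiff_one (by positivity) hα₁ (continuous_dispersion hn hδ₀ hδ₁ hα hf)

end SchrodingerDispersion

namespace SchrodingerDispersion

/-! ### Power profiles on the Fourier side -/

theorem rpow_neg_sub_rpow_neg_le {p x y : ℝ} (hp : 0 ≤ p) (hx : 0 ≤ x) (hxy : x ≤ y) :
    (1 + x) ^ (-p) - (1 + y) ^ (-p) ≤ (1 + x) ^ (-p) * (p * (y - x)) := by
  have hy : 0 ≤ y := hx.trans hxy
  have hu : 0 < (1 + x) / (1 + y) := by positivity
  have h1 : (1 + y) ^ (-p) = (1 + x) ^ (-p) * ((1 + x) / (1 + y)) ^ p := by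
    rw [Real.div_rpow (by positivity) (by positivity), Real.rpow_neg (by positivity),
      Real.rpow_neg (by positivity)]
    have : 0 < (1 + x) ^ p := by positivity
    field_simp
  have h2 := Real.one_sub_inv_le_log_of_pos hu
  have h3 : 1 + p * Real.log ((1 + x) / (1 + y)) ≤ ((1 + x) / (1 + y)) ^ p := by
    rw [Real.rpow_def_of_pos hu, add_comm, mul_comm p]
    exact Real.add_one_le_exp _
  have h4 : ((1 + x) / (1 + y))⁻¹ - 1 ≤ y - x := by
    rw [inv_div, div_sub_one (by positivity), div_le_iff₀ (by positivity)]
    nlinarith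
  have h5 : 1 - ((1 + x) / (1 + y)) ^ p ≤ p * (y - x) := by nlinarith
  rw [h1]
  have h6 : 0 ≤ (1 + x) ^ (-p) := by positivity
  nlinarith

/-- The profile `(1 + |ξ|)^{-p}`. -/
noncomputable def powerProfile {n : ℕ} (p : ℝ) (ξ : EuclideanSpace ℝ (Fin n)) : ℝ :=
  (1 + ‖ξ‖) ^ (-p)

theorem powerProfile_pos {n : ℕ} (p : ℝ) (ξ : EuclideanSpace ℝ (Fin n)) :
    0 < powerProfile p ξ := by
  unfold powerProfile
  positivity

theorem continuous_powerProfile {n : ℕ} (p : ℝ) :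
    Continuous (powerProfile p : EuclideanSpace ℝ (Fin n) → ℝ) :=
  (by fun_prop : Continuous fun ξ : EuclideanSpace ℝ (Fin n) => 1 + ‖ξ‖).rpow_const
    fun ξ => Or.inl (by positivity)

@[fun_prop]
theorem measurable_powerProfile {n : ℕ} (p : ℝ) :
    Measurable (powerProfile p : EuclideanSpace ℝ (Fin n) → ℝ) :=
  (continuous_powerProfile p).measurable

/-- The larger value bounds the difference, and so does its product with p|ξ-η|. The symmetric form
is the one that integrates by scaling against the Gagliardo weight. -/
theorem powerProfile_sub_sq_le {n : ℕ} {p : ℝ} (hp : 0 ≤ p) (ξ η : EuclideanSpace ℝ (Fin n)) :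
    (powerProfile p ξ - powerProfile p η) ^ 2 ≤
      min 1 ((p * ‖ξ - η‖) ^ 2) * powerProfile p ξ ^ 2 +
        min 1 ((p * ‖η - ξ‖) ^ 2) * powerProfile p η ^ 2 := by
  wlog h : ‖ξ‖ ≤ ‖η‖ generalizing ξ η
  · have := this η ξ (le_of_not_ge h)
    rwa [add_comm, ← neg_sub, neg_sq] at this
  have h1 : 0 ≤ powerProfile p ξ - powerProfile p η := by
    rw [sub_nonneg]
    exact Real.rpow_le_rpow_of_nonpos (by positivity) (by linarith) (by linarith)
  have h2 : powerProfile p ξ - powerProfile p η ≤ powerProfile p ξ := by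
    linarith [powerProfile_pos p η]
  have h3 : powerProfile p ξ - powerProfile p η ≤ powerProfile p ξ * (p * ‖ξ - η‖) := by
    refine (rpow_neg_sub_rpow_neg_le hp (norm_nonneg ξ) h).trans ?_
    have : ‖η‖ - ‖ξ‖ ≤ ‖ξ - η‖ := by
      rw [norm_sub_rev]
      exact norm_sub_norm_le η ξ
    have h6 := (powerProfile_pos p ξ).le
    rw [powerProfile] at *
    gcongr
  have h4 : (powerProfile p ξ - powerProfile p η) ^ 2 ≤
      min 1 ((p * ‖ξ - η‖) ^ 2) * powerProfile p ξ ^ 2 := by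
    rw [min_mul_of_nonneg _ _ (sq_nonneg _), one_mul, ← mul_pow]
    refine le_min (by gcongr) ?_
    rw [mul_comm (p * _)]
    gcongr
  have h5 : 0 ≤ min 1 ((p * ‖η - ξ‖) ^ 2) * powerProfile p η ^ 2 := by positivity
  linarith

theorem lintegral_powerProfile_sq_lt_top {n : ℕ} {p : ℝ} (hp : n < 2 * p) :
    ∫⁻ ξ : EuclideanSpace ℝ (Fin n), ENNReal.ofReal (powerProfile p ξ ^ 2) < ⊤ := by
  have h := integrable_one_add_norm (E := EuclideanSpace ℝ (Fin n)) (μ := volume) (r := 2 * p)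
    (by rwa [finrank_euclideanSpace_fin])
  refine (lintegral_congr fun ξ => ?_).trans_lt h.lintegral_lt_top
  rw [powerProfile, ← Real.rpow_natCast, ← Real.rpow_mul (by positivity)]
  congr 2
  push_cast
  ring

theorem enorm_ofReal_sq (x : ℝ) : ‖(x : ℂ)‖ₑ ^ 2 = ENNReal.ofReal (x ^ 2) := by
  rw [← ofReal_norm, Complex.norm_real, ← ENNReal.ofReal_pow (norm_nonneg _), Real.norm_eq_abs,
    sq_abs]

theorem memLp_powerProfile {n : ℕ} {p : ℝ} (hp : n < 2 * p) :
    MemLp (fun ξ : EuclideanSpace ℝ (Fin n) => (powerProfile p ξ : ℂ)) 2 volume := by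
  refine ⟨(Complex.continuous_ofReal.comp (continuous_powerProfile p)).aestronglyMeasurable, ?_⟩
  refine (ENNReal.pow_lt_top_iff (n := 2) |>.1 ?_).resolve_right (by norm_num)
  rw [eLpNorm_two_sq]
  simp only [enorm_ofReal_sq]
  exact lintegral_powerProfile_sq_lt_top hp

theorem weightedSq_powerProfile_lt_top {n : ℕ} {δ p : ℝ} (hδ : 0 < δ) (hp : n + 2 * δ < 2 * p) :
    weightedSq δ (fun ξ : EuclideanSpace ℝ (Fin n) => (powerProfile p ξ : ℂ)) < ⊤ := by
  refine lt_of_le_of_lt (lintegral_mono fun ξ => ?_)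
    (lintegral_powerProfile_sq_lt_top (n := n) (p := p - δ) (by linarith))
  rw [enorm_ofReal_sq, ← ENNReal.ofReal_mul (by positivity)]
  refine ENNReal.ofReal_le_ofReal ?_
  have h1 : (1 + ‖ξ‖) ^ (2 * δ) * powerProfile p ξ ^ 2 = powerProfile (p - δ) ξ ^ 2 := by
    have h2 : powerProfile (p - δ) ξ = powerProfile p ξ * (1 + ‖ξ‖) ^ δ := by
      rw [powerProfile, powerProfile, ← Real.rpow_add (by positivity)]
      congr 1
      ring
    rw [h2, mul_pow, ← Real.rpow_natCast ((1 + ‖ξ‖) ^ δ), ← Real.rpow_mul (by positivity),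
      mul_comm δ]
    push_cast
    ring
  rw [← h1]
  gcongr
  linarith

theorem gagliardoEnergy_powerProfile_lt_top {n : ℕ} (hn : 1 ≤ n) {δ p : ℝ} (hδ₀ : 0 < δ)
    (hδ₁ : δ < 1) (hp₀ : 0 ≤ p) (hp : n < 2 * p) :
    gagliardoEnergy δ (fun ξ : EuclideanSpace ℝ (Fin n) => (powerProfile p ξ : ℂ)) < ⊤ := by
  set G : EuclideanSpace ℝ (Fin n) × EuclideanSpace ℝ (Fin n) → ℝ≥0∞ := fun q =>
    ENNReal.ofReal (min 1 ((p * ‖q.1 - q.2‖) ^ 2)) * ENNReal.ofReal (powerProfile p q.1 ^ 2) with hG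
  have hGm : Measurable G := by fun_prop
  have h1 : gagliardoEnergy δ (fun ξ : EuclideanSpace ℝ (Fin n) => (powerProfile p ξ : ℂ)) ≤
      ∫⁻ q, (G q + G q.swap) ∂gagliardoMeasure n δ := by
    refine lintegral_mono fun q => ?_
    simp only [hG, Prod.fst_swap, Prod.snd_swap]
    rw [← Complex.ofReal_sub, enorm_ofReal_sq, ← ENNReal.ofReal_mul (by positivity),
      ← ENNReal.ofReal_mul (by positivity), ← ENNReal.ofReal_add (by positivity) (by positivity)]
    exact ENNReal.ofReal_le_ofReal (powerProfile_sub_sq_le hp₀ _ _)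
  refine h1.trans_lt ?_
  rw [lintegral_add_swap_gagliardoMeasure δ hGm, hG, lintegral_min_mul_gagliardoMeasure hδ₀
    (a := fun _ => p) measurable_const (fun _ => hp₀) (g := fun ξ =>
      ENNReal.ofReal (powerProfile p ξ ^ 2)) (by fun_prop) (fun _ => ENNReal.ofReal_ne_top),
    lintegral_const_mul _ (by fun_prop)]
  exact ENNReal.mul_lt_top (by norm_num) (ENNReal.mul_lt_top (truncatedMoment_lt_top hn hδ₀ hδ₁)
    (ENNReal.mul_lt_top ENNReal.ofReal_lt_top (lintegral_powerProfile_sq_lt_top hp)))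

/-- The hypothesis on p makes |ξ|^δ f̂ square integrable. The spatial weight is never examined
directly: the Gagliardo identity reduces it to the energy of the profile. -/
theorem exists_memSigma_fourier_eq_powerProfile {n : ℕ} (hn : 1 ≤ n) {δ p : ℝ} (hδ₀ : 0 < δ)
    (hδ₁ : δ < 1) (hp : n + 2 * δ < 2 * p) :
    ∃ f : L2 n, MemSigma δ f ∧ (𝓕 f : L2 n) =ᵐ[volume] fun ξ => (powerProfile p ξ : ℂ) := by
  have hn0 : (0 : ℝ) ≤ n := Nat.cast_nonneg n
  have hp' : n < 2 * p := by linarith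
  obtain ⟨c, hc⟩ : ∃ c, IsGagliardoConstant n δ c := exists_oscillationMoment_eq hn hδ₀ hδ₁
  set F : L2 n := (memLp_powerProfile hp').toLp _ with hF
  have hFe : F =ᵐ[volume] fun ξ => (powerProfile p ξ : ℂ) := MemLp.coeFn_toLp _
  have h1 : (𝓕 (𝓕⁻ F : L2 n) : L2 n) = F := FourierTransform.fourier_fourierInv_eq F
  refine ⟨𝓕⁻ F, ?_, by rw [h1]; exact hFe⟩
  have h2 := hc.energy_eq (𝓕⁻ F : L2 n)
  rw [h1, gagliardoEnergy_congr_ae δ hFe] at h2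
  have h3 := gagliardoEnergy_powerProfile_lt_top hn hδ₀ hδ₁ (by linarith : 0 ≤ p) hp'
  rw [h2] at h3
  rw [MemSigma, sigmaNormSq_eq, h1, ENNReal.add_lt_top]
  constructor
  · exact ENNReal.lt_top_of_mul_ne_top_right h3.ne (by simpa using hc.1)
  · have h4 : weightedSq δ F = weightedSq δ (fun ξ : EuclideanSpace ℝ (Fin n) =>
        (powerProfile p ξ : ℂ)) := by
      refine lintegral_congr_ae ?_
      filter_upwards [hFe] with ξ hξ
      rw [hξ]
    rw [h4]
    exact weightedSq_powerProfile_lt_top hδ₀ hp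

end SchrodingerDispersion

namespace SchrodingerDispersion

/-! ### Frequency projections of the dispersion -/

variable {n : ℕ} {δ c : ℝ}

theorem energyDensity_ofReal (F : EuclideanSpace ℝ (Fin n) → ℝ) (t : ℝ)
    (p : EuclideanSpace ℝ (Fin n) × EuclideanSpace ℝ (Fin n)) :
    ((energyDensity (fun ξ => (F ξ : ℂ)) t p : ℝ) : ℂ) = ((F p.1 ^ 2 + F p.2 ^ 2 : ℝ) : ℂ) -
      ((F p.1 * F p.2 : ℝ) : ℂ) *
        (Complex.exp (((-(Real.pi * t * (‖p.1‖ ^ 2 - ‖p.2‖ ^ 2)) : ℝ) : ℂ) * Complex.I) +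
          Complex.exp (((Real.pi * t * (‖p.1‖ ^ 2 - ‖p.2‖ ^ 2) : ℝ) : ℂ) * Complex.I)) := by
  have h1 (ξ : EuclideanSpace ℝ (Fin n)) : (starRingEnd ℂ) (phase t ξ) =
      Complex.exp (((Real.pi * t * ‖ξ‖ ^ 2 : ℝ) : ℂ) * Complex.I) := by
    rw [phase, ← Complex.exp_conj]
    simp
  have h2 (ξ : EuclideanSpace ℝ (Fin n)) : phase t ξ * (starRingEnd ℂ) (phase t ξ) = 1 := by
    rw [Complex.mul_conj, Complex.normSq_eq_norm_sq, norm_phase]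
    simp
  have h3 : Complex.exp (((-(Real.pi * t * (‖p.1‖ ^ 2 - ‖p.2‖ ^ 2)) : ℝ) : ℂ) * Complex.I) =
      phase t p.1 * (starRingEnd ℂ) (phase t p.2) := by
    rw [h1, phase, ← Complex.exp_add]
    congr 1
    push_cast
    ring
  have h4 : Complex.exp (((Real.pi * t * (‖p.1‖ ^ 2 - ‖p.2‖ ^ 2) : ℝ) : ℂ) * Complex.I) =
      phase t p.2 * (starRingEnd ℂ) (phase t p.1) := by
    rw [h1, phase, ← Complex.exp_add]
    congr 1
    push_cast
    ring
  rw [h3, h4, energyDensity, ← Complex.normSq_eq_norm_sq, ← Complex.mul_conj]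
  simp only [map_sub, map_mul, Complex.conj_ofReal]
  push_cast
  linear_combination (F p.1 : ℂ) ^ 2 * h2 p.1 + (F p.2 : ℂ) ^ 2 * h2 p.2

theorem integral_kernel_mul_exp (K : ℝ → ℂ) {a : ℝ} (ha : 0 < a) (D : ℝ) :
    ∫ w, K w * Complex.exp (((Real.pi * (-w / a) * D : ℝ) : ℂ) * Complex.I) =
      𝓕 K (D / (2 * a)) := by
  rw [Real.fourier_eq']
  refine integral_congr_ae (.of_forall fun w => ?_)
  simp only [smul_eq_mul, RCLike.inner_apply, conj_trivial]
  rw [mul_comm]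
  congr 3
  refine congrArg (fun r : ℝ => (r : ℂ)) ?_
  field_simp

/-- The zero mean of K removes the terms constant in time. The two conjugate exponentials contribute
equally because the symbol is even, which produces the factor -2. -/
theorem integral_kernel_mul_energyDensity {ζ : ℝ → ℝ} {K : SchwartzMap ℝ ℂ}
    (hKF : ∀ ξ, 𝓕 (K : ℝ → ℂ) ξ = radialCutoff ζ (3 / 2) ξ) (hK0 : ∫ w, K w = 0)
    (F : EuclideanSpace ℝ (Fin n) → ℝ) {a : ℝ} (ha : 0 < a)
    (p : EuclideanSpace ℝ (Fin n) × EuclideanSpace ℝ (Fin n)) :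
    ∫ w, K w * ((energyDensity (fun ξ => (F ξ : ℂ)) (-w / a) p : ℝ) : ℂ) =
      -2 * (((F p.1 * F p.2 : ℝ) : ℂ) *
        radialCutoff ζ (3 / 2) ((‖p.1‖ ^ 2 - ‖p.2‖ ^ 2) / (2 * a))) := by
  set D := ‖p.1‖ ^ 2 - ‖p.2‖ ^ 2 with hD
  have hexp (r : ℝ) : Integrable fun w => K w *
      Complex.exp (((Real.pi * (-w / a) * r : ℝ) : ℂ) * Complex.I) :=
    integrable_kernel_mul K (g := fun w => Complex.exp (((Real.pi * (-w / a) * r : ℝ) : ℂ) *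
      Complex.I)) (by fun_prop) (A := 1) fun t => (Complex.norm_exp_ofReal_mul_I _).le
  have h1 (w : ℝ) : K w * ((energyDensity (fun ξ => (F ξ : ℂ)) (-w / a) p : ℝ) : ℂ) =
      K w * ((F p.1 ^ 2 + F p.2 ^ 2 : ℝ) : ℂ) - ((F p.1 * F p.2 : ℝ) : ℂ) *
        (K w * Complex.exp (((Real.pi * (-w / a) * -D : ℝ) : ℂ) * Complex.I) +
          K w * Complex.exp (((Real.pi * (-w / a) * D : ℝ) : ℂ) * Complex.I)) := by
    rw [energyDensity_ofReal, mul_neg]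
    ring
  have h2 : radialCutoff ζ (3 / 2) (-D / (2 * a)) = radialCutoff ζ (3 / 2) (D / (2 * a)) := by
    simp [radialCutoff, neg_div]
  simp only [h1]
  have h3 : Integrable fun w => ((F p.1 * F p.2 : ℝ) : ℂ) *
      (K w * Complex.exp (((Real.pi * (-w / a) * -D : ℝ) : ℂ) * Complex.I) +
        K w * Complex.exp (((Real.pi * (-w / a) * D : ℝ) : ℂ) * Complex.I)) :=
    ((hexp (-D)).add (hexp D)).const_mul _
  rw [integral_sub (K.integrable.mul_const _) h3,
    integral_const_mul, integral_add (hexp _) (hexp _), integral_mul_const, hK0,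
    integral_kernel_mul_exp _ ha, integral_kernel_mul_exp _ ha, hKF, hKF, h2]
  ring

theorem measurable_energyDensity_uncurry {F : EuclideanSpace ℝ (Fin n) → ℂ} (hF : Measurable F)
    {τ : ℝ → ℝ} (hτ : Measurable τ) :
    Measurable fun q : ℝ × (EuclideanSpace ℝ (Fin n) × EuclideanSpace ℝ (Fin n)) =>
      energyDensity F (τ q.1) q.2 := by
  unfold energyDensity phase
  fun_prop

theorem exists_isRegularityExponent {n : ℕ} (hn : 1 ≤ n) (δ : ℝ) :
    ∃ α, IsRegularityExponent n δ α := by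
  rcases hn.eq_or_lt with h | h
  · rcases lt_trichotomy δ (1 / 2) with hδ | hδ | hδ
    · exact ⟨2 * δ, Or.inl ⟨Or.inr ⟨h.symm, hδ⟩, rfl⟩⟩
    · exact ⟨1 / 2, Or.inr (Or.inl ⟨⟨h.symm, hδ⟩, by norm_num, by norm_num⟩)⟩
    · exact ⟨_, Or.inr (Or.inr ⟨⟨h.symm, hδ⟩, rfl⟩)⟩
  · exact ⟨2 * δ, Or.inl ⟨Or.inl h, rfl⟩⟩

theorem exists_dispersion_le_one_add_sq (hn : 1 ≤ n) (hδ₀ : 0 < δ) (hδ₁ : δ < 1) {f : L2 n}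
    (hf : MemSigma δ f) : ∃ B : ℝ, 0 ≤ B ∧ ∀ t, dispersion δ f t ≤ B * (1 + t ^ 2) := by
  obtain ⟨C, hC⟩ := exists_dispersion_le hn hδ₀ hδ₁
  refine ⟨2 * (C * (sigmaNormSq δ f).toReal), by positivity, fun t => (hC f hf t).trans ?_⟩
  have h1 : 1 + |t| ^ (2 * δ) ≤ 2 * (1 + t ^ 2) := by
    rcases le_total |t| 1 with h | h
    · have := Real.rpow_le_one (abs_nonneg t) h (by positivity : 0 ≤ 2 * δ)
      nlinarith [sq_nonneg t]
    · have := Real.rpow_le_rpow_of_exponent_le h (by linarith : 2 * δ ≤ 2)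
      rw [Real.rpow_two, sq_abs] at this
      nlinarith
  have h2 : 0 ≤ C * (sigmaNormSq δ f).toReal := by positivity
  calc C * (1 + |t| ^ (2 * δ)) * (sigmaNormSq δ f).toReal =
        C * (sigmaNormSq δ f).toReal * (1 + |t| ^ (2 * δ)) := by ring
    _ ≤ C * (sigmaNormSq δ f).toReal * (2 * (1 + t ^ 2)) := mul_le_mul_of_nonneg_left h1 h2
    _ = _ := by ring

theorem integrable_kernel_mul_one_add_sq (K : SchwartzMap ℝ ℂ) {a : ℝ} (ha : 1 ≤ a) :
    Integrable fun w : ℝ => ‖K w‖ * (1 + (-w / a) ^ 2) := by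
  refine Integrable.mono' ((K.integrable_pow_mul volume 2).add K.integrable.norm)
    (Continuous.aestronglyMeasurable (by fun_prop)) (.of_forall fun w => ?_)
  rw [Real.norm_of_nonneg (by positivity)]
  simp only [Pi.add_apply, Real.norm_eq_abs, sq_abs]
  have h1 : (-w / a) ^ 2 ≤ w ^ 2 := by
    rw [div_pow, neg_sq]
    exact div_le_self (sq_nonneg w) (one_le_pow₀ ha)
  nlinarith [norm_nonneg (K w)]

theorem integrable_kernel_mul_prod {X : Type*} [MeasurableSpace X] {μ : Measure X} [SFinite μ]
    {K : ℝ → ℂ} (hK : Measurable K) {e : ℝ → X → ℝ} (he : Measurable fun q : ℝ × X => e q.1 q.2)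
    (he0 : ∀ w p, 0 ≤ e w p) (hei : ∀ w, Integrable (e w) μ)
    (h : Integrable fun w => ‖K w‖ * ∫ p, e w p ∂μ) :
    Integrable (fun q : ℝ × X => K q.1 * (e q.1 q.2 : ℂ)) (volume.prod μ) := by
  have hm : Measurable fun q : ℝ × X => K q.1 * (e q.1 q.2 : ℂ) :=
    (hK.comp measurable_fst).mul (Complex.measurable_ofReal.comp he)
  rw [integrable_prod_iff hm.aestronglyMeasurable]
  have h1 (w : ℝ) : Integrable (fun p => (e w p : ℂ)) μ := (hei w).ofReal
  refine ⟨.of_forall fun w => (h1 w).const_mul (K w), h.congr (.of_forall fun w => ?_)⟩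
  simp only [norm_mul, Complex.norm_real, Real.norm_of_nonneg (he0 _ _), integral_const_mul]

/-- This justifies Fubini: after integration over pairs only h remains, and its growth, at most
quadratic, is absorbed by the decay of K. -/
theorem IsGagliardoConstant.integrable_kernel_mul_energyDensity (hc : IsGagliardoConstant n δ c)
    (hn : 1 ≤ n) (hδ₀ : 0 < δ) (hδ₁ : δ < 1) {f : L2 n} (hf : MemSigma δ f)
    (K : SchwartzMap ℝ ℂ) {a : ℝ} (ha : 1 ≤ a) :
    Integrable (fun q : ℝ × (EuclideanSpace ℝ (Fin n) × EuclideanSpace ℝ (Fin n)) =>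
      K q.1 * ((energyDensity (𝓕 f : L2 n) (-q.1 / a) q.2 : ℝ) : ℂ))
      (volume.prod (gagliardoMeasure n δ)) := by
  have hm := measurable_energyDensity_uncurry (measurable_fourier f)
    (τ := fun w => -w / a) (by fun_prop)
  refine integrable_kernel_mul_prod (e := fun w p => energyDensity (𝓕 f : L2 n) (-w / a) p)
    K.continuous.measurable hm (fun _ _ => energyDensity_nonneg _ _ _)
    (fun w => hc.integrable_energyDensity hn hδ₀ hδ₁ hf (-w / a)) ?_
  simp only [hc.integral_energyDensity hn hδ₀ hδ₁ hf]
  obtain ⟨B, hB0, hB⟩ := exists_dispersion_le_one_add_sq hn hδ₀ hδ₁ hf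
  obtain ⟨α, hα⟩ := exists_isRegularityExponent hn δ
  have hcont := continuous_dispersion hn hδ₀ hδ₁ hα hf
  have hc0 := hc.1.le
  refine Integrable.mono' ((integrable_kernel_mul_one_add_sq K ha).const_mul (c * B))
    (Continuous.aestronglyMeasurable (K.continuous.norm.mul
      (continuous_const.mul (hcont.comp (by fun_prop))))) (.of_forall fun w => ?_)
  have hd := dispersion_nonneg δ f (-w / a)
  rw [Real.norm_of_nonneg (by positivity)]
  calc ‖K w‖ * (c * dispersion δ f (-w / a)) ≤ ‖K w‖ * (c * (B * (1 + (-w / a) ^ 2))) :=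
        mul_le_mul_of_nonneg_left (mul_le_mul_of_nonneg_left (hB _) hc0) (norm_nonneg _)
    _ = _ := by ring

/-- Fubini exchanges the time convolution with the pair integral. If F ≥ 0 and ζ ≥ 0 the resulting
integrand has one sign, so a lower bound may come from any subset of pairs. -/
theorem IsGagliardoConstant.integral_kernel_mul_dispersion (hc : IsGagliardoConstant n δ c)
    (hn : 1 ≤ n) (hδ₀ : 0 < δ) (hδ₁ : δ < 1) {f : L2 n} (hf : MemSigma δ f)
    {F : EuclideanSpace ℝ (Fin n) → ℝ}
    (hF : (𝓕 f : L2 n) =ᵐ[volume] fun ξ => (F ξ : ℂ)) {ζ : ℝ → ℝ} {K : SchwartzMap ℝ ℂ}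
    (hKF : ∀ ξ, 𝓕 (K : ℝ → ℂ) ξ = radialCutoff ζ (3 / 2) ξ) (hK0 : ∫ w, K w = 0)
    {a : ℝ} (ha : 1 ≤ a) :
    Integrable (fun p => F p.1 * F p.2 *
      ζ (|(‖p.1‖ ^ 2 - ‖p.2‖ ^ 2) / (2 * a)| - 3 / 2)) (gagliardoMeasure n δ) ∧
    (c : ℂ) * ∫ w, K w * (dispersion δ f (-w / a) : ℂ) =
      ((-2 * ∫ p, F p.1 * F p.2 * ζ (|(‖p.1‖ ^ 2 - ‖p.2‖ ^ 2) / (2 * a)| - 3 / 2)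
        ∂gagliardoMeasure n δ : ℝ) : ℂ) := by
  have ha0 : 0 < a := by linarith
  have hint := hc.integrable_kernel_mul_energyDensity hn hδ₀ hδ₁ hf K ha
  set m : EuclideanSpace ℝ (Fin n) × EuclideanSpace ℝ (Fin n) → ℝ := fun p =>
    F p.1 * F p.2 * ζ (|(‖p.1‖ ^ 2 - ‖p.2‖ ^ 2) / (2 * a)| - 3 / 2) with hm
  have hae : ∀ᵐ p ∂gagliardoMeasure n δ,
      ∫ w, K w * ((energyDensity (𝓕 f : L2 n) (-w / a) p : ℝ) : ℂ) = ((-2 * m p : ℝ) : ℂ) := by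
    refine (gagliardoMeasure_absolutelyContinuous n δ).ae_le ?_
    filter_upwards [Measure.quasiMeasurePreserving_fst.ae_eq_comp hF,
      Measure.quasiMeasurePreserving_snd.ae_eq_comp hF] with p h1 h2
    simp only [Function.comp_apply] at h1 h2
    have h3 := integral_kernel_mul_energyDensity hKF hK0 F ha0 p
    simp only [energyDensity] at h3 ⊢
    rw [h1, h2, h3, radialCutoff, hm]
    push_cast
    ring
  have h4 : Integrable (fun p => ((-2 * m p : ℝ) : ℂ)) (gagliardoMeasure n δ) :=
    hint.integral_prod_right.congr hae
  have h5 : Integrable (fun p => -2 * m p) (gagliardoMeasure n δ) := by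
    simpa using h4.re
  refine ⟨(h5.const_mul (-1 / 2)).congr (.of_forall fun p => by ring), ?_⟩
  calc (c : ℂ) * ∫ w, K w * (dispersion δ f (-w / a) : ℂ) =
      ∫ w, ∫ p, K w * ((energyDensity (𝓕 f : L2 n) (-w / a) p : ℝ) : ℂ)
        ∂gagliardoMeasure n δ := by
        rw [← integral_const_mul]
        refine integral_congr_ae (.of_forall fun w => ?_)
        simp only
        rw [integral_const_mul, integral_complex_ofReal,
          hc.integral_energyDensity hn hδ₀ hδ₁ hf]
        push_cast
        ring
    _ = ∫ p, (∫ w, K w * ((energyDensity (𝓕 f : L2 n) (-w / a) p : ℝ) : ℂ))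
        ∂gagliardoMeasure n δ := integral_integral_swap hint
    _ = ∫ p, ((-2 * m p : ℝ) : ℂ) ∂gagliardoMeasure n δ := integral_congr_ae hae
    _ = _ := by rw [integral_complex_ofReal, integral_const_mul]

end SchrodingerDispersion

namespace SchrodingerDispersion

open scoped Pointwise

/-! ### Sharpness -/

/-- Only pairs with √3 R < |ξ| < 2R and |η| < r are kept. There |ξ-η| ≤ 3R, 1+|ξ| ≤ 3R and 1+|η| ≤
2r, and the region has volume of order R^n r^n. -/
theorem exists_le_lintegral_powerProfile {n : ℕ} (hn : 1 ≤ n) {δ p : ℝ} (hδ : 0 < δ) (hp : 0 ≤ p)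
    {ζ : ℝ → ℝ} (hζ : IsCutoff ζ) :
    ∃ κ : ℝ, 0 < κ ∧ ∀ R r : ℝ, 1 ≤ r → r ≤ R →
      ENNReal.ofReal (κ * (R ^ (-(2 * δ + p)) * r ^ (n - p))) ≤
        ∫⁻ q : EuclideanSpace ℝ (Fin n) × EuclideanSpace ℝ (Fin n),
          ENNReal.ofReal (powerProfile p q.1 * powerProfile p q.2 *
            ζ (|(‖q.1‖ ^ 2 - ‖q.2‖ ^ 2) / (2 * R ^ 2)| - 3 / 2)) ∂gagliardoMeasure n δ := by
  have := nontrivial_euclideanSpace hn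
  -- With |η| < R, the bounds 3 and 4 put (|ξ|²-|η|²)/(2R²) in [1, 2], which is where ζ(· - 3/2) is
  -- known to be 1.
  set A : Set (EuclideanSpace ℝ (Fin n)) := {x | 3 < ‖x‖ ^ 2 ∧ ‖x‖ ^ 2 < 4} with hA
  set B : Set (EuclideanSpace ℝ (Fin n)) := Metric.ball 0 1 with hB
  have hAo : IsOpen A := by
    refine IsOpen.and (isOpen_lt ?_ ?_) (isOpen_lt ?_ ?_) <;> fun_prop
  have hA0 : volume A ≠ 0 := by
    obtain ⟨e, he⟩ := exists_norm_eq (EuclideanSpace ℝ (Fin n)) (by norm_num : (0 : ℝ) ≤ 19 / 10)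
    exact (hAo.measure_pos volume ⟨e, by rw [hA, Set.mem_ofPred_eq, he]; norm_num⟩).ne'
  have hB0 : volume B ≠ 0 := (Metric.measure_ball_pos volume 0 one_pos).ne'
  have hBt : volume B ≠ ⊤ := measure_ball_lt_top.ne
  have hAt : volume A ≠ ⊤ := by
    refine ((measure_mono fun x hx => ?_).trans_lt
      (measure_ball_lt_top (x := (0 : EuclideanSpace ℝ (Fin n))) (r := 2))).ne
    rw [mem_ball_zero_iff]
    nlinarith [hx.2, norm_nonneg x]
  set L₀ : ℝ := 3 ^ (-(n + 2 * δ) - p) * 2 ^ (-p) with hL₀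
  have hL₀0 : 0 < L₀ := by positivity
  set V : ℝ := (volume A).toReal * (volume B).toReal with hV
  have hV0 : 0 < V := mul_pos (ENNReal.toReal_pos hA0 hAt) (ENNReal.toReal_pos hB0 hBt)
  refine ⟨L₀ * V, by positivity, fun R r hr hrR => ?_⟩
  have hR1 : 1 ≤ R := hr.trans hrR
  have hR0 : 0 < R := by linarith
  have hr0 : 0 < r := by linarith
  have hRm : MeasurableSet (R • A) := (hAo.smul₀ hR0.ne').measurableSet
  have hrm : MeasurableSet (r • B) := (Metric.isOpen_ball.smul₀ hr0.ne').measurableSet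
  set L : ℝ := (3 * R) ^ (-(n + 2 * δ)) * ((3 * R) ^ (-p) * (2 * r) ^ (-p)) with hL
  have hlow (ξ η : EuclideanSpace ℝ (Fin n)) (hξ : ξ ∈ R • A) (hη : η ∈ r • B) :
      ENNReal.ofReal L ≤ ENNReal.ofReal (gagliardoWeight δ (ξ - η)) *
        ENNReal.ofReal (powerProfile p ξ * powerProfile p η *
            ζ (|(‖ξ‖ ^ 2 - ‖η‖ ^ 2) / (2 * R ^ 2)| - 3 / 2)) := by
    obtain ⟨x, ⟨hx3, hx4⟩, rfl⟩ := hξ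
    obtain ⟨y, hy, rfl⟩ := hη
    have hy1 : ‖y‖ < 1 := by simpa [hB] using hy
    have hx2 : ‖x‖ < 2 := by nlinarith [norm_nonneg x]
    have hx1 : 1 < ‖x‖ := by nlinarith [norm_nonneg x]
    simp only
    have n1 : ‖R • x‖ = R * ‖x‖ := by rw [norm_smul, Real.norm_of_nonneg hR0.le]
    have n2 : ‖r • y‖ = r * ‖y‖ := by rw [norm_smul, Real.norm_of_nonneg hr0.le]
    have b1 : ‖R • x‖ ≤ 2 * R := by rw [n1]; nlinarith
    have b2 : ‖r • y‖ ≤ r := by rw [n2]; nlinarith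
    have b3 : r * ‖y‖ < R := by nlinarith
    have b4 : R < R * ‖x‖ := by nlinarith
    have h1 : 0 < ‖R • x - r • y‖ := by
      have := norm_sub_norm_le (R • x) (r • y)
      rw [n1, n2] at this
      linarith
    have h2 : ‖R • x - r • y‖ ≤ 3 * R := (norm_sub_le _ _).trans (by linarith)
    have h3 : (3 * R) ^ (-(n + 2 * δ)) ≤ gagliardoWeight δ (R • x - r • y) :=
      Real.rpow_le_rpow_of_nonpos h1 h2 (by
        have : (0 : ℝ) ≤ n := Nat.cast_nonneg n
        linarith)
    have h4 : (3 * R) ^ (-p) ≤ powerProfile p (R • x) :=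
      Real.rpow_le_rpow_of_nonpos (by positivity) (by linarith) (by linarith)
    have h5 : (2 * r) ^ (-p) ≤ powerProfile p (r • y) :=
      Real.rpow_le_rpow_of_nonpos (by positivity) (by linarith) (by linarith)
    have h6 : ζ (|(‖R • x‖ ^ 2 - ‖r • y‖ ^ 2) / (2 * R ^ 2)| - 3 / 2) = 1 := by
      have d0 : (r * ‖y‖) ^ 2 ≤ R ^ 2 := by gcongr
      have d1 : 1 ≤ (‖R • x‖ ^ 2 - ‖r • y‖ ^ 2) / (2 * R ^ 2) := by
        rw [n1, n2, le_div_iff₀ (by positivity), mul_pow R]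
        nlinarith [sq_pos_of_pos hR0]
      have d2 : (‖R • x‖ ^ 2 - ‖r • y‖ ^ 2) / (2 * R ^ 2) ≤ 2 := by
        rw [n1, n2, div_le_iff₀ (by positivity), mul_pow R]
        nlinarith [sq_pos_of_pos hR0, sq_nonneg (r * ‖y‖)]
      refine hζ.eq_one _ ?_
      rw [abs_of_nonneg (by linarith)]
      constructor <;> linarith
    rw [h6, mul_one, ← ENNReal.ofReal_mul (gagliardoWeight_nonneg _ _)]
    refine ENNReal.ofReal_le_ofReal ?_
    have h7 := (powerProfile_pos p (R • x)).le
    have h8 := gagliardoWeight_nonneg δ (R • x - r • y)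
    exact mul_le_mul h3 (mul_le_mul h4 h5 (by positivity) h7) (by positivity) h8
  have hLL : L * (R ^ n * r ^ n) = L₀ * (R ^ (-(2 * δ + p)) * r ^ (n - p)) := by
    rw [hL, hL₀, Real.mul_rpow (by norm_num) hR0.le, Real.mul_rpow (by norm_num) hR0.le,
      Real.mul_rpow (by norm_num) hr0.le, ← Real.rpow_natCast, ← Real.rpow_natCast]
    have e1 : R ^ (-(2 * δ + p)) = R ^ (-(n + 2 * δ)) * R ^ (-p) * R ^ (n : ℝ) := by
      rw [← Real.rpow_add hR0, ← Real.rpow_add hR0]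
      congr 1
      ring
    have e2 : r ^ (n - p) = r ^ (-p) * r ^ (n : ℝ) := by
      rw [← Real.rpow_add hr0]
      congr 1
      ring
    have e3 : (3 : ℝ) ^ (-(n + 2 * δ) - p) = 3 ^ (-(n + 2 * δ)) * 3 ^ (-p) := by
      rw [← Real.rpow_add (by norm_num)]
      congr 1
    rw [e1, e2, e3]
    ring
  have hvol (s : ℝ) (hs : 0 < s) (S : Set (EuclideanSpace ℝ (Fin n))) (hS : volume S ≠ ⊤) :
      volume (s • S) = ENNReal.ofReal (s ^ n * (volume S).toReal) := by
    rw [Measure.addHaar_smul_of_nonneg _ hs.le, finrank_euclideanSpace_fin,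
      ENNReal.ofReal_mul (by positivity), ENNReal.ofReal_toReal hS]
  have hζm := hζ.smooth.continuous.measurable
  rw [lintegral_gagliardoMeasure δ (by fun_prop)]
  calc ENNReal.ofReal (L₀ * V * (R ^ (-(2 * δ + p)) * r ^ (n - p))) =
        ENNReal.ofReal L * volume (r • B) * volume (R • A) := by
        rw [hvol r hr0 B hBt, hvol R hR0 A hAt, ← ENNReal.ofReal_mul (by positivity),
          ← ENNReal.ofReal_mul (by positivity)]
        congr 1
        linear_combination (-V) * hLL
    _ = ∫⁻ ξ in R • A, ∫⁻ η in r • B, ENNReal.ofReal L := by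
        rw [setLIntegral_const, setLIntegral_const]
    _ ≤ ∫⁻ ξ in R • A, ∫⁻ η in r • B, ENNReal.ofReal (gagliardoWeight δ (ξ - η)) *
        ENNReal.ofReal (powerProfile p ξ * powerProfile p η *
            ζ (|(‖ξ‖ ^ 2 - ‖η‖ ^ 2) / (2 * R ^ 2)| - 3 / 2)) :=
        setLIntegral_mono' hRm fun ξ hξ => setLIntegral_mono' hrm fun η hη => hlow ξ η hξ hη
    _ ≤ _ := (setLIntegral_le_lintegral _ _).trans
        (lintegral_mono fun ξ => setLIntegral_le_lintegral _ _)

theorem continuous_integral_kernel_mul (K : SchwartzMap ℝ ℂ) {g : ℝ → ℂ} (hg : Continuous g)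
    {A : ℝ} (hA : ∀ t, ‖g t‖ ≤ A) (a : ℝ) : Continuous fun x => ∫ w, K w * g (x - w / a) := by
  refine continuous_of_dominated (bound := fun w => ‖K w‖ * A)
    (fun x => Continuous.aestronglyMeasurable (by fun_prop)) (fun x => .of_forall fun w => ?_)
    (K.integrable.norm.mul_const A) (.of_forall fun w => by fun_prop)
  rw [norm_mul]
  exact mul_le_mul_of_nonneg_left (hA _) (norm_nonneg _)

theorem norm_freqProj_le {ζ : ℝ → ℝ} {K : SchwartzMap ℝ ℂ}
    (hK : ∀ (k : ℕ) g x, freqProj ζ (2 ^ k) (2 ^ (k + 1)) g x = ∫ w, K w * g (x - w / 2 ^ k))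
    {g : ℝ → ℂ} (hg : Continuous g) {A : ℝ} (hA : ∀ t, ‖g t‖ ≤ A) {β : ℝ}
    (hL : lipschitzNorm ζ β g < ⊤) (k : ℕ) (x : ℝ) :
    ‖∫ w, K w * g (x - w / 2 ^ k)‖ ≤ (lipschitzNorm ζ β g).toReal * (2 ^ k) ^ (-β) := by
  have hc : Continuous (freqProj ζ (2 ^ k) (2 ^ (k + 1)) g) := by
    rw [show freqProj ζ (2 ^ k) (2 ^ (k + 1)) g = fun x => ∫ w, K w * g (x - w / 2 ^ k) from
      funext fun x => hK k g x]
    exact continuous_integral_kernel_mul K hg hA _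
  have h1 : ENNReal.ofReal ((2 : ℝ) ^ (β * (k : ℝ))) *
      ‖freqProj ζ (2 ^ k) (2 ^ (k + 1)) g x‖ₑ ≤ lipschitzNorm ζ β g :=
    (mul_le_mul_right (enorm_le_eLpNorm_top_of_continuous hc x) _).trans
      ((le_iSup (fun k : ℕ => ENNReal.ofReal ((2 : ℝ) ^ (β * (k : ℝ))) *
        eLpNorm (freqProj ζ (2 ^ k) (2 ^ (k + 1)) g) ⊤ volume) k).trans (le_max_right _ _))
  have h2 := ENNReal.toReal_mono hL.ne h1
  rw [ENNReal.toReal_mul, ENNReal.toReal_ofReal (by positivity), toReal_enorm, hK] at h2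
  have h3 : (2 : ℝ) ^ (β * (k : ℝ)) * (2 ^ k) ^ (-β) = 1 := by
    rw [← Real.rpow_natCast, ← Real.rpow_mul (by norm_num), ← Real.rpow_add (by norm_num)]
    rw [show β * (k : ℝ) + k * -β = 0 by ring, Real.rpow_zero]
  calc ‖∫ w, K w * g (x - w / 2 ^ k)‖ =
        (2 : ℝ) ^ (β * (k : ℝ)) * ‖∫ w, K w * g (x - w / 2 ^ k)‖ * (2 ^ k) ^ (-β) := by
        rw [mul_right_comm, h3, one_mul]
    _ ≤ _ := mul_le_mul_of_nonneg_right h2 (by positivity)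

/-- Localisation in time costs little: 1 - ψ is at most t², which at t = -w/a is a^{-2}w², and the
moments of K absorb w² and the growth of h. -/
theorem exists_norm_integral_kernel_mul_sub_le (K : SchwartzMap ℝ ℂ) {h : ℝ → ℝ}
    (hc : Continuous h) {B : ℝ} (hB : ∀ t, |h t| ≤ B * (1 + t ^ 2)) {ψ : ℝ → ℝ}
    (hψc : Continuous ψ) (hψ : ∀ t, |1 - ψ t| ≤ t ^ 2) :
    ∃ E : ℝ, 0 ≤ E ∧ ∀ a : ℝ, 1 ≤ a →
      ‖(∫ w, K w * (h (-w / a) : ℂ)) - ∫ w, K w * ((ψ (-w / a) : ℂ) * (h (-w / a) : ℂ))‖ ≤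
        E * a ^ (-2 : ℝ) := by
  have hB0 : 0 ≤ B := by simpa using (abs_nonneg _).trans (hB 0)
  have i2 : Integrable fun w : ℝ => ‖w‖ ^ 2 * ‖K w‖ := K.integrable_pow_mul volume 2
  have i4 : Integrable fun w : ℝ => ‖w‖ ^ 4 * ‖K w‖ := K.integrable_pow_mul volume 4
  have i6 : Integrable fun w : ℝ => ‖w‖ ^ 2 * ‖K w‖ + ‖w‖ ^ 4 * ‖K w‖ := i2.add i4
  have i0 : Integrable fun w : ℝ => ‖K w‖ := K.integrable.norm
  refine ⟨(∫ w : ℝ, (‖w‖ ^ 2 * ‖K w‖ + ‖w‖ ^ 4 * ‖K w‖)) * B,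
    mul_nonneg (integral_nonneg fun w => by positivity) hB0, fun a ha => ?_⟩
  have ha0 : 0 < a := by linarith
  have ht (w : ℝ) : (-w / a) ^ 2 ≤ ‖w‖ ^ 2 := by
    rw [div_pow, neg_sq, Real.norm_eq_abs, sq_abs]
    exact div_le_self (sq_nonneg w) (one_le_pow₀ ha)
  have hdiff (w : ℝ) : ‖K w * (((1 - ψ (-w / a)) * h (-w / a) : ℝ) : ℂ)‖ ≤
      (‖w‖ ^ 2 * ‖K w‖ + ‖w‖ ^ 4 * ‖K w‖) * (B * a ^ (-2 : ℝ)) := by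
    rw [norm_mul, Complex.norm_real, norm_mul, Real.norm_eq_abs (1 - _), Real.norm_eq_abs (h _)]
    have h1 : |1 - ψ (-w / a)| ≤ ‖w‖ ^ 2 * a ^ (-2 : ℝ) := by
      refine (hψ _).trans (le_of_eq ?_)
      rw [Real.rpow_neg ha0.le, Real.rpow_two, div_pow, neg_sq, Real.norm_eq_abs, sq_abs]
      rfl
    have h2 : |h (-w / a)| ≤ B * (1 + ‖w‖ ^ 2) :=
      (hB _).trans (mul_le_mul_of_nonneg_left (by linarith [ht w]) hB0)
    calc ‖K w‖ * (|1 - ψ (-w / a)| * |h (-w / a)|) ≤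
          ‖K w‖ * ((‖w‖ ^ 2 * a ^ (-2 : ℝ)) * (B * (1 + ‖w‖ ^ 2))) := by gcongr
      _ = _ := by ring
  have hid : Integrable fun w => K w * (((1 - ψ (-w / a)) * h (-w / a) : ℝ) : ℂ) :=
    Integrable.mono' (i6.mul_const _) (Continuous.aestronglyMeasurable (by fun_prop))
      (.of_forall hdiff)
  have hih : Integrable fun w => K w * (h (-w / a) : ℂ) := by
    refine Integrable.mono' ((i0.add i2).mul_const B)
      (Continuous.aestronglyMeasurable (by fun_prop)) (.of_forall fun w => ?_)
    rw [norm_mul, Complex.norm_real, Real.norm_eq_abs]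
    calc ‖K w‖ * |h (-w / a)| ≤ ‖K w‖ * (B * (1 + ‖w‖ ^ 2)) :=
          mul_le_mul_of_nonneg_left
            ((hB _).trans (mul_le_mul_of_nonneg_left (by linarith [ht w]) hB0)) (norm_nonneg _)
      _ = _ := by
          simp only [Pi.add_apply]
          ring
  have heq : (∫ w, K w * (h (-w / a) : ℂ)) - ∫ w, K w * ((ψ (-w / a) : ℂ) * (h (-w / a) : ℂ)) =
      ∫ w, K w * (((1 - ψ (-w / a)) * h (-w / a) : ℝ) : ℂ) := by
    have h3 : (fun w => K w * ((ψ (-w / a) : ℂ) * (h (-w / a) : ℂ))) = fun w =>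
        K w * (h (-w / a) : ℂ) - K w * (((1 - ψ (-w / a)) * h (-w / a) : ℝ) : ℂ) := by
      funext w
      push_cast
      ring
    rw [h3, integral_sub hih hid, sub_sub_cancel]
  rw [heq, mul_assoc, ← integral_mul_const]
  exact norm_integral_le_of_norm_le (i6.mul_const _) (.of_forall hdiff)

theorem exists_cutoff : ∃ ψ : ℝ → ℝ, ContDiff ℝ ∞ ψ ∧ HasCompactSupport ψ ∧
    (∀ t, |ψ t| ≤ 1) ∧ ∀ t, |1 - ψ t| ≤ t ^ 2 := by
  let b : ContDiffBump (0 : ℝ) := ⟨1, 2, one_pos, one_lt_two⟩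
  refine ⟨b, b.contDiff, b.hasCompactSupport, fun t => ?_, fun t => ?_⟩
  · rw [abs_of_nonneg b.nonneg]
    exact b.le_one
  · rcases le_total |t| 1 with h | h
    · rw [b.one_of_mem_closedBall (by simpa using h), sub_self, abs_zero]
      positivity
    · rw [abs_of_nonneg (sub_nonneg.2 b.le_one), ← sq_abs]
      have := b.nonneg (x := t)
      nlinarith

theorem not_forall_mul_rpow_le {κ M γ β : ℝ} (hκ : 0 < κ) (hγβ : γ < β) :
    ¬ ∀ k : ℕ, κ * ((2 : ℝ) ^ k) ^ (-γ) ≤ M * ((2 : ℝ) ^ k) ^ (-β) := by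
  intro h
  have h1 : Filter.Tendsto (fun k : ℕ => M * ((2 : ℝ) ^ k) ^ (-(β - γ))) Filter.atTop (nhds 0) := by
    have := ((tendsto_rpow_neg_atTop (by linarith : 0 < β - γ)).comp
      (tendsto_pow_atTop_atTop_of_one_lt (one_lt_two (α := ℝ)))).const_mul M
    simpa using this
  refine absurd (ge_of_tendsto h1 (.of_forall fun k => ?_)) (not_le.2 hκ)
  have h0 : (0 : ℝ) < 2 ^ k := by positivity
  have h2 : ((2 : ℝ) ^ k) ^ (-γ) * ((2 : ℝ) ^ k) ^ γ = 1 := by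
    rw [← Real.rpow_add h0, neg_add_cancel, Real.rpow_zero]
  have h3 : ((2 : ℝ) ^ k) ^ (-β) * ((2 : ℝ) ^ k) ^ γ = ((2 : ℝ) ^ k) ^ (-(β - γ)) := by
    rw [← Real.rpow_add h0]
    congr 1
    ring
  calc κ = κ * ((2 : ℝ) ^ k) ^ (-γ) * ((2 : ℝ) ^ k) ^ γ := by rw [mul_assoc, h2, mul_one]
    _ ≤ M * ((2 : ℝ) ^ k) ^ (-β) * ((2 : ℝ) ^ k) ^ γ :=
        mul_le_mul_of_nonneg_right (h k) (by positivity)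
    _ = _ := by rw [mul_assoc, h3]

/-- Take R² = 2^k in the lower bound for the pair integral. The choice r = 1 gives γ = δ + p/2 and
the choice r = R gives γ = δ + p - n/2. -/
theorem exists_le_norm_integral_kernel_mul_dispersion {n : ℕ} (hn : 1 ≤ n) {δ p : ℝ} (hδ₀ : 0 < δ)
    (hδ₁ : δ < 1) (hp : n + 2 * δ < 2 * p) {ζ : ℝ → ℝ} (hζ : IsCutoff ζ) {K : SchwartzMap ℝ ℂ}
    (hKF : ∀ ξ, 𝓕 (K : ℝ → ℂ) ξ = radialCutoff ζ (3 / 2) ξ) (hK0 : ∫ w, K w = 0) :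
    ∃ f : L2 n, MemSigma δ f ∧ ∃ κ : ℝ, 0 < κ ∧ ∀ γ : ℝ,
      γ = δ + p / 2 ∨ γ = δ + p - n / 2 → ∀ k : ℕ,
        κ * ((2 : ℝ) ^ k) ^ (-γ) ≤ ‖∫ w, K w * (dispersion δ f (-w / 2 ^ k) : ℂ)‖ := by
  obtain ⟨f, hf, hfF⟩ := exists_memSigma_fourier_eq_powerProfile hn hδ₀ hδ₁ hp
  obtain ⟨c, hc⟩ : ∃ c, IsGagliardoConstant n δ c := exists_oscillationMoment_eq hn hδ₀ hδ₁
  have hc0 := hc.1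
  have hp0 : 0 ≤ p := by
    have : (0 : ℝ) ≤ n := Nat.cast_nonneg n
    linarith
  obtain ⟨κ, hκ, hlow⟩ := exists_le_lintegral_powerProfile hn hδ₀ hp0 hζ
  refine ⟨f, hf, 2 * κ / c, by positivity, fun γ hγ k => ?_⟩
  have ha : (1 : ℝ) ≤ 2 ^ k := one_le_pow₀ one_le_two
  obtain ⟨hint, heq⟩ := hc.integral_kernel_mul_dispersion hn hδ₀ hδ₁ hf hfF hKF hK0 ha
  set R : ℝ := Real.sqrt (2 ^ k) with hR
  have hR1 : 1 ≤ R := Real.one_le_sqrt.2 ha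
  have hR0 : 0 < R := by linarith
  have hR2 : R ^ 2 = 2 ^ k := Real.sq_sqrt (by positivity)
  have hRγ : ((2 : ℝ) ^ k) ^ (-γ) = R ^ (-(2 * γ)) := by
    rw [← hR2, ← Real.rpow_natCast, ← Real.rpow_mul hR0.le]
    congr 1
    push_cast
    ring
  rw [← hR2] at hint heq
  have hnn (q : EuclideanSpace ℝ (Fin n) × EuclideanSpace ℝ (Fin n)) :
      0 ≤ powerProfile p q.1 * powerProfile p q.2 *
        ζ (|(‖q.1‖ ^ 2 - ‖q.2‖ ^ 2) / (2 * R ^ 2)| - 3 / 2) :=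
    mul_nonneg (mul_pos (powerProfile_pos p _) (powerProfile_pos p _)).le (hζ.nonneg _)
  set I := ∫ q, powerProfile p q.1 * powerProfile p q.2 *
    ζ (|(‖q.1‖ ^ 2 - ‖q.2‖ ^ 2) / (2 * R ^ 2)| - 3 / 2) ∂gagliardoMeasure n δ with hI
  have hI0 : 0 ≤ I := integral_nonneg hnn
  have hIe := ofReal_integral_eq_lintegral_ofReal hint (.of_forall hnn)
  have key : κ * ((2 : ℝ) ^ k) ^ (-γ) ≤ I := by
    rw [← ENNReal.ofReal_le_ofReal_iff hI0, hIe, hRγ]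
    rcases hγ with rfl | rfl
    · have h := hlow R 1 le_rfl hR1
      rw [Real.one_rpow, mul_one] at h
      rwa [show 2 * (δ + p / 2) = 2 * δ + p by ring]
    · have h := hlow R R hR1 le_rfl
      rw [← Real.rpow_add hR0] at h
      rwa [show -(2 * (δ + p - n / 2)) = -(2 * δ + p) + (n - p) by ring]
  have hnorm : c * ‖∫ w, K w * (dispersion δ f (-w / 2 ^ k) : ℂ)‖ = 2 * I := by
    have h := congrArg norm heq
    rw [hR2, norm_mul, Complex.norm_real, Complex.norm_real, Real.norm_of_nonneg hc0.le, norm_mul,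
      Real.norm_of_nonneg hI0] at h
    rw [h]
    norm_num
  rw [div_mul_eq_mul_div, div_le_iff₀ hc0, mul_comm _ c, hnorm]
  linarith

/-- Membership in Λ^β would force 2^{-γk} to be at most a constant times 2^{-βk} + 2^{-2k} for all
k, with γ < min(β, 2), which fails for large k. -/
theorem exists_not_memLipschitz {n : ℕ} (hn : 1 ≤ n) {δ β : ℝ} (hδ₀ : 0 < δ) (hδ₁ : δ < 1)
    {ζ : ℝ → ℝ} (hζ : IsCutoff ζ) (hβ : criticalExponent n δ < β) :
    ∃ f : L2 n, MemSigma δ f ∧ ∃ ψ : ℝ → ℂ, ContDiff ℝ ∞ ψ ∧ HasCompactSupport ψ ∧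
      ¬ MemLipschitz ζ β (fun t => ψ t * (dispersion δ f t : ℂ)) := by
  obtain ⟨K, hKF, -, hK⟩ := hζ.exists_dyadic_kernel
  have hK0 : ∫ w, K w = 0 := integral_kernel_eq_zero (by
    rw [hKF, hζ.radialCutoff_three_halves]
    simp)
  -- The exponent is capped at 2 because the localisation error is of order 2^{-2k}; the critical
  -- exponent is below 2 since δ < 1.
  have hcrit : criticalExponent n δ < min β 2 := by
    refine lt_min hβ ?_
    unfold criticalExponent
    split_ifs <;> linarith
  set ε := (min β 2 - criticalExponent n δ) / 2 with hε
  have hε0 : 0 < ε := by linarith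
  -- The excess ε keeps f in Σ_δ. The resulting γ is 2δ + ε, or 1/4 + 3δ/2 + ε/2 if n = 1 and δ >
  -- 1/2; both stay below min(β, 2), since ε is half the gap.
  set p : ℝ := n / 2 + δ + ε with hp
  obtain ⟨γ, hγ, hγβ⟩ : ∃ γ, (γ = δ + p / 2 ∨ γ = δ + p - n / 2) ∧ γ < min β 2 := by
    by_cases h : n = 1 ∧ 1 / 2 < δ
    · refine ⟨_, Or.inl rfl, ?_⟩
      have h1 : criticalExponent n δ = 1 / 4 + 3 / 2 * δ := if_pos h
      have h2 : (n : ℝ) = 1 := by exact_mod_cast h.1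
      rw [hp, h2]
      linarith
    · refine ⟨_, Or.inr rfl, ?_⟩
      have h1 : criticalExponent n δ = 2 * δ := if_neg h
      rw [hp]
      linarith
  obtain ⟨f, hf, κ, hκ, hlow⟩ := exists_le_norm_integral_kernel_mul_dispersion hn hδ₀ hδ₁
    (p := p) (by rw [hp]; linarith) hζ hKF hK0
  obtain ⟨ψ, hψ, hψc, hψ1, hψ2⟩ := exists_cutoff
  obtain ⟨α, hα⟩ := exists_isRegularityExponent hn δ
  have hcont := continuous_dispersion hn hδ₀ hδ₁ hα hf
  obtain ⟨B, hB0, hB⟩ := exists_dispersion_le_one_add_sq hn hδ₀ hδ₁ hf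
  obtain ⟨E, hE0, hE⟩ := exists_norm_integral_kernel_mul_sub_le K hcont (B := B)
    (fun t => by rw [abs_of_nonneg (dispersion_nonneg _ _ _)]; exact hB t) hψ.continuous hψ2
  refine ⟨f, hf, fun t => (ψ t : ℂ), Complex.ofRealCLM.contDiff.comp hψ,
    hψc.comp_left Complex.ofReal_zero, fun hmem => ?_⟩
  have hgc : Continuous fun t => (ψ t : ℂ) * (dispersion δ f t : ℂ) := by
    have := hψ.continuous
    fun_prop
  have hgs : HasCompactSupport fun t => (ψ t : ℂ) * (dispersion δ f t : ℂ) :=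
    (hψc.comp_left (g := fun x : ℝ => (x : ℂ)) Complex.ofReal_zero).mul_right
  obtain ⟨A, hA⟩ := hgs.exists_bound_of_continuous hgc
  set L := (lipschitzNorm ζ β fun t => (ψ t : ℂ) * (dispersion δ f t : ℂ)).toReal with hL
  have hL0 : 0 ≤ L := ENNReal.toReal_nonneg
  refine not_forall_mul_rpow_le (M := L + E) hκ hγβ fun k => ?_
  have ha : (1 : ℝ) ≤ 2 ^ k := one_le_pow₀ one_le_two
  have h1 := norm_freqProj_le hK hgc hA hmem.2 k 0
  simp only [zero_sub, ← neg_div] at h1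
  have h2 := hE _ ha
  have h3 := norm_sub_norm_le (∫ w, K w * (dispersion δ f (-w / 2 ^ k) : ℂ))
    (∫ w, K w * ((ψ (-w / 2 ^ k) : ℂ) * (dispersion δ f (-w / 2 ^ k) : ℂ)))
  have h4 : ((2 : ℝ) ^ k) ^ (-β) ≤ (2 ^ k) ^ (-min β 2) :=
    Real.rpow_le_rpow_of_exponent_le ha (neg_le_neg (min_le_left _ _))
  have h5 : ((2 : ℝ) ^ k) ^ (-2 : ℝ) ≤ (2 ^ k) ^ (-min β 2) :=
    Real.rpow_le_rpow_of_exponent_le ha (neg_le_neg (min_le_right _ _))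
  have h6 := mul_le_mul_of_nonneg_left h4 hL0
  have h7 := mul_le_mul_of_nonneg_left h5 hE0
  have h8 := hlow γ hγ k
  rw [add_mul]
  linarith

end SchrodingerDispersion

theorem mainTheorem6 (n : ℕ) (hn : 1 ≤ n) (δ : ℝ) (hδ₀ : 0 < δ) (hδ₁ : δ < 1)
    (ζ : ℝ → ℝ) (hζ : SchrodingerDispersion.IsCutoff ζ) :
    -- the functional is finite at every time
    (∀ f : SchrodingerDispersion.L2 n, SchrodingerDispersion.MemSigma δ f →
      ∀ t : ℝ, Integrable (SchrodingerDispersion.dispersionDensity δ f t) volume) ∧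
    -- regularity
    (∀ α : ℝ, SchrodingerDispersion.IsRegularityExponent n δ α →
      ∀ ψ : ℝ → ℂ, ContDiff ℝ ∞ ψ → HasCompactSupport ψ →
        ∃ C : ℝ≥0, ∀ f : SchrodingerDispersion.L2 n, SchrodingerDispersion.MemSigma δ f →
          SchrodingerDispersion.MemLipschitz ζ α
            (fun t => ψ t * (SchrodingerDispersion.dispersion δ f t : ℂ)) ∧
          SchrodingerDispersion.lipschitzNorm ζ α
            (fun t => ψ t * (SchrodingerDispersion.dispersion δ f t : ℂ)) ≤
              (C : ℝ≥0∞) * SchrodingerDispersion.sigmaNormSq δ f) ∧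
    -- sharpness
    (∀ β : ℝ, SchrodingerDispersion.criticalExponent n δ < β →
      ∃ f : SchrodingerDispersion.L2 n, SchrodingerDispersion.MemSigma δ f ∧
        ∃ ψ : ℝ → ℂ, ContDiff ℝ ∞ ψ ∧ HasCompactSupport ψ ∧
          ¬ SchrodingerDispersion.MemLipschitz ζ β
            (fun t => ψ t * (SchrodingerDispersion.dispersion δ f t : ℂ))) ∧
    -- continuous differentiability
    (1 / 2 < δ → ∀ f : SchrodingerDispersion.L2 n, SchrodingerDispersion.MemSigma δ f →
      ContDiff ℝ 1 (SchrodingerDispersion.dispersion δ f)) := by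
  obtain ⟨c, hc⟩ : ∃ c, SchrodingerDispersion.IsGagliardoConstant n δ c :=
    SchrodingerDispersion.exists_oscillationMoment_eq hn hδ₀ hδ₁
  exact ⟨fun f hf t => hc.integrable_dispersionDensity hn hδ₀ hδ₁ hf t,
    fun α hα ψ hψ hψc =>
      SchrodingerDispersion.exists_memLipschitz hn hδ₀ hδ₁ hζ hα hψ hψc,
    fun β hβ => SchrodingerDispersion.exists_not_memLipschitz hn hδ₀ hδ₁ hζ hβ,
    fun hδ f hf => SchrodingerDispersion.contDiff_one_dispersion hn hδ hδ₁ hf⟩
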